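/- Let $B$ and $W$ be standard Brownian motions (started at $0$) with respect to a common filtration on a probability space, with $\langle W,B\rangle_t=\rho t$, $-1\le\rho\le 1$. Let $\mu,\gamma,r_0\in\mathbb R$ and $\sigma,\kappa,\delta,V_0>0$. The stock follows the Black–Scholes model $dS_t=\mu S_t\,dt+\sigma S_t\,dB_t$, the short rate follows the Vasicek model $$dr_t=\kappa(\gamma-r_t)\,dt+\delta\,dW_t$$ started at $r_0$, and for $\alpha\in[0,1]$ the wealth $V_t=V^{(\alpha)}_t$ of an investor who keeps the constant fraction $\alpha$ of the wealth in the stock and the rest in the bond is the solution, started at $V_0$, of $$dV_t=\alpha\mu V_t\,dt+\alpha\sigma V_t\,dB_t+(1-\alpha)r_tV_t\,dt .$$ Let $u(c)=c^{\theta}/\theta$ with $\theta\in(0,1)$ (relative risk aversion $1-\theta$). Then, for every $\alpha\in[0,1]$, almost surely $V_t>0$ for all $t\ge 0$; moreover $E[u(V_t)]<\infty$ for every $t\ge 0$, the limit $\Lambda(\alpha)=\lim_{t\to\infty}\frac1t\log E[u(V_t)]$ exists, and $$\Lambda(\alpha)=\kappa\gamma\Big(\tfrac{\theta(1-\alpha)}{\kappa}+\tfrac{\theta\alpha\sigma\rho}{\delta}\Big)+\tfrac{\delta^2}{2}\Big(\tfrac{\theta(1-\alpha)}{\kappa}+\tfrac{\theta\alpha\sigma\rho}{\delta}\Big)^2-\tfrac{\theta\alpha\sigma\kappa\gamma\rho}{\delta}+\tfrac12\theta^2\alpha^2\sigma^2(1-\rho^2)+\theta\alpha\mu-\tfrac12\theta\alpha^2\sigma^2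 .$$ A point $\alpha^*\in[0,1]$ that maximizes $\Lambda$ over $[0,1]$ is given as follows. (i) If $\frac{\delta^2\theta}{2\kappa^2}-\frac{\delta\theta\sigma\rho}{\kappa}+\frac{\sigma^2\theta}{2}-\frac{\sigma^2}{2}\ge 0$, then $\alpha^*=0$ when $\gamma+\frac{\delta^2\theta}{2\kappa^2}\ge\frac12(\theta-1)\sigma^2+\mu$, and $\alpha^*=1$ when $\gamma+\frac{\delta^2\theta}{2\kappa^2}<\frac12(\theta-1)\sigma^2+\mu$. The maximizer is unique unless $\gamma+\frac{\delta^2\theta}{2\kappa^2}=\frac12(\theta-1)\sigma^2+\mu$, in which case uniqueness is not asserted. (ii) Otherwise the maximizer is unique, and with $$\alpha^\dagger=\frac{-\gamma\theta+\theta\mu+\frac{\delta\theta^2\sigma\rho}{\kappa}-\frac{\delta^2\theta^2}{\kappa^2}}{2\theta\Big[-\frac{\delta^2\theta}{2\kappa^2}+\frac{\delta\theta\sigma\rho}{\kappa}-\frac{\sigma^2\theta}{2}+\frac{\sigma^2}{2}\Big]}$$ one has $\alpha^*=1$ if $\alpha^\dagger\ge1$, $\alpha^*=\alpha^\dagger$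 if $\alpha^\dagger\in(0,1)$, and $\alpha^*=0$ if $\alpha^\dagger\le0$. -/

import Mathlib

open MeasureTheory ProbabilityTheory Filter Topology Set
open scoped NNReal

noncomputable section

namespace LongTermGrowth

variable {Ω : Type*} {mΩ : MeasurableSpace Ω}

/-- `B` is a standard Brownian motion (started at `0`) relative to the filtration `F`: it is a
Brownian motion, it is adapted, and `B t - B s` is independent of `F s` whenever `s ≤ t`. -/
structure IsBrownianWrt (F : Filtration ℝ≥0 mΩ) (P : Measure Ω) (B : ℝ≥0 → Ω → ℝ) : Prop where
  brownian : IsBrownianReal B P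
  adapted : StronglyAdapted F B
  indep : ∀ s t : ℝ≥0, s ≤ t →
    Indep (MeasurableSpace.comap (fun ω => B t ω - B s ω) inferInstance) (F s) P

/-- The cross variation of the continuous square-integrable `F`-martingales `X` and `Y`
is `⟨X, Y⟩ t = ρ t`, i.e. `X Y - ρ t` is an `F`-martingale. -/
def HasCrossVariation (F : Filtration ℝ≥0 mΩ) (P : Measure Ω) (X Y : ℝ≥0 → Ω → ℝ) (ρ : ℝ) : Prop :=
  Martingale (fun (t : ℝ≥0) ω => X t ω * Y t ω - ρ * (t : ℝ)) F P

/-- A finite partition `0 = pt 0 ≤ pt 1 ≤ ⋯ ≤ pt n = t` of `[0, t]`. -/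
structure TimePartition (t : ℝ≥0) where
  n : ℕ
  pt : ℕ → ℝ≥0
  mono : Monotone pt
  pt_zero : pt 0 = 0
  pt_last : pt n = t

/-- The largest step of a partition. -/
def TimePartition.mesh {t : ℝ≥0} (π : TimePartition t) : ℝ≥0 :=
  (Finset.range π.n).sup fun i => π.pt (i + 1) - π.pt i

/-- The left-endpoint sum `∑ X_{t_i} (B_{t_{i+1}} - B_{t_i})` along a partition. -/
def TimePartition.leftSum {t : ℝ≥0} (π : TimePartition t) (X B : ℝ≥0 → Ω → ℝ) (ω : Ω) : ℝ :=
  ∑ i ∈ Finset.range π.n, X (π.pt i) ω * (B (π.pt (i + 1)) ω - B (π.pt i) ω)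

/-- `I t = ∫₀ᵗ X dB` in the sense of Itô, for a continuous adapted integrand `X` and a Brownian
motion `B`: for every `t`, the left-endpoint sums converge in probability to `I t` along every
sequence of partitions of `[0, t]` whose mesh tends to `0`. -/
def IsItoIntegral (P : Measure Ω) (X B I : ℝ≥0 → Ω → ℝ) : Prop :=
  ∀ (t : ℝ≥0) (π : ℕ → TimePartition t), Tendsto (fun k => (π k).mesh) atTop (𝓝 0) →
    TendstoInMeasure P (fun k => (π k).leftSum X B) atTop (I t)

/-- `r` is a Vasicek short rate: a continuous adapted solution of
`dr = κ (γ - r) dt + δ dW` with `r 0 = r₀`. -/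
structure IsVasicek (F : Filtration ℝ≥0 mΩ) (P : Measure Ω) (W : ℝ≥0 → Ω → ℝ)
    (κ γ δ r₀ : ℝ) (r : ℝ≥0 → Ω → ℝ) : Prop where
  adapted : StronglyAdapted F r
  cont : ∀ᵐ ω ∂P, Continuous fun t => r t ω
  eqn : ∀ t : ℝ≥0, ∀ᵐ ω ∂P,
    r t ω = r₀ + (∫ s in (0 : ℝ)..t, κ * (γ - r s.toNNReal ω)) + δ * W t ω

/-- `V` is the wealth of an investor who keeps the constant fraction `α` of the wealth in the
stock `dS = μ S dt + σ S dB` and the rest in the bond with short rate `r`: a continuous adapted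
solution of `dV = α μ V dt + α σ V dB + (1 - α) r V dt` with `V 0 = V₀`. -/
structure IsWealth (F : Filtration ℝ≥0 mΩ) (P : Measure Ω) (B r : ℝ≥0 → Ω → ℝ)
    (μ σ V₀ α : ℝ) (V : ℝ≥0 → Ω → ℝ) : Prop where
  adapted : StronglyAdapted F V
  cont : ∀ᵐ ω ∂P, Continuous fun t => V t ω
  eqn : ∃ I : ℝ≥0 → Ω → ℝ, IsItoIntegral P (fun t ω => α * σ * V t ω) B I ∧
    ∀ t : ℝ≥0, ∀ᵐ ω ∂P,
      V t ω = V₀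
        + (∫ s in (0 : ℝ)..t,
            (α * μ * V s.toNNReal ω + (1 - α) * r s.toNNReal ω * V s.toNNReal ω))
        + I t ω

/-- The HARA utility `c ^ (1 - η) / (1 - η)` with constant relative risk aversion `η`. -/
def haraUtility (η c : ℝ) : ℝ := c ^ (1 - η) / (1 - η)

/-- `a` maximizes `Λ` over `[0, 1]`. -/
def IsOptimal (Λ : ℝ → ℝ) (a : ℝ) : Prop :=
  a ∈ Icc (0 : ℝ) 1 ∧ ∀ b ∈ Icc (0 : ℝ) 1, Λ b ≤ Λ a

/-- `a` is the only maximizer of `Λ` over `[0, 1]`. -/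
def IsUniqueOptimal (Λ : ℝ → ℝ) (a : ℝ) : Prop :=
  IsOptimal Λ a ∧ ∀ b, IsOptimal Λ b → b = a

end LongTermGrowth

end

/-! Put `a = α σ`. The wealth equation is linear, so its solution is `V_t = V₀ exp (a B_t - a² t / 2
+ α μ t + (1 - α) ∫ r)`, and positivity is immediate. Integrating the Vasicek equation gives `∫ r =
(r₀ + κ γ t + δ W_t - r_t) / κ`. Hence `E[u(V_t)] = K exp (β t) E[exp (X_t + Y_t)]` with constants
`K` and `β`, where `X = l₁ B + l₂ W` and `Y = -(θ (1 - α) / κ) r`. The first term has `E[exp (c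
X_t)] = exp (c² Q t / 2)` with `Q = l₁² + 2 ρ l₁ l₂ + l₂²`. The second has exponential moments
bounded uniformly in `t`, because `r` is mean reverting. Hölder's inequality with exponents close to
`1` for `X` shows that `Y` does not affect the rate, so `Λ = β + Q / 2`. This is a quadratic
polynomial in `α`, and the rest is the maximization of a parabola on `[0, 1]`.

Two probabilistic facts are obtained by discretization, since the Itô integral is only given as a
limit in probability of left-endpoint sums.

The closed form (`linear_sde_unique`): with `U` the inverse of the stochastic exponential, `U V` is
shown to be constant. On a grid its increment is expanded to second order. What remains are sums of
the type `∑ U (∫ a V dB - a V ΔB)` and `∑ U V ((ΔB)² - Δt)`. They are sums of products of a small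
past-measurable coefficient and a centred independent noise, hence negligible by the `L²` estimate
`tendstoInMeasure_block_sum`. A Borel-Cantelli argument and a common subsequence make the estimate
pathwise (`path_mul_eq_of_euler`).

The joint exponential moment (`integral_exp_pair`): joint normality of `B` and `W` is not a
hypothesis; only their cross variation is given. Taylor expansion over a step of length `h` shows
that `φ t = E[exp (l₁ B_t + l₂ W_t)]` satisfies `φ (s + h) = (1 + Q h / 2) φ s + O(h^(3/2))`, which
forces `φ t = exp (Q t / 2)`. -/

noncomputable section

namespace LongTermGrowth

variable {Ω : Type*} {mΩ : MeasurableSpace Ω}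

/-! ### Discrete stochastic sums: orthogonality and `L²` bounds. -/

/-- `ξ i` is a centred square-integrable noise, independent of the past `G i` and known at
time `i + 1`, with second moment at most `v`. -/
structure IsNoise (G : ℕ → MeasurableSpace Ω) (P : Measure Ω) (ξ : ℕ → Ω → ℝ) (v : ℝ) : Prop where
  mono : Monotone G
  le : ∀ i, G i ≤ mΩ
  meas : ∀ i, Measurable[G (i + 1)] (ξ i)
  memLp : ∀ i, MemLp (ξ i) 2 P
  mean : ∀ i, ∫ ω, ξ i ω ∂P = 0
  indep : ∀ i, Indep (MeasurableSpace.comap (ξ i) inferInstance) (G i) P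
  var_le : ∀ i, ∫ ω, ξ i ω ^ 2 ∂P ≤ v

theorem IsNoise.shift {G : ℕ → MeasurableSpace Ω} {P : Measure Ω} {ξ : ℕ → Ω → ℝ} {v : ℝ}
    (h : IsNoise G P ξ v) (k : ℕ) :
    IsNoise (fun i => G (k + i)) P (fun i => ξ (k + i)) v where
  mono := fun _ _ hij => h.mono (by omega)
  le := fun i => h.le _
  meas := fun i => h.meas _
  memLp := fun i => h.memLp _
  mean := fun i => h.mean _
  indep := fun i => h.indep _
  var_le := fun i => h.var_le _

theorem indepFun_of_indep_of_measurable {P : Measure Ω} {m : MeasurableSpace Ω} {X Y : Ω → ℝ}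
    (h : Indep (MeasurableSpace.comap X inferInstance) m P) (hY : Measurable[m] Y) :
    IndepFun X Y P := by
  rw [IndepFun_iff_Indep]
  exact indep_of_indep_of_le_right h hY.comap_le

/-- A discrete Itô isometry. The earlier partial sum times `K N` is `G N`-measurable, hence
independent of the centred `ξ N`, so the cross term in the square vanishes and the variances add up.
-/
theorem IsNoise.sum_mul {G : ℕ → MeasurableSpace Ω} {P : Measure Ω} [IsProbabilityMeasure P]
    {ξ : ℕ → Ω → ℝ} {v : ℝ} (h : IsNoise G P ξ v) {K : ℕ → Ω → ℝ} {η : ℝ}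
    (hK : ∀ i, Measurable[G i] (K i)) (hb : ∀ i ω, |K i ω| ≤ η) (N : ℕ) :
    Measurable[G N] (fun ω => ∑ i ∈ Finset.range N, K i ω * ξ i ω) ∧
    MemLp (fun ω => ∑ i ∈ Finset.range N, K i ω * ξ i ω) 2 P ∧
    ∫ ω, (∑ i ∈ Finset.range N, K i ω * ξ i ω) ^ 2 ∂P ≤ η ^ 2 * (N * v) := by
  induction N with
  | zero => simp
  | succ N ih =>
    obtain ⟨ih1, ih2, ih3⟩ := ih
    have hKξ : MemLp (fun ω => K N ω * ξ N ω) 2 P := by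
      refine ((h.memLp N).const_mul η).mono ?_ ?_
      · exact (((hK N).mono (h.le N) le_rfl).aestronglyMeasurable).mul (h.memLp N).1
      · refine ae_of_all _ fun ω => ?_
        rw [norm_mul, norm_mul]
        gcongr
        exact (hb N ω).trans (le_abs_self η)
    refine ⟨?_, ?_, ?_⟩
    · simp_rw [Finset.sum_range_succ]
      exact (ih1.mono (h.mono N.le_succ) le_rfl).add
        (((hK N).mono (h.mono N.le_succ) le_rfl).mul (h.meas N))
    · simp_rw [Finset.sum_range_succ]
      exact ih2.add hKξ
    · set M : Ω → ℝ := fun ω => ∑ i ∈ Finset.range N, K i ω * ξ i ω with hM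
      have hMK : Measurable[G N] (fun ω => M ω * K N ω) := ih1.mul (hK N)
      have hind : IndepFun (ξ N) (fun ω => M ω * K N ω) P :=
        indepFun_of_indep_of_measurable (h.indep N) hMK
      have hcross : ∫ ω, ξ N ω * (M ω * K N ω) ∂P = 0 := by
        rw [hind.integral_fun_mul_eq_mul_integral (h.memLp N).1
          (hMK.mono (h.le N) le_rfl).aestronglyMeasurable, h.mean N, zero_mul]
      have hcrossI : Integrable (fun ω => M ω * (K N ω * ξ N ω)) P := ih2.integrable_mul hKξ
      have hsq : ∫ ω, (K N ω * ξ N ω) ^ 2 ∂P ≤ η ^ 2 * v := by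
        calc ∫ ω, (K N ω * ξ N ω) ^ 2 ∂P ≤ ∫ ω, η ^ 2 * ξ N ω ^ 2 ∂P := by
              refine integral_mono hKξ.integrable_sq ((h.memLp N).integrable_sq.const_mul _) ?_
              intro ω
              simp only [mul_pow]
              have : K N ω ^ 2 ≤ η ^ 2 := sq_le_sq.mpr ((hb N ω).trans (le_abs_self η))
              gcongr
          _ = η ^ 2 * ∫ ω, ξ N ω ^ 2 ∂P := integral_const_mul _ _
          _ ≤ η ^ 2 * v := by gcongr; exact h.var_le N
      have hexp : ∀ ω, (∑ i ∈ Finset.range (N + 1), K i ω * ξ i ω) ^ 2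
          = M ω ^ 2 + 2 * (M ω * (K N ω * ξ N ω)) + (K N ω * ξ N ω) ^ 2 := by
        intro ω
        rw [Finset.sum_range_succ]
        simp only [hM]
        ring
      have hc2 : ∫ ω, M ω * (K N ω * ξ N ω) ∂P = 0 := by
        rw [← hcross]
        exact integral_congr_ae (ae_of_all _ fun ω => by ring)
      simp_rw [hexp]
      have hadd : Integrable (fun ω => M ω ^ 2 + 2 * (M ω * (K N ω * ξ N ω))) P :=
        ih2.integrable_sq.add (hcrossI.const_mul 2)
      rw [integral_add hadd hKξ.integrable_sq, integral_add ih2.integrable_sq (hcrossI.const_mul 2), integral_const_mul, hc2]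
      push_cast
      linarith

/-- Sums of squared block sums `∑ K ξ` of a noise tend to `0` in measure if the
coefficients `K` tend uniformly to `0` and the total variance stays bounded. -/
theorem tendstoInMeasure_block_sum {P : Measure Ω} [IsProbabilityMeasure P] {a b : ℕ → ℕ}
    {G : ℕ → ℕ → MeasurableSpace Ω} {ξ K : ℕ → ℕ → Ω → ℝ} {v : ℕ → ℝ} {C : ℝ}
    (h : ∀ n, IsNoise (G n) P (ξ n) (v n)) (hK : ∀ n i, Measurable[G n i] (K n i))
    (hC : ∀ n, a n * (b n * v n) ≤ C)
    (hsup : ∀ᵐ ω ∂P, ∀ ε > 0, ∀ᶠ n in atTop, ∀ i < a n * b n, |K n i ω| ≤ ε) :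
    TendstoInMeasure P (fun n ω => ∑ i ∈ Finset.range (a n),
      (∑ j ∈ Finset.range (b n), K n (i * b n + j) ω * ξ n (i * b n + j) ω) ^ 2) atTop
      (fun _ => 0) := by
  rw [tendstoInMeasure_iff_measureReal_norm]
  intro ε hε
  simp only [sub_zero]
  have key : ∀ η > 0, ∀ n, P.real {ω | ε ≤ ‖∑ i ∈ Finset.range (a n),
      (∑ j ∈ Finset.range (b n), K n (i * b n + j) ω * ξ n (i * b n + j) ω) ^ 2‖}
      ≤ P.real {ω | ∃ i < a n * b n, η < |K n i ω|} + η ^ 2 * C / ε := by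
    intro η hη n
    classical
    -- The coefficients are only small pathwise, so they need not be bounded as the `L²` estimate
    -- requires. Cutting them off at `η` keeps them measurable with respect to the past and changes
    -- the sum only where some coefficient exceeds `η`, an event whose probability tends to `0`.
    set L : ℕ → Ω → ℝ := fun i ω => if |K n i ω| ≤ η then K n i ω else 0 with hL
    have hLm : ∀ i, Measurable[G n i] (L i) := by
      intro i
      have hms : MeasurableSet[G n i] {ω | |K n i ω| ≤ η} :=
        (measurable_abs.comp (hK n i)) measurableSet_Iic
      exact Measurable.ite hms (hK n i) measurable_const
    have hLb : ∀ i ω, |L i ω| ≤ η := by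
      intro i ω
      simp only [hL]
      split_ifs with h1
      · exact h1
      · simpa using hη.le
    have hblock : ∀ i, Integrable (fun ω =>
        (∑ j ∈ Finset.range (b n), L (i * b n + j) ω * ξ n (i * b n + j) ω) ^ 2) P ∧
        ∫ ω, (∑ j ∈ Finset.range (b n), L (i * b n + j) ω * ξ n (i * b n + j) ω) ^ 2 ∂P
          ≤ η ^ 2 * (b n * v n) := by
      intro i
      obtain ⟨-, h2, h3⟩ := ((h n).shift (i * b n)).sum_mul (K := fun j => L (i * b n + j))
        (fun j => hLm _) (fun j => hLb _) (b n)
      exact ⟨h2.integrable_sq, h3⟩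
    set Y : Ω → ℝ := fun ω => ∑ i ∈ Finset.range (a n),
      (∑ j ∈ Finset.range (b n), L (i * b n + j) ω * ξ n (i * b n + j) ω) ^ 2 with hY
    have hY0 : ∀ ω, 0 ≤ Y ω := fun ω => Finset.sum_nonneg fun i _ => sq_nonneg _
    have hYint : Integrable Y P := integrable_finsetSum _ fun i _ => (hblock i).1
    have hYle : ∫ ω, Y ω ∂P ≤ η ^ 2 * C := by
      simp only [hY]
      rw [integral_finsetSum _ fun i _ => (hblock i).1]
      calc _ ≤ ∑ i ∈ Finset.range (a n), η ^ 2 * (b n * v n) :=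
            Finset.sum_le_sum fun i _ => (hblock i).2
        _ = η ^ 2 * (a n * (b n * v n)) := by
            rw [Finset.sum_const, Finset.card_range, nsmul_eq_mul]; ring
        _ ≤ η ^ 2 * C := by gcongr; exact hC n
    have hmark : P.real {ω | ε ≤ Y ω} ≤ η ^ 2 * C / ε := by
      rw [le_div_iff₀ hε, mul_comm]
      exact (mul_meas_ge_le_integral_of_nonneg (ae_of_all _ hY0) hYint ε).trans hYle
    refine le_trans ?_ (add_le_add_right hmark _)
    refine le_trans (measureReal_mono ?_) (measureReal_union_le _ _)
    intro ω hω
    by_cases hbad : ∃ i < a n * b n, η < |K n i ω|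
    · exact Or.inl hbad
    · right
      push Not at hbad
      have heq : ∑ i ∈ Finset.range (a n),
          (∑ j ∈ Finset.range (b n), K n (i * b n + j) ω * ξ n (i * b n + j) ω) ^ 2 = Y ω := by
        refine Finset.sum_congr rfl fun i hi => ?_
        congr 1
        refine Finset.sum_congr rfl fun j hj => ?_
        have hi' := Finset.mem_range.mp hi
        have hj' := Finset.mem_range.mp hj
        have : i * b n + j < a n * b n := by nlinarith
        simp only [hL, if_pos (hbad _ this)]
      have hω' : ε ≤ ‖∑ i ∈ Finset.range (a n),
          (∑ j ∈ Finset.range (b n), K n (i * b n + j) ω * ξ n (i * b n + j) ω) ^ 2‖ := hω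
      rw [heq, Real.norm_of_nonneg (hY0 ω)] at hω'
      exact hω'
  have hbad : ∀ η > 0, Tendsto (fun n => P.real {ω | ∃ i < a n * b n, η < |K n i ω|}) atTop
      (𝓝 0) := by
    intro η hη
    have hms : ∀ n, MeasurableSet {ω | ∃ i < a n * b n, η < |K n i ω|} := by
      intro n
      have : {ω | ∃ i < a n * b n, η < |K n i ω|}
          = ⋃ i ∈ Finset.range (a n * b n), {ω | η < |K n i ω|} := by
        ext ω; simp
      rw [this]
      refine Finset.measurableSet_biUnion _ fun i _ => ?_
      exact (measurable_abs.comp ((hK n i).mono ((h n).le i) le_rfl)) measurableSet_Ioi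
    have := tendsto_measure_of_ae_tendsto_indicator_of_isFiniteMeasure (μ := P) atTop
      (A := (∅ : Set Ω)) MeasurableSet.empty hms (by
        filter_upwards [hsup] with ω hω
        filter_upwards [hω η hη] with n hn
        simp only [mem_empty_iff_false, iff_false]
        push Not
        exact hn)
    rw [measure_empty] at this
    exact (ENNReal.tendsto_toReal ENNReal.zero_ne_top).comp this
  rw [Metric.tendsto_atTop]
  intro δ hδ
  have hC1 : (0 : ℝ) < |C| + 1 := by positivity
  -- Chosen so that the Markov bound `η² C / ε` is at most `δ / 2`.
  set η : ℝ := Real.sqrt (δ * ε / (2 * (|C| + 1))) with hη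
  have hηpos : 0 < η := Real.sqrt_pos.mpr (by positivity)
  have hηsq : η ^ 2 = δ * ε / (2 * (|C| + 1)) := Real.sq_sqrt (by positivity)
  have hsmall : η ^ 2 * C / ε ≤ δ / 2 := by
    calc η ^ 2 * C / ε ≤ η ^ 2 * (|C| + 1) / ε := by
          gcongr; linarith [le_abs_self C]
      _ = δ / 2 := by rw [hηsq]; field_simp
  obtain ⟨N, hN⟩ := (Metric.tendsto_atTop.mp (hbad η hηpos)) (δ / 2) (by positivity)
  refine ⟨N, fun n hn => ?_⟩
  have h1 := hN n hn
  rw [Real.dist_0_eq_abs, abs_of_nonneg measureReal_nonneg] at h1 ⊢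
  linarith [key η hηpos n]

/-! ### Moments and independence of Brownian increments. -/

section BrownianIncrements

variable {F : Filtration ℝ≥0 mΩ} {P : Measure Ω} {B : ℝ≥0 → Ω → ℝ}

theorem IsBrownianWrt.measurable_filtration (hB : IsBrownianWrt F P B) {s t : ℝ≥0} (hst : s ≤ t) :
    Measurable[F t] (B s) :=
  ((hB.adapted s).measurable).mono (F.mono hst) le_rfl

theorem IsBrownianWrt.measurable (hB : IsBrownianWrt F P B) (t : ℝ≥0) : Measurable (B t) :=
  ((hB.adapted t).measurable).mono (F.le t) le_rfl

theorem IsBrownianWrt.measurable_sub (hB : IsBrownianWrt F P B) (s t : ℝ≥0) :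
    Measurable (fun ω => B t ω - B s ω) :=
  (hB.measurable t).sub (hB.measurable s)

theorem IsBrownianWrt.map_sub (hB : IsBrownianWrt F P B) {s t : ℝ≥0} (hst : s ≤ t) :
    P.map (fun ω => B t ω - B s ω) = gaussianReal 0 (t - s) := by
  have h := (hB.brownian.hasLaw_sub t s).map_eq
  have hd : nndist t.1 s.1 = t - s := by
    rw [← NNReal.coe_inj, NNReal.coe_sub hst, coe_nndist, Real.dist_eq]
    exact abs_of_nonneg (sub_nonneg.mpr (NNReal.coe_le_coe.mpr hst))
  rw [hd] at h
  exact h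

/-- Reduces every integral over an increment to the standard Gaussian, with the step length visible
as a factor `√h`. -/
theorem gaussianReal_eq_map_sqrt_mul (v : ℝ≥0) :
    gaussianReal 0 v = (gaussianReal 0 1).map (fun x => √(v : ℝ) * x) := by
  rw [gaussianReal_map_const_mul]
  congr 1
  · simp
  · rw [← NNReal.coe_inj]
    simp

theorem IsBrownianWrt.integral_sub (hB : IsBrownianWrt F P B) {s t : ℝ≥0} (hst : s ≤ t)
    {f : ℝ → ℝ} (hf : Measurable f) :
    ∫ ω, f (B t ω - B s ω) ∂P = ∫ x, f (√((t : ℝ) - s) * x) ∂(gaussianReal 0 1) := by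
  rw [← integral_map (φ := fun ω => B t ω - B s ω) (hB.measurable_sub s t).aemeasurable
    hf.aestronglyMeasurable, hB.map_sub hst, gaussianReal_eq_map_sqrt_mul,
    integral_map (by fun_prop) hf.aestronglyMeasurable, NNReal.coe_sub hst]

theorem IsBrownianWrt.integrable_sub (hB : IsBrownianWrt F P B) {s t : ℝ≥0} (hst : s ≤ t)
    {f : ℝ → ℝ} (hf : Measurable f)
    (hi : Integrable (fun x => f (√((t : ℝ) - s) * x)) (gaussianReal 0 1)) :
    Integrable (fun ω => f (B t ω - B s ω)) P := by
  have h : Integrable f (gaussianReal 0 (t - s)) := by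
    rw [gaussianReal_eq_map_sqrt_mul, integrable_map_measure hf.aestronglyMeasurable (by fun_prop),
      NNReal.coe_sub hst]
    exact hi
  rw [← hB.map_sub hst, integrable_map_measure hf.aestronglyMeasurable
    (hB.measurable_sub s t).aemeasurable] at h
  exact h

theorem IsBrownianWrt.memLp_sub (hB : IsBrownianWrt F P B) {s t : ℝ≥0} (hst : s ≤ t) (p : ℝ≥0) :
    MemLp (fun ω => B t ω - B s ω) p P := by
  have h : MemLp id p (P.map (fun ω => B t ω - B s ω)) := by
    rw [hB.map_sub hst]
    exact memLp_id_gaussianReal p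
  exact h.comp_of_map (hB.measurable_sub s t).aemeasurable

theorem integral_sq_gaussianReal : ∫ x, x ^ 2 ∂(gaussianReal 0 1) = 1 := by
  have h := variance_fun_id_gaussianReal (μ := 0) (v := 1)
  rw [variance_eq_integral (by fun_prop)] at h
  simpa using h

theorem integrable_pow_gaussianReal (k : ℕ) :
    Integrable (fun x : ℝ => x ^ k) (gaussianReal 0 1) := by
  rcases Nat.eq_zero_or_pos k with rfl | hk
  · simp
  · have h := (memLp_id_gaussianReal (μ := 0) (v := 1) (k : ℝ≥0)).integrable_norm_pow
      (by simpa using hk.ne')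
    refine (h.congr' ?_ ?_)
    · fun_prop
    · exact ae_of_all _ fun x => by simp

theorem IsBrownianWrt.integral_sub_eq_zero (hB : IsBrownianWrt F P B) {s t : ℝ≥0} (hst : s ≤ t) :
    ∫ ω, (B t ω - B s ω) ∂P = 0 := by
  rw [hB.integral_sub hst (f := fun x => x) measurable_id, integral_const_mul,
    integral_id_gaussianReal, mul_zero]

theorem IsBrownianWrt.integral_sub_sq (hB : IsBrownianWrt F P B) {s t : ℝ≥0} (hst : s ≤ t) :
    ∫ ω, (B t ω - B s ω) ^ 2 ∂P = t - s := by
  have h0 : (0 : ℝ) ≤ t - s := sub_nonneg.mpr hst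
  rw [hB.integral_sub hst (f := fun x => x ^ 2) (by fun_prop)]
  simp_rw [mul_pow, Real.sq_sqrt h0]
  rw [integral_const_mul, integral_sq_gaussianReal, mul_one]

theorem IsBrownianWrt.integral_sub_pow_four (hB : IsBrownianWrt F P B) {s t : ℝ≥0} (hst : s ≤ t) :
    ∫ ω, (B t ω - B s ω) ^ 4 ∂P = (t - s) ^ 2 * ∫ x, x ^ 4 ∂(gaussianReal 0 1) := by
  have h0 : (0 : ℝ) ≤ t - s := sub_nonneg.mpr hst
  have h4 : √((t : ℝ) - s) ^ 4 = (t - s) ^ 2 := by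
    rw [show (4 : ℕ) = 2 * 2 from rfl, pow_mul, Real.sq_sqrt h0]
  rw [hB.integral_sub hst (f := fun x => x ^ 4) (by fun_prop)]
  simp_rw [mul_pow, h4]
  rw [integral_const_mul]

theorem IsBrownianWrt.integrable_exp_sub (hB : IsBrownianWrt F P B) {s t : ℝ≥0} (hst : s ≤ t)
    (c : ℝ) : Integrable (fun ω => Real.exp (c * (B t ω - B s ω))) P := by
  refine hB.integrable_sub hst (f := fun x => Real.exp (c * x)) (by fun_prop) ?_
  simp_rw [← mul_assoc]
  exact integrable_exp_mul_gaussianReal _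

theorem IsBrownianWrt.integral_exp_sub (hB : IsBrownianWrt F P B) {s t : ℝ≥0} (hst : s ≤ t)
    (c : ℝ) : ∫ ω, Real.exp (c * (B t ω - B s ω)) ∂P = Real.exp (c ^ 2 * (t - s) / 2) := by
  have h := mgf_gaussianReal (hB.map_sub hst) c
  rw [mgf] at h
  rw [h, NNReal.coe_sub hst]
  congr 1
  ring

theorem IsBrownianWrt.indepFun_sub (hB : IsBrownianWrt F P B) {s t : ℝ≥0} (hst : s ≤ t)
    {Y : Ω → ℝ} (hY : Measurable[F s] Y) : IndepFun (fun ω => B t ω - B s ω) Y P :=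
  indepFun_of_indep_of_measurable (hB.indep s t hst) hY

theorem IsBrownianWrt.ae_zero (hB : IsBrownianWrt F P B) : ∀ᵐ ω ∂P, B 0 ω = 0 :=
  hB.brownian.eval_zero_ae_eq_zero

theorem grid_le_succ (h : ℝ≥0) (i : ℕ) : (i : ℝ≥0) * h ≤ ((i + 1 : ℕ) : ℝ≥0) * h := by
  gcongr
  simp

theorem grid_sub (h : ℝ≥0) (i : ℕ) :
    ((((i + 1 : ℕ) : ℝ≥0) * h : ℝ≥0) : ℝ) - (((i : ℝ≥0) * h : ℝ≥0) : ℝ) = h := by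
  push_cast
  ring

theorem IsBrownianWrt.isNoise_increments (hB : IsBrownianWrt F P B) (h : ℝ≥0) :
    IsNoise (fun i => F ((i : ℝ≥0) * h)) P
      (fun i ω => B (((i + 1 : ℕ) : ℝ≥0) * h) ω - B ((i : ℝ≥0) * h) ω) h where
  mono := fun i j hij => F.mono (by gcongr)
  le := fun i => F.le _
  meas := fun i => (hB.measurable_filtration le_rfl).sub
    (hB.measurable_filtration (grid_le_succ h i))
  memLp := fun i => hB.memLp_sub (grid_le_succ h i) 2
  mean := fun i => hB.integral_sub_eq_zero (grid_le_succ h i)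
  indep := fun i => hB.indep _ _ (grid_le_succ h i)
  var_le := fun i => by rw [hB.integral_sub_sq (grid_le_succ h i), grid_sub]

/-- The factor `c` is a free normalization: it is later compensated in the coefficients, to make
them uniformly small while the total variance stays bounded. -/
theorem IsBrownianWrt.isNoise_sq_increments [IsProbabilityMeasure P] (hB : IsBrownianWrt F P B)
    (h : ℝ≥0) (c : ℝ) :
    IsNoise (fun i => F ((i : ℝ≥0) * h)) P
      (fun i ω => c * ((B (((i + 1 : ℕ) : ℝ≥0) * h) ω - B ((i : ℝ≥0) * h) ω) ^ 2 - h))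
      (c ^ 2 * (h ^ 2 * ∫ x, x ^ 4 ∂(gaussianReal 0 1))) := by
  have hint2 : ∀ i : ℕ, Integrable (fun ω =>
      (B (((i + 1 : ℕ) : ℝ≥0) * h) ω - B ((i : ℝ≥0) * h) ω) ^ 2) P := fun i =>
    (hB.memLp_sub (grid_le_succ h i) 2).integrable_sq
  have hint4 : ∀ i : ℕ, Integrable (fun ω =>
      (B (((i + 1 : ℕ) : ℝ≥0) * h) ω - B ((i : ℝ≥0) * h) ω) ^ 4) P := fun i => by
    refine hB.integrable_sub (grid_le_succ h i) (f := fun x => x ^ 4) (by fun_prop) ?_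
    simp_rw [mul_pow]
    exact (integrable_pow_gaussianReal 4).const_mul _
  have hmem : ∀ i : ℕ, MemLp (fun ω =>
      (B (((i + 1 : ℕ) : ℝ≥0) * h) ω - B ((i : ℝ≥0) * h) ω) ^ 2) 2 P := fun i => by
    rw [memLp_two_iff_integrable_sq (((hB.measurable_sub _ _).pow_const 2).aestronglyMeasurable)]
    refine (hint4 i).congr (ae_of_all _ fun ω => by ring)
  refine ⟨fun i j hij => F.mono (by gcongr), fun i => F.le _, fun i => ?_, fun i => ?_,
    fun i => ?_, fun i => ?_, fun i => ?_⟩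
  · exact ((((hB.measurable_filtration le_rfl).sub
      (hB.measurable_filtration (grid_le_succ h i))).pow_const 2).sub_const _).const_mul c
  · exact ((hmem i).sub (memLp_const (h : ℝ))).const_mul c
  · rw [integral_const_mul, MeasureTheory.integral_sub (hint2 i) (integrable_const _),
      hB.integral_sub_sq (grid_le_succ h i), grid_sub]
    simp
  · refine indep_of_indep_of_le_left (hB.indep _ _ (grid_le_succ h i)) ?_
    rintro _ ⟨s, hs, rfl⟩
    refine ⟨(fun x : ℝ => c * (x ^ 2 - h)) ⁻¹' s, ?_, rfl⟩
    exact (show Measurable (fun x : ℝ => c * (x ^ 2 - h)) by fun_prop) hs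
  · have h4 := hB.integral_sub_pow_four (grid_le_succ h i)
    have h2 := hB.integral_sub_sq (grid_le_succ h i)
    rw [grid_sub] at h4 h2
    have hexp : ∀ ω, (c * ((B (((i + 1 : ℕ) : ℝ≥0) * h) ω - B ((i : ℝ≥0) * h) ω) ^ 2 - h)) ^ 2
        = c ^ 2 * ((B (((i + 1 : ℕ) : ℝ≥0) * h) ω - B ((i : ℝ≥0) * h) ω) ^ 4
          - (2 * h * (B (((i + 1 : ℕ) : ℝ≥0) * h) ω - B ((i : ℝ≥0) * h) ω) ^ 2 - h ^ 2)) := by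
      intro ω; ring
    simp_rw [hexp]
    have hi2 : Integrable (fun ω => 2 * h * (B (((i + 1 : ℕ) : ℝ≥0) * h) ω
        - B ((i : ℝ≥0) * h) ω) ^ 2 - (h : ℝ) ^ 2) P :=
      ((hint2 i).const_mul _).sub (integrable_const _)
    rw [integral_const_mul, MeasureTheory.integral_sub (hint4 i) hi2,
      MeasureTheory.integral_sub ((hint2 i).const_mul _) (integrable_const _), integral_const_mul,
      h4, h2]
    simp only [integral_const, probReal_univ, smul_eq_mul, one_mul]
    gcongr
    nlinarith [sq_nonneg (h : ℝ)]

end BrownianIncrements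

/-! ### The discrete product rule along a path. -/

/-- The factor `exp (-y)` cancels an Euler factor `1 + y` up to `-y² / 2`; this second-order defect
is what the Itô correction compensates. -/
theorem abs_exp_neg_mul_one_add_sub_le {y : ℝ} (hy : |y| ≤ 1) :
    |Real.exp (-y) * (1 + y) - 1 + y ^ 2 / 2| ≤ |y| ^ 3 := by
  have h := Real.exp_bound (x := -y) (by simpa using hy) (n := 3) (by norm_num)
  simp only [Finset.sum_range_succ, Finset.range_zero, Finset.sum_empty, Nat.factorial, abs_neg] at h
  norm_num at h
  set R : ℝ := Real.exp (-y) - (1 + -y + y ^ 2 / 2) with hR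
  have e1 : Real.exp (-y) * (1 + y) - 1 + y ^ 2 / 2 = y ^ 3 / 2 + (1 + y) * R := by
    rw [hR]; ring
  have h1 : |1 + y| ≤ 2 := by
    calc |1 + y| ≤ |1| + |y| := abs_add_le _ _
      _ ≤ 2 := by rw [abs_one]; linarith
  have h2 : |(1 + y) * R| ≤ 2 * (|y| ^ 3 * (2 / 9)) := by
    rw [abs_mul]
    gcongr
  have h3 : |y ^ 3 / 2| = |y| ^ 3 / 2 := by
    rw [abs_div, abs_pow, abs_two]
  rw [e1]
  have := abs_add_le (y ^ 3 / 2) ((1 + y) * R)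
  have h4 : 0 ≤ |y| ^ 3 := by positivity
  linarith

/-- One step of the discrete product rule for `u v`, where `u` is the inverse of the stochastic
exponential and `v` an approximate Euler step of the linear equation. -/
theorem abs_euler_step_le {u v x p e d c a h M ε D y : ℝ} (hy : y = a * x - a ^ 2 * h / 2 + p)
    (hu : |u| ≤ M) (hv : |v| ≤ M) (hp : |p| ≤ M * h) (hc : |c - v * p| ≤ M * (ε * h))
    (hd : |d| ≤ D) (hx : |x| ≤ ε) (hyε : |y| ≤ ε) (hε : ε ≤ 1) (hε0 : 0 < ε) (h0 : 0 ≤ h) :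
    |u * Real.exp (-y) * (v + a * v * x + e + d + c) - u * v - u * e
        + a ^ 2 / 2 * (u * v * (x ^ 2 - h))|
      ≤ M * (ε * y ^ 2 + e ^ 2 / ε) + 3 * M * (D + M * (ε * h))
        + M ^ 2 * (ε * y ^ 2 + ε * (a ^ 2 + (M + a ^ 2) * (1 + |a|)) * h) := by
  have hM : 0 ≤ M := (abs_nonneg _).trans hu
  have hy1 : |y| ≤ 1 := hyε.trans hε
  have hexp1 : |Real.exp (-y) - 1| ≤ 2 * |y| := by
    simpa using Real.abs_exp_sub_one_le (x := -y) (by simpa using hy1)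
  have hexp3 : |Real.exp (-y)| ≤ 3 := by
    have := abs_sub_abs_le_abs_sub (Real.exp (-y)) 1
    rw [abs_one] at this
    linarith
  have hbr := abs_exp_neg_mul_one_add_sub_le hy1
  set E := Real.exp (-y) with hE
  -- Here `x` is the Brownian increment, `p` and `c` are the increments of `∫ b` and `∫ b v`, `e` is
  -- the fluctuation of the integrand inside the step, and `d` is the approximation error of the
  -- stochastic integral. Once `c` is replaced by `v p`, the Euler factor is `1 + a x + p = 1 + y +
  -- a² h / 2`. The terms `a² h / 2` cancel, and `a² x² - y²` factors with the small factor `y - a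
  -- x` of order `h`.
  have hdecomp : u * E * (v + a * v * x + e + d + c) - u * v - u * e
        + a ^ 2 / 2 * (u * v * (x ^ 2 - h))
      = u * ((E - 1) * e) + u * (E * (d + (c - v * p)))
        + u * v * ((E * (1 + y) - 1 + y ^ 2 / 2) + (E - 1) * (a ^ 2 * h / 2)
          + -((y - a * x) * (y + a * x)) / 2) := by
    have : p = y - a * x + a ^ 2 * h / 2 := by rw [hy]; ring
    rw [this]
    ring
  have t1 : |u * ((E - 1) * e)| ≤ M * (ε * y ^ 2 + e ^ 2 / ε) := by
    rw [abs_mul, abs_mul]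
    -- The weights are unequal because `∑ y²` will only be bounded, whereas `∑ e²` tends to `0`.
    have : 2 * |y| * |e| ≤ ε * y ^ 2 + e ^ 2 / ε := by
      have h1 : 0 ≤ (ε * |y| - |e|) ^ 2 / ε := by positivity
      have h2 : (ε * |y| - |e|) ^ 2 / ε = ε * |y| ^ 2 + |e| ^ 2 / ε - 2 * |y| * |e| := by
        field_simp; ring
      rw [h2, sq_abs, sq_abs] at h1
      linarith
    calc |u| * (|E - 1| * |e|) ≤ M * (2 * |y| * |e|) := by gcongr
      _ ≤ _ := by gcongr
  have t2 : |u * (E * (d + (c - v * p)))| ≤ 3 * M * (D + M * (ε * h)) := by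
    rw [abs_mul, abs_mul]
    calc |u| * (|E| * |d + (c - v * p)|) ≤ M * (3 * (D + M * (ε * h))) := by
          gcongr
          exact (abs_add_le _ _).trans (add_le_add hd hc)
      _ = _ := by ring
  have t3 : |u * v * ((E * (1 + y) - 1 + y ^ 2 / 2) + (E - 1) * (a ^ 2 * h / 2)
          + -((y - a * x) * (y + a * x)) / 2)|
      ≤ M ^ 2 * (ε * y ^ 2 + ε * (a ^ 2 + (M + a ^ 2) * (1 + |a|)) * h) := by
    rw [abs_mul, abs_mul]
    have s1 : |E * (1 + y) - 1 + y ^ 2 / 2| ≤ ε * y ^ 2 := by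
      refine hbr.trans ?_
      rw [pow_succ, sq_abs, mul_comm]
      gcongr
    have s2 : |(E - 1) * (a ^ 2 * h / 2)| ≤ ε * a ^ 2 * h := by
      rw [abs_mul, abs_of_nonneg (by positivity : 0 ≤ a ^ 2 * h / 2)]
      calc |E - 1| * (a ^ 2 * h / 2) ≤ 2 * ε * (a ^ 2 * h / 2) := by
            gcongr
            exact hexp1.trans (by gcongr)
        _ = _ := by ring
    have s3 : |-((y - a * x) * (y + a * x)) / 2| ≤ ε * ((M + a ^ 2) * (1 + |a|)) * h := by
      rw [abs_div, abs_neg, abs_mul, abs_two]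
      have r1 : |y - a * x| ≤ (M + a ^ 2) * h := by
        have : y - a * x = p + -(a ^ 2 * h / 2) := by rw [hy]; ring
        rw [this]
        refine (abs_add_le _ _).trans ?_
        rw [abs_neg, abs_of_nonneg (by positivity : 0 ≤ a ^ 2 * h / 2)]
        nlinarith [mul_nonneg (sq_nonneg a) h0]
      have r2 : |y + a * x| ≤ ε * (1 + |a|) := by
        refine (abs_add_le _ _).trans ?_
        rw [abs_mul]
        nlinarith [mul_le_mul_of_nonneg_left hx (abs_nonneg a)]
      have r3 : |y - a * x| * |y + a * x| ≤ (M + a ^ 2) * h * (ε * (1 + |a|)) := by gcongr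
      have r4 : 0 ≤ (M + a ^ 2) * h * (ε * (1 + |a|)) := by positivity
      have r5 : ε * ((M + a ^ 2) * (1 + |a|)) * h = (M + a ^ 2) * h * (ε * (1 + |a|)) := by ring
      rw [r5]
      linarith
    have huv : |u| * |v| ≤ M ^ 2 := by
      rw [sq]; gcongr
    gcongr
    have a1 := abs_add_le ((E * (1 + y) - 1 + y ^ 2 / 2) + (E - 1) * (a ^ 2 * h / 2))
      (-((y - a * x) * (y + a * x)) / 2)
    have a2 := abs_add_le (E * (1 + y) - 1 + y ^ 2 / 2) ((E - 1) * (a ^ 2 * h / 2))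
    have a3 : ε * (a ^ 2 + (M + a ^ 2) * (1 + |a|)) * h
      = ε * a ^ 2 * h + ε * ((M + a ^ 2) * (1 + |a|)) * h := by ring
    rw [a3]
    linarith
  rw [hdecomp]
  have b1 := abs_add_le (u * ((E - 1) * e) + u * (E * (d + (c - v * p))))
    (u * v * ((E * (1 + y) - 1 + y ^ 2 / 2) + (E - 1) * (a ^ 2 * h / 2)
          + -((y - a * x) * (y + a * x)) / 2))
  have b2 := abs_add_le (u * ((E - 1) * e)) (u * (E * (d + (c - v * p))))
  linarith

theorem Continuous.exists_modulus {f : ℝ≥0 → ℝ} (hf : Continuous f) (T : ℝ≥0) {ε : ℝ}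
    (hε : 0 < ε) :
    ∃ δ > 0, ∀ s ≤ T, ∀ t ≤ T, dist s t < δ → |f s - f t| ≤ ε := by
  have h := (isCompact_Icc (a := (0 : ℝ≥0)) (b := T)).uniformContinuousOn_of_continuous
    hf.continuousOn
  rw [Metric.uniformContinuousOn_iff_le] at h
  obtain ⟨δ, hδ, h⟩ := h ε hε
  exact ⟨δ, hδ, fun s hs t ht hst => h s ⟨zero_le, hs⟩ t ⟨zero_le, ht⟩ hst.le⟩

theorem Continuous.exists_abs_le {f : ℝ≥0 → ℝ} (hf : Continuous f) (T : ℝ≥0) :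
    ∃ M, ∀ s ≤ T, |f s| ≤ M := by
  obtain ⟨M, hM⟩ := (isCompact_Icc (a := (0 : ℝ≥0)) (b := T)).exists_bound_of_continuousOn
    hf.continuousOn
  exact ⟨M, fun s hs => hM s ⟨zero_le, hs⟩⟩

/-- The one-step errors are telescoped. The sums of `u e` and of `u v (x² - h)` stay inside the
absolute value, because they vanish only through cancellation; all other terms can be bounded one by
one. -/
theorem abs_euler_sum_le {N : ℕ} {u v x p e d c y : ℕ → ℝ} {a h M ε D T : ℝ}
    (hT : N * h = T)
    (hustep : ∀ i < N, u (i + 1) = u i * Real.exp (-y i))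
    (hvstep : ∀ i < N, v (i + 1) = v i + a * v i * x i + e i + d i + c i)
    (hy : ∀ i < N, y i = a * x i - a ^ 2 * h / 2 + p i)
    (hu : ∀ i < N, |u i| ≤ M) (hv : ∀ i < N, |v i| ≤ M) (hp : ∀ i < N, |p i| ≤ M * h)
    (hc : ∀ i < N, |c i - v i * p i| ≤ M * (ε * h))
    (hd : ∀ i < N, |d i| ≤ D) (hx : ∀ i < N, |x i| ≤ ε) (hyε : ∀ i < N, |y i| ≤ ε)
    (hε : ε ≤ 1) (hε0 : 0 < ε) (h0 : 0 ≤ h) :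
    |u N * v N - u 0 * v 0| ≤ |∑ i ∈ Finset.range N, u i * e i|
      + a ^ 2 / 2 * |∑ i ∈ Finset.range N, u i * v i * (x i ^ 2 - h)|
      + (M * (ε * (∑ i ∈ Finset.range N, y i ^ 2) + (∑ i ∈ Finset.range N, e i ^ 2) / ε)
        + 3 * M * (N * D + M * (ε * T))
        + M ^ 2 * (ε * (∑ i ∈ Finset.range N, y i ^ 2)
          + ε * (a ^ 2 + (M + a ^ 2) * (1 + |a|)) * T)) := by
  have htel : u N * v N - u 0 * v 0
      = ∑ i ∈ Finset.range N, (u (i + 1) * v (i + 1) - u i * v i) :=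
    (Finset.sum_range_sub (fun i => u i * v i) N).symm
  have hsplit : u N * v N - u 0 * v 0 = (∑ i ∈ Finset.range N, u i * e i)
      + -(a ^ 2 / 2 * ∑ i ∈ Finset.range N, u i * v i * (x i ^ 2 - h))
      + ∑ i ∈ Finset.range N, (u (i + 1) * v (i + 1) - u i * v i - u i * e i
        + a ^ 2 / 2 * (u i * v i * (x i ^ 2 - h))) := by
    rw [htel, Finset.mul_sum, ← Finset.sum_neg_distrib, ← Finset.sum_add_distrib,
      ← Finset.sum_add_distrib]
    exact Finset.sum_congr rfl fun i _ => by ring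
  have hrem : |∑ i ∈ Finset.range N, (u (i + 1) * v (i + 1) - u i * v i - u i * e i
        + a ^ 2 / 2 * (u i * v i * (x i ^ 2 - h)))|
      ≤ ∑ i ∈ Finset.range N, (M * (ε * y i ^ 2 + e i ^ 2 / ε) + 3 * M * (D + M * (ε * h))
        + M ^ 2 * (ε * y i ^ 2 + ε * (a ^ 2 + (M + a ^ 2) * (1 + |a|)) * h)) := by
    refine (Finset.abs_sum_le_sum_abs _ _).trans (Finset.sum_le_sum fun i hi => ?_)
    have hi' := Finset.mem_range.mp hi
    rw [hustep i hi', hvstep i hi']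
    exact abs_euler_step_le (hy i hi') (hu i hi') (hv i hi') (hp i hi') (hc i hi') (hd i hi')
      (hx i hi') (hyε i hi') hε hε0 h0
  have hval : ∑ i ∈ Finset.range N, (M * (ε * y i ^ 2 + e i ^ 2 / ε) + 3 * M * (D + M * (ε * h))
        + M ^ 2 * (ε * y i ^ 2 + ε * (a ^ 2 + (M + a ^ 2) * (1 + |a|)) * h))
      = M * (ε * (∑ i ∈ Finset.range N, y i ^ 2) + (∑ i ∈ Finset.range N, e i ^ 2) / ε)
        + 3 * M * (N * D + M * (ε * T))
        + M ^ 2 * (ε * (∑ i ∈ Finset.range N, y i ^ 2)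
          + ε * (a ^ 2 + (M + a ^ 2) * (1 + |a|)) * T) := by
    simp only [Finset.sum_add_distrib, ← Finset.mul_sum, ← Finset.sum_div, Finset.sum_const,
      Finset.card_range, nsmul_eq_mul, ← hT]
  rw [hval] at hrem
  rw [hsplit]
  refine (abs_add_le _ _).trans (add_le_add ?_ hrem)
  refine (abs_add_le _ _).trans ?_
  rw [abs_neg, abs_mul, abs_of_nonneg (by positivity : 0 ≤ a ^ 2 / 2)]

theorem eq_zero_of_abs_le_mul {z K : ℝ} (h : ∀ ε, 0 < ε → ε ≤ 1 → |z| ≤ ε * K) : z = 0 := by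
  by_contra hz
  have hz' : 0 < |z| := abs_pos.mpr hz
  have hK : 0 < K := by
    have := h 1 one_pos le_rfl
    linarith
  have h1 := h (min 1 (|z| / (2 * K))) (lt_min one_pos (by positivity)) (min_le_left _ _)
  have h2 : min 1 (|z| / (2 * K)) * K ≤ |z| / (2 * K) * K := by
    gcongr
    exact min_le_right _ _
  have h3 : |z| / (2 * K) * K = |z| / 2 := by field_simp
  linarith

theorem grid_le {T : ℝ≥0} {N i : ℕ} (hi : i ≤ N) : (i : ℝ≥0) * (T / N) ≤ T := by
  rcases Nat.eq_zero_or_pos N with rfl | hN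
  · simp
  · have hN' : (0 : ℝ≥0) < N := by exact_mod_cast hN
    calc (i : ℝ≥0) * (T / N) ≤ (N : ℝ≥0) * (T / N) := by gcongr
      _ = T := by field_simp

theorem dist_grid (h : ℝ≥0) (i : ℕ) :
    dist (((i + 1 : ℕ) : ℝ≥0) * h) ((i : ℝ≥0) * h) = h := by
  rw [NNReal.dist_eq, grid_sub]
  simp

set_option maxHeartbeats 1000000 in
/-- Pathwise form of the uniqueness for `dv = b v dt + a v dβ`: if the increments of the
stochastic integral are approximated by Euler terms with errors that are negligible along a
sequence of uniform grids, then `v` is a multiple of the stochastic exponential. -/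
theorem path_mul_eq_of_euler {T : ℝ≥0} {a v₀ : ℝ} {v β A b I u : ℝ≥0 → ℝ} (hv : Continuous v)
    (hβ : Continuous β) (hb : Continuous b) (hAc : Continuous A)
    (hA : ∀ t : ℝ≥0, A t = ∫ s in (0 : ℝ)..t, b s.toNNReal)
    (hu : ∀ t : ℝ≥0, u t = Real.exp (-(a * β t) + a ^ 2 * t / 2 - A t))
    {N : ℕ → ℕ} (hN : Tendsto N atTop atTop) (hN0 : ∀ k, 0 < N k)
    (heq : ∀ k i : ℕ, v (i * (T / N k)) = v₀
      + (∫ s in (0 : ℝ)..((i * (T / N k) : ℝ≥0) : ℝ), b s.toNNReal * v s.toNNReal)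
      + I (i * (T / N k)))
    {x e : ℕ → ℕ → ℝ} {D : ℕ → ℝ}
    (hx : ∀ k i, x k i = β ((i + 1 : ℕ) * (T / N k)) - β (i * (T / N k)))
    (hD : ∀ᶠ k in atTop, ∀ i < N k, |I ((i + 1 : ℕ) * (T / N k)) - I (i * (T / N k))
      - a * v (i * (T / N k)) * x k i - e k i| ≤ D k)
    (hND : Tendsto (fun k => (N k : ℝ) * D k) atTop (𝓝 0))
    (hS1 : Tendsto (fun k => ∑ i ∈ Finset.range (N k), u (i * (T / N k)) * e k i) atTop (𝓝 0))
    (hS2 : Tendsto (fun k => ∑ i ∈ Finset.range (N k), e k i ^ 2) atTop (𝓝 0))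
    (hS3 : Tendsto (fun k => ∑ i ∈ Finset.range (N k), u (i * (T / N k)) * v (i * (T / N k))
      * (x k i ^ 2 - ((T / N k : ℝ≥0) : ℝ))) atTop (𝓝 0))
    (hS4 : Tendsto (fun k => ∑ i ∈ Finset.range (N k),
      (x k i ^ 2 - ((T / N k : ℝ≥0) : ℝ))) atTop (𝓝 0)) :
    u T * v T = u 0 * v 0 := by
  have huc : Continuous u := by
    have : u = fun t : ℝ≥0 => Real.exp (-(a * β t) + a ^ 2 * t / 2 - A t) := funext hu
    rw [this]
    fun_prop
  obtain ⟨M1, hM1⟩ := Continuous.exists_abs_le hv T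
  obtain ⟨M2, hM2⟩ := Continuous.exists_abs_le huc T
  obtain ⟨M3, hM3⟩ := Continuous.exists_abs_le hb T
  set M : ℝ := max M1 (max M2 M3) with hM
  have hvM : ∀ s ≤ T, |v s| ≤ M := fun s hs => (hM1 s hs).trans (le_max_left _ _)
  have huM : ∀ s ≤ T, |u s| ≤ M := fun s hs =>
    (hM2 s hs).trans ((le_max_left _ _).trans (le_max_right _ _))
  have hbM : ∀ s ≤ T, |b s| ≤ M := fun s hs =>
    (hM3 s hs).trans ((le_max_right _ _).trans (le_max_right _ _))
  have hM0 : 0 ≤ M := (abs_nonneg _).trans (hvM 0 zero_le)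
  have hbR : Continuous fun s : ℝ => b s.toNNReal := hb.comp continuous_real_toNNReal
  have hbvR : Continuous fun s : ℝ => b s.toNNReal * v s.toNNReal :=
    hbR.mul (hv.comp continuous_real_toNNReal)
  have hh0 : Tendsto (fun k => ((T / N k : ℝ≥0) : ℝ)) atTop (𝓝 0) := by
    simp only [NNReal.coe_div, NNReal.coe_natCast]
    exact tendsto_const_nhds.div_atTop (tendsto_natCast_atTop_atTop.comp hN)
  -- `Q` bounds `∑ y²` on fine grids: split `y = a x + (p - a² h / 2)` and use `∑ x² ≤ T + 1`. The
  -- constant `K` below collects the coefficients of `ε` in the final estimate.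
  set Q : ℝ := 2 * a ^ 2 * (T + 1) + 2 * (M + a ^ 2) ^ 2 * T with hQ
  set K : ℝ := 1 + a ^ 2 / 2 + (M * (Q + 1) + 3 * M * (1 + M * T)
    + M ^ 2 * (Q + (a ^ 2 + (M + a ^ 2) * (1 + |a|)) * T)) with hK
  clear_value K Q M
  refine sub_eq_zero.mp (eq_zero_of_abs_le_mul (K := K) fun ε hε hε1 => ?_)
  obtain ⟨δ1, hδ1, hmod1⟩ := Continuous.exists_modulus hv T hε
  obtain ⟨δ2, hδ2, hmod2⟩ := Continuous.exists_modulus hβ T hε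
  have hgc : Continuous fun t : ℝ≥0 => a * β t - a ^ 2 * t / 2 + A t := by fun_prop
  obtain ⟨δ3, hδ3, hmod3⟩ := Continuous.exists_modulus hgc T hε
  have ev1 := hh0.eventually (gt_mem_nhds hδ1)
  have ev2 := hh0.eventually (gt_mem_nhds hδ2)
  have ev3 := hh0.eventually (gt_mem_nhds hδ3)
  have ev4 := hh0.eventually (gt_mem_nhds one_pos)
  have ev5 := hND.eventually (gt_mem_nhds hε)
  have ev6 := hS1.abs.eventually (gt_mem_nhds (show |(0 : ℝ)| < ε by simpa using hε))
  -- The threshold is `ε²` because this sum is divided by `ε` in the estimate.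
  have ev7 := hS2.eventually (gt_mem_nhds (show (0 : ℝ) < ε ^ 2 by positivity))
  have ev8 := hS3.abs.eventually (gt_mem_nhds (show |(0 : ℝ)| < ε by simpa using hε))
  have ev9 := hS4.eventually (gt_mem_nhds one_pos)
  obtain ⟨k, hk1, hk2, hk3, hk4, hk5, hk6, hk7, hk8, hk9, hkD⟩ := (ev1.and (ev2.and (ev3.and
    (ev4.and (ev5.and (ev6.and (ev7.and (ev8.and (ev9.and hD))))))))).exists
  set h : ℝ≥0 := T / N k with hh
  have hNpos : (0 : ℝ≥0) < N k := by exact_mod_cast hN0 k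
  have hNh : (N k : ℝ≥0) * h = T := by rw [hh]; field_simp
  have hNhR : (N k : ℝ) * (h : ℝ) = T := by exact_mod_cast hNh
  have hgle : ∀ i ≤ N k, (i : ℝ≥0) * h ≤ T := fun i hi => grid_le hi
  have hgleR : ∀ i : ℕ, (((i : ℝ≥0) * h : ℝ≥0) : ℝ) ≤ (((i + 1 : ℕ) * h : ℝ≥0) : ℝ) :=
    fun i => by exact_mod_cast grid_le_succ h i
  set p : ℕ → ℝ := fun i => A ((i + 1 : ℕ) * h) - A (i * h) with hp
  set y : ℕ → ℝ := fun i => a * x k i - a ^ 2 * h / 2 + p i with hy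
  set c : ℕ → ℝ := fun i => ∫ s in (((i : ℝ≥0) * h : ℝ≥0) : ℝ)..(((i + 1 : ℕ) * h : ℝ≥0) : ℝ),
    b s.toNNReal * v s.toNNReal with hc
  set d : ℕ → ℝ := fun i => I ((i + 1 : ℕ) * h) - I (i * h) - a * v (i * h) * x k i - e k i with hd
  have hpint : ∀ i, p i = ∫ s in (((i : ℝ≥0) * h : ℝ≥0) : ℝ)..(((i + 1 : ℕ) * h : ℝ≥0) : ℝ),
      b s.toNNReal := fun i => by
    simp only [hp]
    rw [hA, hA, intervalIntegral.integral_interval_sub_left (hbR.intervalIntegrable _ _)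
      (hbR.intervalIntegrable _ _)]
  have hmemT : ∀ i < N k, ∀ s ∈ uIoc (((i : ℝ≥0) * h : ℝ≥0) : ℝ) (((i + 1 : ℕ) * h : ℝ≥0) : ℝ),
      s.toNNReal ≤ T ∧ dist s.toNNReal (i * h) ≤ h := by
    intro i hi s hs
    rw [uIoc_of_le (hgleR i)] at hs
    obtain ⟨hs1, hs2⟩ := hs
    have hs0 : 0 ≤ s := (NNReal.coe_nonneg _).trans hs1.le
    refine ⟨?_, ?_⟩
    · rw [Real.toNNReal_le_iff_le_coe]
      exact hs2.trans (by exact_mod_cast hgle (i + 1) hi)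
    · rw [NNReal.dist_eq, Real.coe_toNNReal s hs0, abs_of_nonneg (by linarith)]
      have := grid_sub h i
      linarith
  have hlen : ∀ i : ℕ, |(((i + 1 : ℕ) * h : ℝ≥0) : ℝ) - (((i : ℝ≥0) * h : ℝ≥0) : ℝ)| = h :=
    fun i => by rw [grid_sub]; simp
  have hpb : ∀ i < N k, |p i| ≤ M * h := by
    intro i hi
    rw [hpint, ← hlen i, ← Real.norm_eq_abs]
    exact intervalIntegral.norm_integral_le_of_norm_le_const fun s hs => hbM _ (hmemT i hi s hs).1
  have hcb : ∀ i < N k, |c i - v (i * h) * p i| ≤ M * (ε * h) := by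
    intro i hi
    have e1 : c i - v (i * h) * p i
        = ∫ s in (((i : ℝ≥0) * h : ℝ≥0) : ℝ)..(((i + 1 : ℕ) * h : ℝ≥0) : ℝ),
          b s.toNNReal * (v s.toNNReal - v (i * h)) := by
      rw [hpint, ← intervalIntegral.integral_const_mul]
      simp only [hc]
      rw [← intervalIntegral.integral_sub (hbvR.intervalIntegrable _ _)
        ((hbR.const_mul _).intervalIntegrable _ _)]
      exact intervalIntegral.integral_congr fun s _ => by ring
    rw [e1, ← mul_assoc, ← Real.norm_eq_abs]
    conv_rhs => rw [← hlen i]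
    refine intervalIntegral.norm_integral_le_of_norm_le_const fun s hs => ?_
    obtain ⟨h1, h2⟩ := hmemT i hi s hs
    rw [norm_mul]
    refine mul_le_mul (hbM _ h1) ?_ (norm_nonneg _) hM0
    exact hmod1 _ h1 _ (hgle i hi.le) (h2.trans_lt hk1)
  have hxb : ∀ i < N k, |x k i| ≤ ε := by
    intro i hi
    rw [hx]
    exact hmod2 _ (hgle (i + 1) hi) _ (hgle i hi.le) (by rw [dist_grid]; exact hk2)
  have hyeq : ∀ i, y i = (a * β ((i + 1 : ℕ) * h) - a ^ 2 * (((i + 1 : ℕ) * h : ℝ≥0) : ℝ) / 2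
      + A ((i + 1 : ℕ) * h)) - (a * β (i * h) - a ^ 2 * ((i * h : ℝ≥0) : ℝ) / 2 + A (i * h)) := by
    intro i
    have := grid_sub h i
    simp only [hy, hp, hx]
    linear_combination (a ^ 2 / 2) * this
  have hyb : ∀ i < N k, |y i| ≤ ε := by
    intro i hi
    rw [hyeq]
    exact hmod3 _ (hgle (i + 1) hi) _ (hgle i hi.le) (by rw [dist_grid]; exact hk3)
  have hustep : ∀ i < N k, u ((i + 1 : ℕ) * h) = u (i * h) * Real.exp (-y i) := by
    intro i _
    rw [hu, hu, ← Real.exp_add, hyeq]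
    congr 1
    ring
  have hvstep : ∀ i < N k, v ((i + 1 : ℕ) * h) = v (i * h) + a * v (i * h) * x k i + e k i
      + d i + c i := by
    intro i _
    have h1 := heq k (i + 1)
    have h2 := heq k i
    have h3 := intervalIntegral.integral_interval_sub_left
      (hbvR.intervalIntegrable (μ := volume) 0 (((i + 1 : ℕ) * h : ℝ≥0) : ℝ))
      (hbvR.intervalIntegrable (μ := volume) 0 ((i * h : ℝ≥0) : ℝ))
    simp only [hd, hc]
    rw [← h3, ← hh] at *
    linarith
  have hmain := abs_euler_sum_le (u := fun i => u (i * h)) (v := fun i => v (i * h)) hNhR hustep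
    hvstep (fun i _ => rfl) (fun i hi => huM _ (hgle i hi.le)) (fun i hi => hvM _ (hgle i hi.le))
    hpb hcb hkD hxb hyb hε1 hε h.coe_nonneg
  simp only [Nat.cast_zero, zero_mul, hNh] at hmain
  have hysum : ∑ i ∈ Finset.range (N k), y i ^ 2 ≤ Q := by
    have hterm : ∀ i ∈ Finset.range (N k), y i ^ 2
        ≤ 2 * a ^ 2 * (x k i ^ 2 - h) + (2 * a ^ 2 * h + 2 * (M + a ^ 2) ^ 2 * h) := by
      intro i hi
      have hi' := Finset.mem_range.mp hi
      have h1 : |p i - a ^ 2 * h / 2| ≤ (M + a ^ 2) * h := by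
        refine (abs_sub _ _).trans ?_
        rw [abs_of_nonneg (by positivity : 0 ≤ a ^ 2 * (h : ℝ) / 2)]
        nlinarith [hpb i hi', mul_nonneg (sq_nonneg a) h.coe_nonneg]
      have h2 : (p i - a ^ 2 * h / 2) ^ 2 ≤ ((M + a ^ 2) * h) ^ 2 := by
        rw [← sq_abs]
        gcongr
      have h3 : (h : ℝ) ^ 2 ≤ h := by nlinarith [h.coe_nonneg]
      have h4 : ((M + a ^ 2) * (h : ℝ)) ^ 2 ≤ (M + a ^ 2) ^ 2 * h := by
        rw [mul_pow]; gcongr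
      have h5 : y i = a * x k i + (p i - a ^ 2 * h / 2) := by simp only [hy]; ring
      rw [h5]
      have h6 := add_sq_le (a := a * x k i) (b := p i - a ^ 2 * h / 2)
      rw [mul_pow] at h6
      linarith
    refine (Finset.sum_le_sum hterm).trans ?_
    rw [Finset.sum_add_distrib, ← Finset.mul_sum, Finset.sum_const, Finset.card_range,
      nsmul_eq_mul, hQ]
    have e1 : (N k : ℝ) * (2 * a ^ 2 * h + 2 * (M + a ^ 2) ^ 2 * h)
        = 2 * a ^ 2 * T + 2 * (M + a ^ 2) ^ 2 * T := by rw [← hNhR]; ring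
    rw [e1]
    have e2 : 2 * a ^ 2 * ∑ i ∈ Finset.range (N k), (x k i ^ 2 - (h : ℝ)) ≤ 2 * a ^ 2 * 1 := by
      gcongr
    linarith
  have hesum : (∑ i ∈ Finset.range (N k), e k i ^ 2) / ε ≤ ε := by
    rw [div_le_iff₀ hε, ← sq]
    exact hk7.le
  have b1 : M * (ε * (∑ i ∈ Finset.range (N k), y i ^ 2)
      + (∑ i ∈ Finset.range (N k), e k i ^ 2) / ε) ≤ M * (ε * Q + ε) := by gcongr
  have b2 : 3 * M * (N k * D k + M * (ε * T)) ≤ 3 * M * (ε + M * (ε * T)) := by gcongr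
  have b3 : M ^ 2 * (ε * (∑ i ∈ Finset.range (N k), y i ^ 2)
      + ε * (a ^ 2 + (M + a ^ 2) * (1 + |a|)) * T)
      ≤ M ^ 2 * (ε * Q + ε * (a ^ 2 + (M + a ^ 2) * (1 + |a|)) * T) := by gcongr
  have b4 : a ^ 2 / 2 * |∑ i ∈ Finset.range (N k), u (i * h) * v (i * h) * (x k i ^ 2 - (h : ℝ))|
      ≤ a ^ 2 / 2 * ε := by gcongr
  have hKe : ε * K = ε + a ^ 2 / 2 * ε + (M * (ε * Q + ε) + 3 * M * (ε + M * (ε * T))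
      + M ^ 2 * (ε * Q + ε * (a ^ 2 + (M + a ^ 2) * (1 + |a|)) * T)) := by
    rw [hK]; ring
  rw [hKe]
  linarith

/-! ### Itô integrals and quadratic variation on two-scale grids. -/

/-- The uniform partition of `[0, t]` with `k` steps of length `h`. -/
def TimePartition.uniform {t : ℝ≥0} (h : ℝ≥0) (k : ℕ) (hk : (k : ℝ≥0) * h = t) :
    TimePartition t where
  n := k
  pt := fun j => j * h
  mono := fun i j hij => by
    have : (i : ℝ≥0) ≤ j := by exact_mod_cast hij
    exact mul_le_mul_left this h
  pt_zero := by simp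
  pt_last := hk

theorem TimePartition.mesh_uniform_le {t : ℝ≥0} (h : ℝ≥0) (k : ℕ) (hk : (k : ℝ≥0) * h = t) :
    (TimePartition.uniform h k hk).mesh ≤ h := by
  refine Finset.sup_le fun i _ => ?_
  rw [tsub_le_iff_left]
  simp only [TimePartition.uniform]
  push_cast
  exact le_of_eq (by ring)

theorem tendsto_coe_div_succ (T : ℝ≥0) :
    Tendsto (fun n : ℕ => ((T / (n + 1 : ℕ) : ℝ≥0) : ℝ)) atTop (𝓝 0) := by
  simp only [NNReal.coe_div, NNReal.coe_natCast]
  exact tendsto_const_nhds.div_atTop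
    (tendsto_natCast_atTop_atTop.comp (tendsto_add_atTop_nat 1))

theorem sum_range_mul (f : ℕ → ℝ) (N b : ℕ) :
    ∑ j ∈ Finset.range (N * b), f j
      = ∑ i ∈ Finset.range N, ∑ j ∈ Finset.range b, f (i * b + j) := by
  induction N with
  | zero => simp
  | succ N ih => rw [Nat.succ_mul, Finset.sum_range_add, ih, Finset.sum_range_succ]

/-- Left sums along uniform grids of step `h / (m + 1)` converge in measure to the Itô integral
at every multiple of `h`. -/
theorem IsItoIntegral.tendsto_uniform {P : Measure Ω} {X B I : ℝ≥0 → Ω → ℝ}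
    (hI : IsItoIntegral P X B I) (h : ℝ≥0) (i : ℕ) :
    TendstoInMeasure P (fun (m : ℕ) ω => ∑ j ∈ Finset.range (i * (m + 1)),
      X (j * (h / (m + 1 : ℕ))) ω
        * (B ((j + 1 : ℕ) * (h / (m + 1 : ℕ))) ω - B (j * (h / (m + 1 : ℕ))) ω))
      atTop (I (i * h)) := by
  have hk : ∀ m : ℕ, ((i * (m + 1) : ℕ) : ℝ≥0) * (h / (m + 1 : ℕ)) = i * h := by
    intro m
    push_cast
    field_simp
  refine hI (i * h) (fun m => TimePartition.uniform _ _ (hk m)) ?_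
  refine tendsto_of_tendsto_of_tendsto_of_le_of_le tendsto_const_nhds ?_ (fun _ => zero_le)
    (fun m => TimePartition.mesh_uniform_le _ _ (hk m))
  exact NNReal.tendsto_coe.mp (tendsto_coe_div_succ h)

/-- The integral is approximated at each time separately; a union bound over the finitely many
coarse grid points yields one fine grid that serves all of them. -/
theorem IsItoIntegral.exists_uniform_close {P : Measure Ω} [IsFiniteMeasure P]
    {X B I : ℝ≥0 → Ω → ℝ} (hI : IsItoIntegral P X B I) (h : ℝ≥0) (N : ℕ) {δ : ℝ} (hδ : 0 < δ)
    {q : ENNReal} (hq : 0 < q) :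
    ∃ m : ℕ, P {ω | ∃ i ≤ N, δ ≤ |(∑ j ∈ Finset.range (i * (m + 1)),
      X (j * (h / (m + 1 : ℕ))) ω
        * (B ((j + 1 : ℕ) * (h / (m + 1 : ℕ))) ω - B (j * (h / (m + 1 : ℕ))) ω))
      - I (i * h) ω|} ≤ q := by
  have h1 : Tendsto (fun m : ℕ => ∑ i ∈ Finset.range (N + 1),
      P {ω | δ ≤ |(∑ j ∈ Finset.range (i * (m + 1)), X (j * (h / (m + 1 : ℕ))) ω
        * (B ((j + 1 : ℕ) * (h / (m + 1 : ℕ))) ω - B (j * (h / (m + 1 : ℕ))) ω))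
      - I (i * h) ω|}) atTop (𝓝 0) := by
    rw [show (0 : ENNReal) = ∑ i ∈ Finset.range (N + 1), 0 by simp]
    refine tendsto_finsetSum _ fun i _ => ?_
    exact (tendstoInMeasure_iff_norm.mp (hI.tendsto_uniform h i)) δ hδ
  obtain ⟨m, hm⟩ := (h1.eventually (gt_mem_nhds hq)).exists
  refine ⟨m, le_trans ?_ hm.le⟩
  refine le_trans (measure_mono ?_) (measure_biUnion_finset_le _ _)
  rintro ω ⟨i, hi, hω⟩
  exact mem_biUnion (Finset.mem_coe.mpr (Finset.mem_range.mpr (Nat.lt_succ_of_le hi))) hω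

theorem IsItoIntegral.ae_zero {P : Measure Ω} {X B I : ℝ≥0 → Ω → ℝ}
    (hI : IsItoIntegral P X B I) : ∀ᵐ ω ∂P, I 0 ω = 0 := by
  have h := hI.tendsto_uniform 0 0
  simp only [zero_mul, Finset.range_zero, Finset.sum_empty, Nat.cast_zero] at h
  obtain ⟨ns, -, hns⟩ := h.exists_seq_tendsto_ae
  filter_upwards [hns] with ω hω
  exact (tendsto_nhds_unique hω tendsto_const_nhds)

/-- Each coarse step is cut into `m + 1` fine ones, so the truncating quotient `j / (m + 1)` is the
index of the coarse step that starts at or before fine point `j`. -/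
theorem coarse_le (h : ℝ≥0) (m j : ℕ) :
    ((j / (m + 1) : ℕ) : ℝ≥0) * h ≤ j * (h / (m + 1 : ℕ)) := by
  have h1 : ((j / (m + 1) : ℕ) : ℝ≥0) * (m + 1 : ℕ) ≤ j := by
    exact_mod_cast Nat.div_mul_le_self j (m + 1)
  have h2 : ((j / (m + 1) : ℕ) : ℝ≥0) * h
      = ((j / (m + 1) : ℕ) : ℝ≥0) * (m + 1 : ℕ) * (h / (m + 1 : ℕ)) := by
    field_simp
  rw [h2]
  gcongr

theorem dist_coarse_le (h : ℝ≥0) (m j : ℕ) :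
    dist ((j : ℝ≥0) * (h / (m + 1 : ℕ))) (((j / (m + 1) : ℕ) : ℝ≥0) * h) ≤ h := by
  have h0 := coarse_le h m j
  rw [NNReal.dist_eq, abs_of_nonneg (sub_nonneg.mpr (NNReal.coe_le_coe.mpr h0)),
    sub_le_iff_le_add']
  have h1 : (j : ℝ) ≤ ((j / (m + 1) : ℕ) : ℝ) * (m + 1 : ℕ) + (m + 1 : ℕ) := by
    have := Nat.lt_div_mul_add (a := j) (b := m + 1) (by omega)
    exact_mod_cast this.le
  have hm : (0 : ℝ) < (m + 1 : ℕ) := by positivity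
  push_cast at h1 hm ⊢
  have hh : (0 : ℝ) ≤ h := h.coe_nonneg
  rw [← mul_div_assoc, div_le_iff₀ hm]
  nlinarith

theorem fine_le {T : ℝ≥0} {N m j : ℕ} (hj : j ≤ N * (m + 1)) :
    (j : ℝ≥0) * (T / N / (m + 1 : ℕ)) ≤ T := by
  rw [div_div, ← Nat.cast_mul]
  exact grid_le hj

theorem tendsto_of_sq_tendsto {f : ℕ → ℝ} (h : Tendsto (fun n => f n ^ 2) atTop (𝓝 0)) :
    Tendsto f atTop (𝓝 0) := by
  have := (Real.continuous_sqrt.tendsto 0).comp h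
  simp only [Real.sqrt_zero, Function.comp_def, Real.sqrt_sq_eq_abs] at this
  exact (tendsto_zero_iff_abs_tendsto_zero _).mpr this

/-- The coarse block sums `∑ (X_s - X_[s]) ΔB` on a two-scale grid are negligible: both after
multiplication by an adapted process and in the sum of squares. -/
theorem IsBrownianWrt.two_scale {F : Filtration ℝ≥0 mΩ} {P : Measure Ω} [IsProbabilityMeasure P]
    {B : ℝ≥0 → Ω → ℝ} (hB : IsBrownianWrt F P B) {X U : ℝ≥0 → Ω → ℝ}
    (hX : ∀ s, Measurable[F s] (X s)) (hU : ∀ s, Measurable[F s] (U s))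
    (hXc : ∀ᵐ ω ∂P, Continuous fun t => X t ω) (hUc : ∀ᵐ ω ∂P, Continuous fun t => U t ω)
    (T : ℝ≥0) (m : ℕ → ℕ) :
    TendstoInMeasure P (fun (n : ℕ) ω =>
      (∑ j ∈ Finset.range ((n + 1) * (m n + 1)),
        U (((j / (m n + 1) : ℕ) : ℝ≥0) * (T / (n + 1 : ℕ))) ω
        * (X ((j : ℝ≥0) * (T / (n + 1 : ℕ) / (m n + 1 : ℕ))) ω
          - X (((j / (m n + 1) : ℕ) : ℝ≥0) * (T / (n + 1 : ℕ))) ω)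
        * (B (((j + 1 : ℕ) : ℝ≥0) * (T / (n + 1 : ℕ) / (m n + 1 : ℕ))) ω
          - B ((j : ℝ≥0) * (T / (n + 1 : ℕ) / (m n + 1 : ℕ))) ω)) ^ 2)
      atTop (fun _ => 0) ∧
    TendstoInMeasure P (fun (n : ℕ) ω => ∑ i ∈ Finset.range (n + 1),
      (∑ j ∈ Finset.range (m n + 1),
        (X (((i * (m n + 1) + j : ℕ) : ℝ≥0) * (T / (n + 1 : ℕ) / (m n + 1 : ℕ))) ω
          - X ((((i * (m n + 1) + j) / (m n + 1) : ℕ) : ℝ≥0) * (T / (n + 1 : ℕ))) ω)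
        * (B (((i * (m n + 1) + j + 1 : ℕ) : ℝ≥0) * (T / (n + 1 : ℕ) / (m n + 1 : ℕ))) ω
          - B (((i * (m n + 1) + j : ℕ) : ℝ≥0) * (T / (n + 1 : ℕ) / (m n + 1 : ℕ))) ω)) ^ 2)
      atTop (fun _ => 0) := by
  have hcoarse : ∀ {Z : ℝ≥0 → Ω → ℝ}, (∀ s, Measurable[F s] (Z s)) → ∀ n i : ℕ,
      Measurable[F ((i : ℝ≥0) * (T / (n + 1 : ℕ) / (m n + 1 : ℕ)))]
        (Z (((i / (m n + 1) : ℕ) : ℝ≥0) * (T / (n + 1 : ℕ)))) := fun hZ n i =>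
    (hZ _).mono (F.mono (coarse_le _ _ _)) le_rfl
  have hK : ∀ n i : ℕ, Measurable[F ((i : ℝ≥0) * (T / (n + 1 : ℕ) / (m n + 1 : ℕ)))]
      (fun ω => X ((i : ℝ≥0) * (T / (n + 1 : ℕ) / (m n + 1 : ℕ))) ω
        - X (((i / (m n + 1) : ℕ) : ℝ≥0) * (T / (n + 1 : ℕ))) ω) := fun n i =>
    (hX _).sub (hcoarse hX n i)
  have hh0 := tendsto_coe_div_succ T
  have hsup : ∀ᵐ ω ∂P, ∀ ε > 0, ∀ᶠ n in atTop, ∀ i < (n + 1) * (m n + 1),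
      |X ((i : ℝ≥0) * (T / (n + 1 : ℕ) / (m n + 1 : ℕ))) ω
        - X (((i / (m n + 1) : ℕ) : ℝ≥0) * (T / (n + 1 : ℕ))) ω| ≤ ε := by
    filter_upwards [hXc] with ω hω ε hε
    obtain ⟨δ, hδ, hmod⟩ := Continuous.exists_modulus hω T hε
    filter_upwards [hh0.eventually (gt_mem_nhds hδ)] with n hn i hi
    have hf := fine_le (T := T) hi.le
    exact hmod _ hf _ ((coarse_le _ _ _).trans hf) ((dist_coarse_le _ _ _).trans_lt hn)
  have hvar : ∀ n : ℕ, ((n + 1 : ℕ) : ℝ) * (((m n + 1 : ℕ) : ℝ)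
      * ((T / (n + 1 : ℕ) / (m n + 1 : ℕ) : ℝ≥0) : ℝ)) = T := fun n => by
    push_cast
    field_simp
  constructor
  -- A single block makes the block sum the square of the entire weighted sum; the second claim uses
  -- one block per coarse step. The weight `U` is taken at coarse points, so it belongs to the past
  -- of each fine increment.
  · have key := tendstoInMeasure_block_sum (P := P) (a := fun _ => 1)
      (b := fun n => (n + 1) * (m n + 1)) (C := T)
      (ξ := fun n j ω => B (((j + 1 : ℕ) : ℝ≥0) * (T / (n + 1 : ℕ) / (m n + 1 : ℕ))) ω
          - B ((j : ℝ≥0) * (T / (n + 1 : ℕ) / (m n + 1 : ℕ))) ω)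
      (K := fun n i ω => U (((i / (m n + 1) : ℕ) : ℝ≥0) * (T / (n + 1 : ℕ))) ω
        * (X ((i : ℝ≥0) * (T / (n + 1 : ℕ) / (m n + 1 : ℕ))) ω
          - X (((i / (m n + 1) : ℕ) : ℝ≥0) * (T / (n + 1 : ℕ))) ω))
      (fun n => hB.isNoise_increments (T / (n + 1 : ℕ) / (m n + 1 : ℕ)))
      (fun n i => (hcoarse hU n i).mul (hK n i)) (fun n => ?_) ?_
    · refine key.congr_left fun n => ae_of_all _ fun ω => ?_
      simp only [Finset.range_one, Finset.sum_singleton, zero_mul, zero_add]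
    · rw [← hvar n]
      push_cast
      exact le_of_eq (by ring)
    · filter_upwards [hsup, hUc] with ω hω hUω ε hε
      obtain ⟨M, hM⟩ := Continuous.exists_abs_le hUω T
      have hM0 : 0 ≤ M := (abs_nonneg _).trans (hM 0 zero_le)
      filter_upwards [hω (ε / (M + 1)) (by positivity)] with n hn i hi
      rw [one_mul] at hi
      rw [abs_mul]
      calc _ ≤ M * (ε / (M + 1)) := by
            refine mul_le_mul (hM _ ?_) (hn i hi) (abs_nonneg _) hM0
            exact (coarse_le _ _ _).trans (fine_le (T := T) hi.le)
        _ ≤ ε := by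
            rw [← mul_div_assoc, div_le_iff₀ (by positivity)]
            nlinarith
  · exact tendstoInMeasure_block_sum (a := fun n => n + 1) (b := fun n => m n + 1)
      (C := T)
      (ξ := fun n j ω => B (((j + 1 : ℕ) : ℝ≥0) * (T / (n + 1 : ℕ) / (m n + 1 : ℕ))) ω
          - B ((j : ℝ≥0) * (T / (n + 1 : ℕ) / (m n + 1 : ℕ))) ω)
      (K := fun n i ω => X ((i : ℝ≥0) * (T / (n + 1 : ℕ) / (m n + 1 : ℕ))) ω
          - X (((i / (m n + 1) : ℕ) : ℝ≥0) * (T / (n + 1 : ℕ))) ω)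
      (fun n => hB.isNoise_increments (T / (n + 1 : ℕ) / (m n + 1 : ℕ)))
      hK (fun n => (hvar n).le) hsup

/-- For an adapted continuous `H`, the sums `∑ H ((ΔB)² - Δt)` along uniform grids tend to `0`. -/
theorem IsBrownianWrt.quadratic_variation {F : Filtration ℝ≥0 mΩ} {P : Measure Ω}
    [IsProbabilityMeasure P] {B : ℝ≥0 → Ω → ℝ} (hB : IsBrownianWrt F P B) {H : ℝ≥0 → Ω → ℝ}
    (hH : ∀ s, Measurable[F s] (H s)) (hHc : ∀ᵐ ω ∂P, Continuous fun t => H t ω) (T : ℝ≥0) :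
    TendstoInMeasure P (fun (n : ℕ) ω => (∑ j ∈ Finset.range (n + 1),
        H (j * (T / (n + 1 : ℕ))) ω * ((B ((j + 1 : ℕ) * (T / (n + 1 : ℕ))) ω
          - B (j * (T / (n + 1 : ℕ))) ω) ^ 2 - ((T / (n + 1 : ℕ) : ℝ≥0) : ℝ))) ^ 2)
      atTop (fun _ => 0) := by
  have hs : ∀ n : ℕ, √((n + 1 : ℕ) : ℝ) ≠ 0 := fun n => by positivity
  -- The noise is multiplied and the coefficient divided by `√(n + 1)`. The coefficients then tend
  -- uniformly to `0` on a continuous path, and the total variance bound is exactly `T²` times the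
  -- fourth Gaussian moment.
  have key := tendstoInMeasure_block_sum (P := P) (a := fun _ => 1) (b := fun n => n + 1)
    (C := T ^ 2 * ∫ x, x ^ 4 ∂(gaussianReal 0 1))
    (K := fun n i ω => H (i * (T / (n + 1 : ℕ))) ω / √((n + 1 : ℕ) : ℝ))
    (fun n => hB.isNoise_sq_increments (T / (n + 1 : ℕ)) (√((n + 1 : ℕ) : ℝ)))
    (fun n i => (hH _).div_const _) (fun n => ?_) ?_
  · refine key.congr_left fun n => ae_of_all _ fun ω => ?_
    simp only [Finset.range_one, Finset.sum_singleton, zero_mul, zero_add]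
    congr 1
    refine Finset.sum_congr rfl fun j _ => ?_
    have := hs n
    field_simp
  · rw [Real.sq_sqrt (by positivity)]
    push_cast
    refine le_of_eq ?_
    field_simp
  · filter_upwards [hHc] with ω hω ε hε
    obtain ⟨M, hM⟩ := Continuous.exists_abs_le hω T
    have hlim : Tendsto (fun n : ℕ => M / √((n + 1 : ℕ) : ℝ)) atTop (𝓝 0) :=
      tendsto_const_nhds.div_atTop (Real.tendsto_sqrt_atTop.comp
        (tendsto_natCast_atTop_atTop.comp (tendsto_add_atTop_nat 1)))
    filter_upwards [hlim.eventually (gt_mem_nhds hε)] with n hn i hi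
    rw [one_mul] at hi
    rw [abs_div, abs_of_nonneg (Real.sqrt_nonneg _)]
    refine le_trans ?_ hn.le
    gcongr
    exact hM _ (grid_le hi.le)

theorem continuous_primitive_nnreal {b A : ℝ≥0 → ℝ} (hb : Continuous b)
    (hA : ∀ t : ℝ≥0, A t = ∫ s in (0 : ℝ)..t, b s.toNNReal) : Continuous A := by
  have hbR : Continuous fun s : ℝ => b s.toNNReal := hb.comp continuous_real_toNNReal
  have h := intervalIntegral.continuous_primitive (μ := volume)
    (fun x y => hbR.intervalIntegrable x y) 0
  have : A = (fun x => ∫ s in (0 : ℝ)..x, b s.toNNReal) ∘ ((↑) : ℝ≥0 → ℝ) := funext hA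
  rw [this]
  exact h.comp NNReal.continuous_coe

/-! ### The closed form of the linear stochastic equation. -/

/-- The block sum of `(a V_s - a V_[s]) ΔB` over the `i`-th block of a two-scale grid. -/
def blockError (a : ℝ) (V B : ℝ≥0 → ℝ) (h : ℝ≥0) (m i : ℕ) : ℝ :=
  ∑ j ∈ Finset.range (m + 1),
    (a * V (((i * (m + 1) + j : ℕ) : ℝ≥0) * (h / (m + 1 : ℕ))) - a * V ((i : ℝ≥0) * h))
      * (B (((i * (m + 1) + j + 1 : ℕ) : ℝ≥0) * (h / (m + 1 : ℕ)))
        - B (((i * (m + 1) + j : ℕ) : ℝ≥0) * (h / (m + 1 : ℕ))))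

theorem sub_leftSum_eq_blockError (a : ℝ) (V B : ℝ≥0 → ℝ) (h : ℝ≥0) (m i : ℕ) :
    (∑ j ∈ Finset.range ((i + 1) * (m + 1)), a * V (j * (h / (m + 1 : ℕ)))
        * (B ((j + 1 : ℕ) * (h / (m + 1 : ℕ))) - B (j * (h / (m + 1 : ℕ)))))
      - (∑ j ∈ Finset.range (i * (m + 1)), a * V (j * (h / (m + 1 : ℕ)))
        * (B ((j + 1 : ℕ) * (h / (m + 1 : ℕ))) - B (j * (h / (m + 1 : ℕ)))))
      = a * V (i * h) * (B ((i + 1 : ℕ) * h) - B (i * h)) + blockError a V B h m i := by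
  rw [Nat.succ_mul, Finset.sum_range_add, add_sub_cancel_left]
  have htel : B ((i + 1 : ℕ) * h) - B (i * h) = ∑ j ∈ Finset.range (m + 1),
      (B (((i * (m + 1) + j + 1 : ℕ) : ℝ≥0) * (h / (m + 1 : ℕ)))
        - B (((i * (m + 1) + j : ℕ) : ℝ≥0) * (h / (m + 1 : ℕ)))) := by
    have := Finset.sum_range_sub
      (fun j => B (((i * (m + 1) + j : ℕ) : ℝ≥0) * (h / (m + 1 : ℕ)))) (m + 1)
    simp only [← add_assoc] at this
    rw [this]
    congr 2
    · push_cast; field_simp; ring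
    · push_cast; field_simp; ring
  rw [htel, blockError, Finset.mul_sum, ← Finset.sum_add_distrib]
  exact Finset.sum_congr rfl fun j _ => by ring

theorem block_div (i m j : ℕ) (hj : j < m + 1) : (i * (m + 1) + j) / (m + 1) = i := by
  rw [Nat.mul_comm, Nat.mul_add_div (by omega), Nat.div_eq_of_lt hj, add_zero]

/-- The solution of the linear equation `dV = b V dt + a V dB` is
`V₀ exp (a B - a² t / 2 + ∫ b)`. -/
theorem linear_sde_unique {F : Filtration ℝ≥0 mΩ} {P : Measure Ω} [IsProbabilityMeasure P]
    {B : ℝ≥0 → Ω → ℝ} (hB : IsBrownianWrt F P B) {V A b I : ℝ≥0 → Ω → ℝ} {a V₀ : ℝ}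
    (hV : ∀ s, Measurable[F s] (V s)) (hA : ∀ s, Measurable[F s] (A s))
    (hVc : ∀ᵐ ω ∂P, Continuous fun t => V t ω) (hbc : ∀ᵐ ω ∂P, Continuous fun t => b t ω)
    (hAb : ∀ᵐ ω ∂P, ∀ t : ℝ≥0, A t ω = ∫ s in (0 : ℝ)..t, b s.toNNReal ω)
    (hI : IsItoIntegral P (fun t ω => a * V t ω) B I)
    (heq : ∀ t : ℝ≥0, ∀ᵐ ω ∂P, V t ω = V₀
      + (∫ s in (0 : ℝ)..t, b s.toNNReal ω * V s.toNNReal ω) + I t ω) (T : ℝ≥0) :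
    ∀ᵐ ω ∂P, V T ω = V₀ * Real.exp (a * B T ω - a ^ 2 * T / 2 + A T ω) := by
  set U : ℝ≥0 → Ω → ℝ := fun t ω => Real.exp (-(a * B t ω) + a ^ 2 * t / 2 - A t ω) with hU
  have hBm : ∀ s, Measurable[F s] (B s) := fun s => hB.measurable_filtration le_rfl
  have hUm : ∀ s, Measurable[F s] (U s) := fun s =>
    Real.measurable_exp.comp (((((hBm s).const_mul a).neg).add_const _).sub (hA s))
  have hAc : ∀ᵐ ω ∂P, Continuous fun t => A t ω := by
    filter_upwards [hbc, hAb] with ω h1 h2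
    exact continuous_primitive_nnreal h1 h2
  have hUc : ∀ᵐ ω ∂P, Continuous fun t => U t ω := by
    filter_upwards [hAc, hB.brownian.cont] with ω h1 h2
    simp only [hU]
    fun_prop
  -- The fine scale is chosen so that all `n + 2` integral values are within `1 / (n + 1)²` outside
  -- an event of probability at most `2⁻ⁿ`. By Borel-Cantelli this eventually holds on almost every
  -- path, and the errors summed over `n + 1` steps still tend to `0`.
  have hex : ∀ n : ℕ, ∃ m : ℕ, P {ω | ∃ i ≤ n + 1, 1 / ((n + 1 : ℕ) : ℝ) ^ 2 ≤
      |(∑ j ∈ Finset.range (i * (m + 1)), a * V (j * (T / (n + 1 : ℕ) / (m + 1 : ℕ))) ω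
        * (B ((j + 1 : ℕ) * (T / (n + 1 : ℕ) / (m + 1 : ℕ))) ω
          - B (j * (T / (n + 1 : ℕ) / (m + 1 : ℕ))) ω))
      - I (i * (T / (n + 1 : ℕ))) ω|} ≤ 2⁻¹ ^ n := fun n =>
    hI.exists_uniform_close _ _ (by positivity) (ENNReal.pow_pos (by simp) n)
  choose m hm using hex
  have hBC := ae_eventually_notMem (ne_top_of_le_ne_top
    (by rw [ENNReal.tsum_geometric]; simp) (ENNReal.tsum_le_tsum hm))
  obtain ⟨hS1, hS2⟩ := hB.two_scale (X := fun t ω => a * V t ω) (fun s => (hV s).const_mul a) hUm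
    (by filter_upwards [hVc] with ω h; fun_prop) hUc T m
  have hS3 := hB.quadratic_variation (H := fun t ω => U t ω * V t ω)
    (fun s => (hUm s).mul (hV s)) (by filter_upwards [hVc, hUc] with ω h1 h2; fun_prop) T
  have hS4 := hB.quadratic_variation (H := fun _ _ => 1)
    (fun s => measurable_const) (ae_of_all _ fun ω => continuous_const) T
  -- Convergence in measure gives almost sure convergence along a subsequence; nested extraction
  -- makes all four sums converge along the same one.
  obtain ⟨φ₁, hφ₁, h1⟩ := hS1.exists_seq_tendsto_ae
  obtain ⟨φ₂, hφ₂, h2⟩ := (hS2.comp hφ₁.tendsto_atTop).exists_seq_tendsto_ae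
  obtain ⟨φ₃, hφ₃, h3⟩ := (hS3.comp (hφ₁.comp hφ₂).tendsto_atTop).exists_seq_tendsto_ae
  obtain ⟨φ₄, hφ₄, h4⟩ :=
    (hS4.comp ((hφ₁.comp hφ₂).comp hφ₃).tendsto_atTop).exists_seq_tendsto_ae
  set φ : ℕ → ℕ := ((φ₁ ∘ φ₂) ∘ φ₃) ∘ φ₄ with hφdef
  have hφ : StrictMono φ := ((hφ₁.comp hφ₂).comp hφ₃).comp hφ₄
  have heqall : ∀ᵐ ω ∂P, ∀ n i : ℕ, V (i * (T / (n + 1 : ℕ))) ω = V₀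
      + (∫ s in (0 : ℝ)..((i * (T / (n + 1 : ℕ)) : ℝ≥0) : ℝ), b s.toNNReal ω * V s.toNNReal ω)
      + I (i * (T / (n + 1 : ℕ))) ω := by
    rw [ae_all_iff]; intro n
    rw [ae_all_iff]; intro i
    exact heq _
  filter_upwards [hVc, hbc, hAb, hAc, hB.brownian.cont, hB.ae_zero, hBC, h1, h2, h3, h4, heqall,
    heq 0, hI.ae_zero] with ω kV kb kAb kA kB kB0 kBC k1 k2 k3 k4 keq keq0 kI0
  have hV0 : V 0 ω = V₀ := by simpa [kI0] using keq0
  have hA0 : A 0 ω = 0 := by simpa using kAb 0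
  have hmain : U T ω * V T ω = U 0 ω * V 0 ω := by
    refine path_mul_eq_of_euler (T := T) (a := a) (v₀ := V₀) (v := fun t => V t ω)
      (β := fun t => B t ω) (A := fun t => A t ω) (b := fun t => b t ω) (I := fun t => I t ω)
      (u := fun t => U t ω) kV kB kb kA kAb (fun t => rfl) (N := fun k => φ k + 1)
      ((tendsto_add_atTop_nat 1).comp hφ.tendsto_atTop) (fun k => Nat.succ_pos _)
      (fun k i => keq (φ k) i)
      (x := fun k i => B ((i + 1 : ℕ) * (T / (φ k + 1 : ℕ))) ω - B (i * (T / (φ k + 1 : ℕ))) ω)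
      (e := fun k i => blockError a (fun t => V t ω) (fun t => B t ω) (T / (φ k + 1 : ℕ))
        (m (φ k)) i)
      (D := fun k => 2 / ((φ k + 1 : ℕ) : ℝ) ^ 2) (fun k i => rfl) ?_ ?_ ?_ ?_ ?_ ?_
    -- An increment of `I` involves the approximation errors at both endpoints, hence the factor `2`
    -- in `D`.
    · filter_upwards [hφ.tendsto_atTop.eventually kBC] with k hk i hi
      have hk' : ∀ i ≤ φ k + 1, |(∑ j ∈ Finset.range (i * (m (φ k) + 1)),
          a * V (j * (T / (φ k + 1 : ℕ) / (m (φ k) + 1 : ℕ))) ω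
          * (B ((j + 1 : ℕ) * (T / (φ k + 1 : ℕ) / (m (φ k) + 1 : ℕ))) ω
            - B (j * (T / (φ k + 1 : ℕ) / (m (φ k) + 1 : ℕ))) ω))
          - I (i * (T / (φ k + 1 : ℕ))) ω| ≤ 1 / ((φ k + 1 : ℕ) : ℝ) ^ 2 := by
        intro i hi
        by_contra hcon
        exact hk ⟨i, hi, (not_le.mp hcon).le⟩
      have q1 := hk' (i + 1) hi
      have q2 := hk' i (Nat.le_of_lt hi)
      have q3 := sub_leftSum_eq_blockError a (fun t => V t ω) (fun t => B t ω)
        (T / (φ k + 1 : ℕ)) (m (φ k)) i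
      rw [abs_le] at q1 q2 ⊢
      have q4 : 2 / ((φ k + 1 : ℕ) : ℝ) ^ 2 = 1 / ((φ k + 1 : ℕ) : ℝ) ^ 2
        + 1 / ((φ k + 1 : ℕ) : ℝ) ^ 2 := by ring
      rw [q4]
      constructor <;> linarith
    · have : (fun k => ((φ k + 1 : ℕ) : ℝ) * (2 / ((φ k + 1 : ℕ) : ℝ) ^ 2))
          = fun k => 2 / ((φ k + 1 : ℕ) : ℝ) := by
        funext k
        have : ((φ k + 1 : ℕ) : ℝ) ≠ 0 := by positivity
        field_simp
      rw [this]
      exact tendsto_const_nhds.div_atTop (tendsto_natCast_atTop_atTop.comp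
        ((tendsto_add_atTop_nat 1).comp hφ.tendsto_atTop))
    · have k1' := k1.comp ((hφ₂.comp hφ₃).comp hφ₄).tendsto_atTop
      refine tendsto_of_sq_tendsto (k1'.congr fun k => ?_)
      simp only [Function.comp_def, hφdef]
      congr 1
      rw [sum_range_mul]
      refine Finset.sum_congr rfl fun i _ => ?_
      rw [blockError, Finset.mul_sum]
      refine Finset.sum_congr rfl fun j hj => ?_
      rw [block_div _ _ _ (Finset.mem_range.mp hj)]
      ring
    · have k2' := k2.comp (hφ₃.comp hφ₄).tendsto_atTop
      refine k2'.congr fun k => ?_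
      simp only [Function.comp_def, hφdef]
      refine Finset.sum_congr rfl fun i _ => ?_
      rw [blockError]
      congr 1
      refine Finset.sum_congr rfl fun j hj => ?_
      rw [block_div _ _ _ (Finset.mem_range.mp hj)]
    · exact tendsto_of_sq_tendsto (k3.comp hφ₄.tendsto_atTop)
    · have := tendsto_of_sq_tendsto k4
      simp only [one_mul] at this
      exact this
  have hU0 : U 0 ω = 1 := by simp [hU, kB0, hA0]
  rw [hU0, hV0, one_mul] at hmain
  rw [← hmain]
  simp only [hU]
  rw [mul_comm, ← mul_assoc, ← Real.exp_add]
  have : a * B T ω - a ^ 2 * T / 2 + A T ω + (-(a * B T ω) + a ^ 2 * T / 2 - A T ω) = 0 := by ring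
  rw [this, Real.exp_zero, one_mul]

/-! ### Joint exponential moments of the correlated pair. -/

/-- The exponent `3/2` exceeds `1`: over `n + 1` equal steps the increments add up to at most a
constant times `(n + 1)^(-1/2)`. -/
theorem eq_of_abs_sub_le_sqrt_pow {f : ℝ≥0 → ℝ} {T : ℝ≥0} {C : ℝ}
    (hf : ∀ s t : ℝ≥0, s ≤ t → t ≤ T → (t : ℝ) - s ≤ 1 → |f t - f s| ≤ C * √((t : ℝ) - s) ^ 3) :
    f T = f 0 := by
  have hb : ∀ᶠ n : ℕ in atTop, |f T - f 0| ≤ C * √(T : ℝ) ^ 3 / √((n + 1 : ℕ) : ℝ) := by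
    filter_upwards [(tendsto_coe_div_succ T).eventually (gt_mem_nhds one_pos)] with n hn
    set h : ℝ≥0 := T / (n + 1 : ℕ) with hh
    have htel : f T - f 0
        = ∑ i ∈ Finset.range (n + 1), (f ((i + 1 : ℕ) * h) - f (i * h)) := by
      rw [Finset.sum_range_sub (fun i : ℕ => f (i * h)) (n + 1)]
      have : ((n + 1 : ℕ) : ℝ≥0) * h = T := by rw [hh]; field_simp
      rw [this]
      simp
    have hterm : ∀ i ∈ Finset.range (n + 1),
        |f ((i + 1 : ℕ) * h) - f (i * h)| ≤ C * √(h : ℝ) ^ 3 := by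
      intro i hi
      have := hf _ _ (grid_le_succ h i) (grid_le (Finset.mem_range.mp hi))
        (by rw [grid_sub]; exact hn.le)
      rwa [grid_sub] at this
    rw [htel]
    refine (Finset.abs_sum_le_sum_abs _ _).trans ((Finset.sum_le_sum hterm).trans ?_)
    rw [Finset.sum_const, Finset.card_range, nsmul_eq_mul]
    have hs : √(h : ℝ) = √(T : ℝ) / √((n + 1 : ℕ) : ℝ) := by
      rw [hh, NNReal.coe_div, Real.sqrt_div T.coe_nonneg]
      simp
    have hp : 0 < √((n + 1 : ℕ) : ℝ) := by positivity
    have hsq : ((n + 1 : ℕ) : ℝ) = √((n + 1 : ℕ) : ℝ) ^ 2 := (Real.sq_sqrt (by positivity)).symm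
    rw [hs]
    set w := √((n + 1 : ℕ) : ℝ)
    rw [hsq]
    refine le_of_eq ?_
    field_simp
  have hlim : Tendsto (fun n : ℕ => C * √(T : ℝ) ^ 3 / √((n + 1 : ℕ) : ℝ)) atTop (𝓝 0) :=
    tendsto_const_nhds.div_atTop (Real.tendsto_sqrt_atTop.comp
      (tendsto_natCast_atTop_atTop.comp (tendsto_add_atTop_nat 1)))
  have h0 : |f T - f 0| ≤ 0 := ge_of_tendsto hlim hb
  exact sub_eq_zero.mp (abs_nonpos_iff.mp h0)

theorem abs_exp_sub_quadratic_le (z : ℝ) :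
    |Real.exp z - (1 + z + z ^ 2 / 2)| ≤ |z| ^ 3 * Real.exp |z| := by
  have h := Complex.norm_exp_sub_sum_le_norm_mul_exp (z : ℂ) 3
  simp only [Finset.sum_range_succ, Finset.range_zero, Finset.sum_empty, Nat.factorial] at h
  have e : Complex.exp z - (0 + (z : ℂ) ^ 0 / ((1 : ℕ) : ℂ) + (z : ℂ) ^ 1 / (((0 + 1) * 1 : ℕ) : ℂ)
      + (z : ℂ) ^ 2 / (((1 + 1) * ((0 + 1) * 1) : ℕ) : ℂ))
      = ((Real.exp z - (1 + z + z ^ 2 / 2) : ℝ) : ℂ) := by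
    push_cast
    ring
  rw [e, Complex.norm_real, Complex.norm_real, Real.norm_eq_abs, Real.norm_eq_abs] at h
  exact h

theorem abs_exp_sub_linear_le (z : ℝ) :
    |Real.exp z - (1 + z)| ≤ |z| ^ 2 * Real.exp |z| := by
  have h := Complex.norm_exp_sub_sum_le_norm_mul_exp (z : ℂ) 2
  simp only [Finset.sum_range_succ, Finset.range_zero, Finset.sum_empty, Nat.factorial] at h
  have e : Complex.exp z
      - (0 + (z : ℂ) ^ 0 / ((1 : ℕ) : ℂ) + (z : ℂ) ^ 1 / (((0 + 1) * 1 : ℕ) : ℂ))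
      = ((Real.exp z - (1 + z) : ℝ) : ℂ) := by
    push_cast
    ring
  rw [e, Complex.norm_real, Complex.norm_real, Real.norm_eq_abs, Real.norm_eq_abs] at h
  exact h

/-- The bound for the third order Taylor remainder of `exp`. -/
def expRem (L x : ℝ) : ℝ := (L * |x|) ^ 3 * Real.exp (L * |x|)

theorem measurable_expRem (L : ℝ) : Measurable (expRem L) := by
  unfold expRem
  fun_prop

theorem expRem_nonneg {L : ℝ} (hL : 0 ≤ L) (x : ℝ) : 0 ≤ expRem L x := by
  unfold expRem
  positivity

/-- Applied with `s = √h`, this is the source of the order `h^(3/2)`. -/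
theorem expRem_mul_le {L s : ℝ} (hL : 0 ≤ L) (hs : 0 ≤ s) (hs1 : s ≤ 1) (x : ℝ) :
    expRem L (s * x) ≤ s ^ 3 * expRem L x := by
  unfold expRem
  rw [abs_mul, abs_of_nonneg hs]
  have h1 : Real.exp (L * (s * |x|)) ≤ Real.exp (L * |x|) := by
    gcongr
    exact mul_le_of_le_one_left (abs_nonneg x) hs1
  calc (L * (s * |x|)) ^ 3 * Real.exp (L * (s * |x|))
      ≤ (L * (s * |x|)) ^ 3 * Real.exp (L * |x|) := by gcongr
    _ = _ := by ring

theorem integrable_expRem {L : ℝ} (hL : 0 ≤ L) : Integrable (expRem L) (gaussianReal 0 1) := by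
  have h1 := (integrable_exp_mul_gaussianReal (μ := 0) (v := 1) (2 * L)).add
    (integrable_exp_mul_gaussianReal (μ := 0) (v := 1) (-(2 * L)))
  refine (h1.const_mul 6).mono' (measurable_expRem L).aestronglyMeasurable (ae_of_all _ fun x => ?_)
  rw [Real.norm_of_nonneg (expRem_nonneg hL x)]
  have hy : 0 ≤ L * |x| := by positivity
  have h2 : (L * |x|) ^ 3 ≤ 6 * Real.exp (L * |x|) := by
    have := Real.pow_div_factorial_le_exp _ hy 3
    have h6 : ((Nat.factorial 3 : ℕ) : ℝ) = 6 := by norm_num [Nat.factorial]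
    rw [h6, div_le_iff₀ (by norm_num)] at this
    linarith
  have h3 : Real.exp (L * |x|) * Real.exp (L * |x|)
      ≤ Real.exp (2 * L * x) + Real.exp (-(2 * L) * x) := by
    rw [← Real.exp_add]
    rcases abs_cases x with ⟨h, -⟩ | ⟨h, -⟩ <;> rw [h]
    · have : L * x + L * x = 2 * L * x := by ring
      rw [this]
      linarith [Real.exp_pos (-(2 * L) * x)]
    · have : L * -x + L * -x = -(2 * L) * x := by ring
      rw [this]
      linarith [Real.exp_pos (2 * L * x)]
  calc expRem L x ≤ 6 * Real.exp (L * |x|) * Real.exp (L * |x|) := by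
        unfold expRem
        gcongr
    _ ≤ _ := by
        simp only [Pi.add_apply]
        linarith

/-- Dominating by the larger of `|x|` and `|w|` splits the remainder into functions of one increment
each. These can be integrated although the joint law of the two increments is not known. -/
theorem abs_exp_add_sub_le_expRem {l₁ l₂ : ℝ} (x w : ℝ) :
    |Real.exp (l₁ * x + l₂ * w) - (1 + (l₁ * x + l₂ * w) + (l₁ * x + l₂ * w) ^ 2 / 2)|
      ≤ expRem (|l₁| + |l₂|) x + expRem (|l₁| + |l₂|) w := by
  refine (abs_exp_sub_quadratic_le _).trans ?_
  have hL : 0 ≤ |l₁| + |l₂| := by positivity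
  have hz : |l₁ * x + l₂ * w| ≤ (|l₁| + |l₂|) * max |x| |w| := by
    refine (abs_add_le _ _).trans ?_
    rw [abs_mul, abs_mul, add_mul]
    gcongr
    · exact le_max_left _ _
    · exact le_max_right _ _
  have h1 : |l₁ * x + l₂ * w| ^ 3 * Real.exp |l₁ * x + l₂ * w|
      ≤ ((|l₁| + |l₂|) * max |x| |w|) ^ 3 * Real.exp ((|l₁| + |l₂|) * max |x| |w|) := by
    gcongr
  refine h1.trans ?_
  rcases max_cases |x| |w| with ⟨h, -⟩ | ⟨h, -⟩ <;> rw [h]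
  · exact le_add_of_nonneg_right (expRem_nonneg hL w)
  · exact le_add_of_nonneg_left (expRem_nonneg hL x)

theorem IsBrownianWrt.integrable_expRem {F : Filtration ℝ≥0 mΩ} {P : Measure Ω}
    {B : ℝ≥0 → Ω → ℝ} (hB : IsBrownianWrt F P B) {s t : ℝ≥0} (hst : s ≤ t)
    (h1 : (t : ℝ) - s ≤ 1) {L : ℝ} (hL : 0 ≤ L) :
    Integrable (fun ω => expRem L (B t ω - B s ω)) P ∧
    ∫ ω, expRem L (B t ω - B s ω) ∂P
      ≤ √((t : ℝ) - s) ^ 3 * ∫ x, expRem L x ∂(gaussianReal 0 1) := by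
  have hs1 : √((t : ℝ) - s) ≤ 1 := Real.sqrt_le_one.mpr h1
  have hint : Integrable (fun x => expRem L (√((t : ℝ) - s) * x)) (gaussianReal 0 1) := by
    refine ((LongTermGrowth.integrable_expRem hL).const_mul (√((t : ℝ) - s) ^ 3)).mono'
      ((measurable_expRem L).comp (measurable_const_mul _)).aestronglyMeasurable
      (ae_of_all _ fun x => ?_)
    rw [Real.norm_of_nonneg (expRem_nonneg hL _)]
    exact expRem_mul_le hL (Real.sqrt_nonneg _) hs1 x
  refine ⟨hB.integrable_sub hst (measurable_expRem L) hint, ?_⟩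
  rw [hB.integral_sub hst (measurable_expRem L), ← integral_const_mul]
  exact integral_mono hint ((LongTermGrowth.integrable_expRem hL).const_mul _)
    fun x => expRem_mul_le hL (Real.sqrt_nonneg _) hs1 x

section PairMGF

variable {F : Filtration ℝ≥0 mΩ} {P : Measure Ω} {B W : ℝ≥0 → Ω → ℝ}

theorem IsBrownianWrt.sub_zero_ae (hB : IsBrownianWrt F P B) (t : ℝ≥0) :
    (fun ω => B t ω - B 0 ω) =ᵐ[P] B t := by
  filter_upwards [hB.ae_zero] with ω hω
  rw [hω, sub_zero]

theorem IsBrownianWrt.memLp (hB : IsBrownianWrt F P B) (t : ℝ≥0) (p : ℝ≥0) : MemLp (B t) p P :=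
  (memLp_congr_ae (hB.sub_zero_ae t)).mp (hB.memLp_sub zero_le p)

theorem IsBrownianWrt.integrable_exp (hB : IsBrownianWrt F P B) (t : ℝ≥0) (c : ℝ) :
    Integrable (fun ω => Real.exp (c * B t ω)) P := by
  refine (hB.integrable_exp_sub (zero_le : 0 ≤ t) c).congr ?_
  filter_upwards [hB.sub_zero_ae t] with ω hω
  rw [hω]

theorem IsBrownianWrt.integral_exp (hB : IsBrownianWrt F P B) (t : ℝ≥0) (c : ℝ) :
    ∫ ω, Real.exp (c * B t ω) ∂P = Real.exp (c ^ 2 * t / 2) := by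
  have h := hB.integral_exp_sub (zero_le : 0 ≤ t) c
  rw [NNReal.coe_zero, sub_zero] at h
  rw [← h]
  refine integral_congr_ae ?_
  filter_upwards [hB.sub_zero_ae t] with ω hω
  rw [hω]

theorem exp_add_le (x y : ℝ) :
    Real.exp (x + y) ≤ (Real.exp (2 * x) + Real.exp (2 * y)) / 2 := by
  rw [Real.exp_add, two_mul, two_mul, Real.exp_add, Real.exp_add]
  nlinarith [sq_nonneg (Real.exp x - Real.exp y)]

theorem integrable_exp_pair (hB : IsBrownianWrt F P B) (hW : IsBrownianWrt F P W) (l₁ l₂ : ℝ)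
    (t : ℝ≥0) : Integrable (fun ω => Real.exp (l₁ * B t ω + l₂ * W t ω)) P := by
  refine (((hB.integrable_exp t (2 * l₁)).add (hW.integrable_exp t (2 * l₂))).div_const 2).mono'
    ?_ (ae_of_all _ fun ω => ?_)
  · exact (Real.measurable_exp.comp (((hB.measurable t).const_mul _).add
      ((hW.measurable t).const_mul _))).aestronglyMeasurable
  · rw [Real.norm_of_nonneg (Real.exp_pos _).le]
    simp only [Pi.add_apply, mul_assoc]
    exact exp_add_le _ _

theorem memLp_exp_pair (hB : IsBrownianWrt F P B) (hW : IsBrownianWrt F P W) (l₁ l₂ : ℝ)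
    (t : ℝ≥0) : MemLp (fun ω => Real.exp (l₁ * B t ω + l₂ * W t ω)) 2 P := by
  rw [memLp_two_iff_integrable_sq (integrable_exp_pair hB hW l₁ l₂ t).1]
  refine (integrable_exp_pair hB hW (2 * l₁) (2 * l₂) t).congr (ae_of_all _ fun ω => ?_)
  simp only
  rw [← Real.exp_nat_mul]
  congr 1
  push_cast
  ring

theorem memLp_mul_pair (hB : IsBrownianWrt F P B) (hW : IsBrownianWrt F P W) (s t : ℝ≥0) :
    MemLp (fun ω => W s ω * B t ω) 2 P := by
  have hm : AEStronglyMeasurable (fun ω => W s ω * B t ω) P :=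
    ((hW.measurable s).mul (hB.measurable t)).aestronglyMeasurable
  rw [memLp_two_iff_integrable_sq hm]
  have i1 := (hW.memLp s 4).integrable_norm_pow (by norm_num)
  have i2 := (hB.memLp t 4).integrable_norm_pow (by norm_num)
  refine (i1.add i2).mono' (hm.pow 2) (ae_of_all _ fun ω => ?_)
  have e4 : ∀ x : ℝ, |x| ^ 4 = x ^ 4 := fun x => Even.pow_abs (by decide) x
  simp only [Pi.add_apply, Real.norm_eq_abs]
  rw [abs_of_nonneg (sq_nonneg _), e4, e4]
  nlinarith [sq_nonneg (W s ω ^ 2 - B t ω ^ 2), sq_nonneg (W s ω ^ 2), sq_nonneg (B t ω ^ 2)]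

variable [IsProbabilityMeasure P]

/-- Conditional moments of the increments of a correlated pair, tested against an `F s`-measurable
weight `G`. -/
theorem integral_mul_increments (hB : IsBrownianWrt F P B) (hW : IsBrownianWrt F P W) {ρ : ℝ}
    (hWB : HasCrossVariation F P W B ρ) {s t : ℝ≥0} (hst : s ≤ t) {G : Ω → ℝ}
    (hGm : Measurable[F s] G) (hG : MemLp G 2 P) :
    ∫ ω, G ω * ((W t ω - W s ω) * (B t ω - B s ω)) ∂P = ρ * (t - s) * ∫ ω, G ω ∂P := by
  have hGs : StronglyMeasurable[F s] G := hGm.stronglyMeasurable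
  have hM2 : ∀ u : ℝ≥0, MemLp (fun ω => W u ω * B u ω - ρ * (u : ℝ)) 2 P := fun u =>
    (memLp_mul_pair hB hW u u).sub (memLp_const _)
  have hGi : Integrable G P := hG.integrable (by norm_num)
  have hmart : ∫ ω, G ω * (W t ω * B t ω - ρ * (t : ℝ)) ∂P
      = ∫ ω, G ω * (W s ω * B s ω - ρ * (s : ℝ)) ∂P := by
    have hint : Integrable (fun ω => G ω * (W t ω * B t ω - ρ * (t : ℝ))) P :=
      hG.integrable_mul (hM2 t)
    have h1 := condExp_mul_of_stronglyMeasurable_left (m := F s) (μ := P) hGs hint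
      ((hM2 t).integrable (by norm_num))
    have h2 := hWB.2 s t hst
    rw [← integral_condExp (F.le s) (μ := P)]
    refine integral_congr_ae ?_
    filter_upwards [h1, h2] with ω e1 e2
    rw [Pi.mul_apply, e2] at e1
    exact e1
  have iG1 : Integrable (fun ω => G ω * (W t ω * B t ω)) P :=
    hG.integrable_mul (memLp_mul_pair hB hW t t)
  have iG2 : Integrable (fun ω => G ω * (W s ω * B s ω)) P :=
    hG.integrable_mul (memLp_mul_pair hB hW s s)
  have iG3 : Integrable (fun ω => (W t ω - W s ω) * (G ω * B s ω)) P := by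
    refine (hG.integrable_mul ((memLp_mul_pair hB hW t s).sub (memLp_mul_pair hB hW s s))).congr
      (ae_of_all _ fun ω => ?_)
    simp only [Pi.mul_apply, Pi.sub_apply]
    ring
  have iG4 : Integrable (fun ω => (B t ω - B s ω) * (G ω * W s ω)) P := by
    refine (hG.integrable_mul ((memLp_mul_pair hB hW s t).sub (memLp_mul_pair hB hW s s))).congr
      (ae_of_all _ fun ω => ?_)
    simp only [Pi.mul_apply, Pi.sub_apply]
    ring
  have hz3 : ∫ ω, (W t ω - W s ω) * (G ω * B s ω) ∂P = 0 := by
    have hm : Measurable[F s] (fun ω => G ω * B s ω) := hGm.mul (hB.measurable_filtration le_rfl)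
    rw [(hW.indepFun_sub hst hm).integral_fun_mul_eq_mul_integral
      (hW.measurable_sub s t).aestronglyMeasurable (hm.mono (F.le s) le_rfl).aestronglyMeasurable,
      hW.integral_sub_eq_zero hst, zero_mul]
  have hz4 : ∫ ω, (B t ω - B s ω) * (G ω * W s ω) ∂P = 0 := by
    have hm : Measurable[F s] (fun ω => G ω * W s ω) := hGm.mul (hW.measurable_filtration le_rfl)
    rw [(hB.indepFun_sub hst hm).integral_fun_mul_eq_mul_integral
      (hB.measurable_sub s t).aestronglyMeasurable (hm.mono (F.le s) le_rfl).aestronglyMeasurable,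
      hB.integral_sub_eq_zero hst, zero_mul]
  -- The product of increments is the increment of `W B`, handled by the martingale property, minus
  -- increments multiplied by past quantities, whose means vanish by independence.
  have hsplit : ∀ ω, G ω * ((W t ω - W s ω) * (B t ω - B s ω))
      = (G ω * (W t ω * B t ω) - G ω * (W s ω * B s ω))
        - ((W t ω - W s ω) * (G ω * B s ω) + (B t ω - B s ω) * (G ω * W s ω)) := by
    intro ω; ring
  simp_rw [hsplit]
  have iD : Integrable (fun ω => G ω * (W t ω * B t ω) - G ω * (W s ω * B s ω)) P := iG1.sub iG2
  have iE : Integrable (fun ω => (W t ω - W s ω) * (G ω * B s ω)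
    + (B t ω - B s ω) * (G ω * W s ω)) P := iG3.add iG4
  rw [integral_sub iD iE, integral_sub iG1 iG2, integral_add iG3 iG4, hz3, hz4]
  have e1 : ∀ u : ℝ≥0, Integrable (fun ω => G ω * (W u ω * B u ω)) P →
      ∫ ω, G ω * (W u ω * B u ω - ρ * (u : ℝ)) ∂P
        = ∫ ω, G ω * (W u ω * B u ω) ∂P - ρ * u * ∫ ω, G ω ∂P := by
    intro u hu
    rw [← integral_const_mul, ← integral_sub hu (hGi.const_mul _)]
    exact integral_congr_ae (ae_of_all _ fun ω => by ring)
  rw [e1 t iG1, e1 s iG2] at hmart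
  linarith

/-- Factor out the past value `G` and expand the exponential of the increment to second order. The
linear terms have mean zero, the squares contribute `t - s` each, the mixed term `ρ (t - s)` by the
cross variation, and the remainder involves only one increment at a time. -/
theorem pair_step (hB : IsBrownianWrt F P B) (hW : IsBrownianWrt F P W) {ρ : ℝ}
    (hWB : HasCrossVariation F P W B ρ) (l₁ l₂ : ℝ) {s t : ℝ≥0} (hst : s ≤ t)
    (h1 : (t : ℝ) - s ≤ 1) :
    |∫ ω, Real.exp (l₁ * B t ω + l₂ * W t ω) ∂P
      - (1 + (l₁ ^ 2 + 2 * ρ * l₁ * l₂ + l₂ ^ 2) * (t - s) / 2)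
        * ∫ ω, Real.exp (l₁ * B s ω + l₂ * W s ω) ∂P|
      ≤ 2 * (∫ x, expRem (|l₁| + |l₂|) x ∂(gaussianReal 0 1)) * √((t : ℝ) - s) ^ 3
        * ∫ ω, Real.exp (l₁ * B s ω + l₂ * W s ω) ∂P := by
  have hL : 0 ≤ |l₁| + |l₂| := by positivity
  set G : Ω → ℝ := fun ω => Real.exp (l₁ * B s ω + l₂ * W s ω) with hG
  have hGm : Measurable[F s] G := Real.measurable_exp.comp
    (((hB.measurable_filtration le_rfl).const_mul _).add
      ((hW.measurable_filtration le_rfl).const_mul _))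
  have hGm' : AEStronglyMeasurable G P := (hGm.mono (F.le s) le_rfl).aestronglyMeasurable
  have hG2 : MemLp G 2 P := memLp_exp_pair hB hW l₁ l₂ s
  have hGi : Integrable G P := hG2.integrable (by norm_num)
  have hG0 : ∀ ω, 0 ≤ G ω := fun ω => (Real.exp_pos _).le
  -- functions of one increment factor out
  have hfac : ∀ {Y : ℝ≥0 → Ω → ℝ}, IsBrownianWrt F P Y → ∀ {f : ℝ → ℝ}, Measurable f →
      Integrable (fun ω => f (Y t ω - Y s ω)) P →
      Integrable (fun ω => G ω * f (Y t ω - Y s ω)) P ∧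
      ∫ ω, G ω * f (Y t ω - Y s ω) ∂P = (∫ ω, G ω ∂P) * ∫ ω, f (Y t ω - Y s ω) ∂P := by
    intro Y hY f hf hfi
    have hind : IndepFun G (fun ω => f (Y t ω - Y s ω)) P :=
      ((hY.indepFun_sub hst hGm).comp hf measurable_id).symm
    exact ⟨hind.integrable_mul hGi hfi, hind.integral_fun_mul_eq_mul_integral hGm' hfi.1⟩
  have hb1 := hfac hB (f := fun x => x) measurable_id
    ((hB.memLp_sub hst 1).integrable (by norm_num))
  have hw1 := hfac hW (f := fun x => x) measurable_id
    ((hW.memLp_sub hst 1).integrable (by norm_num))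
  have hb2 := hfac hB (f := fun x => x ^ 2) (by fun_prop) (hB.memLp_sub hst 2).integrable_sq
  have hw2 := hfac hW (f := fun x => x ^ 2) (by fun_prop) (hW.memLp_sub hst 2).integrable_sq
  have rb := hB.integrable_expRem hst h1 hL
  have rWi := hW.integrable_expRem hst h1 hL
  have hb3 := hfac hB (measurable_expRem _) rb.1
  have hw3 := hfac hW (measurable_expRem _) rWi.1
  have hcr := integral_mul_increments hB hW hWB hst hGm hG2
  have hcri : Integrable (fun ω => G ω * ((W t ω - W s ω) * (B t ω - B s ω))) P := by
    refine (hG2.integrable_mul (((memLp_mul_pair hB hW t t).sub (memLp_mul_pair hB hW t s)).sub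
      ((memLp_mul_pair hB hW s t).sub (memLp_mul_pair hB hW s s)))).congr
      (ae_of_all _ fun ω => ?_)
    simp only [Pi.mul_apply, Pi.sub_apply]
    ring
  rw [hB.integral_sub_eq_zero hst] at hb1
  rw [hW.integral_sub_eq_zero hst] at hw1
  rw [hB.integral_sub_sq hst] at hb2
  rw [hW.integral_sub_sq hst] at hw2
  set Q : Ω → ℝ := fun ω => G ω * (1 + (l₁ * (B t ω - B s ω) + l₂ * (W t ω - W s ω))
    + (l₁ * (B t ω - B s ω) + l₂ * (W t ω - W s ω)) ^ 2 / 2) with hQ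
  have hQeq : Q = fun ω => (G ω + l₁ * (G ω * (B t ω - B s ω)) + l₂ * (G ω * (W t ω - W s ω)))
      + (l₁ ^ 2 / 2 * (G ω * (B t ω - B s ω) ^ 2) + l₂ ^ 2 / 2 * (G ω * (W t ω - W s ω) ^ 2)
        + l₁ * l₂ * (G ω * ((W t ω - W s ω) * (B t ω - B s ω)))) := by
    funext ω
    simp only [hQ]
    ring
  have iA1 : Integrable (fun ω => G ω + l₁ * (G ω * (B t ω - B s ω))) P :=
    hGi.add (hb1.1.const_mul _)
  have iA : Integrable (fun ω => G ω + l₁ * (G ω * (B t ω - B s ω))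
      + l₂ * (G ω * (W t ω - W s ω))) P := iA1.add (hw1.1.const_mul _)
  have iC1 : Integrable (fun ω => l₁ ^ 2 / 2 * (G ω * (B t ω - B s ω) ^ 2)
      + l₂ ^ 2 / 2 * (G ω * (W t ω - W s ω) ^ 2)) P :=
    (hb2.1.const_mul _).add (hw2.1.const_mul _)
  have iC : Integrable (fun ω => l₁ ^ 2 / 2 * (G ω * (B t ω - B s ω) ^ 2)
      + l₂ ^ 2 / 2 * (G ω * (W t ω - W s ω) ^ 2)
      + l₁ * l₂ * (G ω * ((W t ω - W s ω) * (B t ω - B s ω)))) P := iC1.add (hcri.const_mul _)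
  have hQi : Integrable Q P := by rw [hQeq]; exact iA.add iC
  have hQval : ∫ ω, Q ω ∂P
      = (1 + (l₁ ^ 2 + 2 * ρ * l₁ * l₂ + l₂ ^ 2) * (t - s) / 2) * ∫ ω, G ω ∂P := by
    rw [hQeq, integral_add iA iC, integral_add iA1 (hw1.1.const_mul _),
      integral_add hGi (hb1.1.const_mul _), integral_add iC1 (hcri.const_mul _),
      integral_add (hb2.1.const_mul _) (hw2.1.const_mul _)]
    simp only [integral_const_mul]
    rw [hb1.2, hw1.2, hb2.2, hw2.2, hcr]
    ring
  have hei := integrable_exp_pair hB hW l₁ l₂ t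
  rw [← hQval, ← integral_sub hei hQi]
  refine (abs_integral_le_integral_abs).trans ?_
  have hle : ∫ ω, |Real.exp (l₁ * B t ω + l₂ * W t ω) - Q ω| ∂P
      ≤ ∫ ω, (G ω * expRem (|l₁| + |l₂|) (B t ω - B s ω)
        + G ω * expRem (|l₁| + |l₂|) (W t ω - W s ω)) ∂P := by
    refine integral_mono (hei.sub hQi).abs (hb3.1.add hw3.1) fun ω => ?_
    have e1 : Real.exp (l₁ * B t ω + l₂ * W t ω)
        = G ω * Real.exp (l₁ * (B t ω - B s ω) + l₂ * (W t ω - W s ω)) := by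
      simp only [hG]
      rw [← Real.exp_add]
      congr 1
      ring
    simp only [hQ]
    rw [e1, ← mul_sub, abs_mul, abs_of_nonneg (hG0 ω), ← mul_add]
    exact mul_le_mul_of_nonneg_left (abs_exp_add_sub_le_expRem _ _) (hG0 ω)
  refine hle.trans ?_
  rw [integral_add hb3.1 hw3.1, hb3.2, hw3.2]
  have hGnn : 0 ≤ ∫ ω, G ω ∂P := integral_nonneg hG0
  have m1 := mul_le_mul_of_nonneg_left rb.2 hGnn
  have m2 := mul_le_mul_of_nonneg_left rWi.2 hGnn
  refine (add_le_add m1 m2).trans (le_of_eq ?_)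
  ring

/-- This replaces joint normality: by `pair_step`, `exp (-q t / 2) φ t` has increments of order
`h^(3/2)`, so it keeps its value `1` at time `0`. -/
theorem integral_exp_pair (hB : IsBrownianWrt F P B) (hW : IsBrownianWrt F P W) {ρ : ℝ}
    (hWB : HasCrossVariation F P W B ρ) (l₁ l₂ : ℝ) (T : ℝ≥0) :
    ∫ ω, Real.exp (l₁ * B T ω + l₂ * W T ω) ∂P
      = Real.exp ((l₁ ^ 2 + 2 * ρ * l₁ * l₂ + l₂ ^ 2) * T / 2) := by
  set q : ℝ := l₁ ^ 2 + 2 * ρ * l₁ * l₂ + l₂ ^ 2 with hq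
  set φ : ℝ≥0 → ℝ := fun t => ∫ ω, Real.exp (l₁ * B t ω + l₂ * W t ω) ∂P with hφ
  set R : ℝ := ∫ x, expRem (|l₁| + |l₂|) x ∂(gaussianReal 0 1) with hR
  have hR0 : 0 ≤ R := integral_nonneg fun x => expRem_nonneg (by positivity) x
  have hφ0 : ∀ t, 0 ≤ φ t := fun t => integral_nonneg fun ω => (Real.exp_pos _).le
  -- A bound for `φ` on `[0, T]` from the two marginals alone, by `exp (x + y) ≤ (exp (2 x) + exp (2
  -- y)) / 2`.
  set Kφ : ℝ := (Real.exp ((2 * l₁) ^ 2 * T / 2) + Real.exp ((2 * l₂) ^ 2 * T / 2)) / 2 with hKφ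
  have hφK : ∀ t ≤ T, φ t ≤ Kφ := by
    intro t ht
    have ht' : (t : ℝ) ≤ T := ht
    have i1 := hB.integrable_exp t (2 * l₁)
    have i2 := hW.integrable_exp t (2 * l₂)
    calc φ t ≤ ∫ ω, (Real.exp (2 * l₁ * B t ω) + Real.exp (2 * l₂ * W t ω)) / 2 ∂P := by
          refine integral_mono (integrable_exp_pair hB hW l₁ l₂ t) ((i1.add i2).div_const 2)
            fun ω => ?_
          simp only [mul_assoc]
          exact exp_add_le _ _
      _ = (Real.exp ((2 * l₁) ^ 2 * t / 2) + Real.exp ((2 * l₂) ^ 2 * t / 2)) / 2 := by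
          rw [integral_div, integral_add i1 i2, hB.integral_exp, hW.integral_exp]
      _ ≤ Kφ := by
          rw [hKφ]
          gcongr
  have hconst := eq_of_abs_sub_le_sqrt_pow (T := T)
    (f := fun t => Real.exp (-(q * t / 2)) * φ t)
    (C := Real.exp (|q| * T / 2) * ((2 * R + q ^ 2 / 4 * Real.exp (|q| / 2)) * Kφ)) ?_
  · simp only [NNReal.coe_zero, mul_zero, zero_div, neg_zero, Real.exp_zero, one_mul] at hconst
    have h0 : φ 0 = 1 := by
      simp only [hφ]
      rw [integral_congr_ae (g := fun _ => (1 : ℝ))]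
      · simp
      · filter_upwards [hB.ae_zero, hW.ae_zero] with ω e1 e2
        simp [e1, e2]
    rw [h0] at hconst
    change φ T = _
    calc φ T = Real.exp (q * T / 2) * (Real.exp (-(q * T / 2)) * φ T) := by
          rw [← mul_assoc, ← Real.exp_add]; simp
      _ = _ := by rw [hconst, mul_one]
  · intro s t hst htT h1
    have hst' : (s : ℝ) ≤ t := hst
    have htT' : (t : ℝ) ≤ T := htT
    have hh0 : 0 ≤ (t : ℝ) - s := by linarith
    set w : ℝ := √((t : ℝ) - s) with hw
    have hw0 : 0 ≤ w := Real.sqrt_nonneg _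
    have hw1 : w ≤ 1 := Real.sqrt_le_one.mpr h1
    have hww : w ^ 2 = t - s := Real.sq_sqrt hh0
    have hstep := pair_step hB hW hWB l₁ l₂ hst h1
    have e1 : Real.exp (-(q * t / 2)) * φ t - Real.exp (-(q * s / 2)) * φ s
        = Real.exp (-(q * t / 2)) * ((φ t - (1 + q * (t - s) / 2) * φ s)
          + -((Real.exp (q * (t - s) / 2) - (1 + q * (t - s) / 2)) * φ s)) := by
      have : Real.exp (-(q * s / 2)) = Real.exp (-(q * t / 2)) * Real.exp (q * (t - s) / 2) := by
        rw [← Real.exp_add]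
        congr 1
        ring
      rw [this]
      ring
    have e2 : |Real.exp (q * (t - s) / 2) - (1 + q * (t - s) / 2)|
        ≤ q ^ 2 / 4 * Real.exp (|q| / 2) * w ^ 3 := by
      refine (abs_exp_sub_linear_le _).trans ?_
      rw [sq_abs]
      have a1 : |q * (t - s) / 2| ≤ |q| / 2 := by
        rw [abs_div, abs_mul, abs_of_nonneg hh0, abs_two]
        gcongr
        exact mul_le_of_le_one_right (abs_nonneg q) h1
      have a2 : (q * (t - s) / 2) ^ 2 ≤ q ^ 2 / 4 * w ^ 3 := by
        have : w ^ 4 ≤ w ^ 3 := pow_le_pow_of_le_one hw0 hw1 (by norm_num)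
        calc (q * (t - s) / 2) ^ 2 = q ^ 2 / 4 * w ^ 4 := by rw [← hww]; ring
          _ ≤ _ := by gcongr
      calc _ ≤ q ^ 2 / 4 * w ^ 3 * Real.exp (|q| / 2) := by gcongr
        _ = _ := by ring
    have e3 : Real.exp (-(q * t / 2)) ≤ Real.exp (|q| * T / 2) := by
      gcongr
      have : -(q * t) ≤ |q| * T := by
        calc -(q * t) = -q * t := by ring
          _ ≤ |q| * t := by gcongr; exact neg_le_abs q
          _ ≤ |q| * T := by gcongr
      linarith
    have hφs := hφK s (hst.trans htT)
    rw [e1, abs_mul, abs_of_nonneg (Real.exp_pos _).le, mul_assoc]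
    have e4 : |(φ t - (1 + q * (t - s) / 2) * φ s)
          + -((Real.exp (q * (t - s) / 2) - (1 + q * (t - s) / 2)) * φ s)|
        ≤ (2 * R + q ^ 2 / 4 * Real.exp (|q| / 2)) * Kφ * w ^ 3 := by
      refine (abs_add_le _ _).trans ?_
      rw [abs_neg, abs_mul, abs_of_nonneg (hφ0 s)]
      have a1 : 2 * R * w ^ 3 * φ s ≤ 2 * R * w ^ 3 * Kφ := by gcongr
      have a2 : |Real.exp (q * (t - s) / 2) - (1 + q * (t - s) / 2)| * φ s
          ≤ q ^ 2 / 4 * Real.exp (|q| / 2) * w ^ 3 * Kφ :=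
        mul_le_mul e2 hφs (hφ0 s) (by positivity)
      have a3 : |φ t - (1 + q * (t - s) / 2) * φ s| ≤ 2 * R * w ^ 3 * φ s := hstep
      refine (add_le_add (a3.trans a1) a2).trans (le_of_eq ?_)
      ring
    exact mul_le_mul e3 e4 (abs_nonneg _) (Real.exp_pos _).le

end PairMGF

/-! ### The Vasicek rate: its integral and its exponential moments. -/

theorem ae_forall_eq_of_continuous {P : Measure Ω} {X Y : ℝ≥0 → Ω → ℝ}
    (hX : ∀ᵐ ω ∂P, Continuous fun t => X t ω) (hY : ∀ᵐ ω ∂P, Continuous fun t => Y t ω)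
    (h : ∀ t, ∀ᵐ ω ∂P, X t ω = Y t ω) : ∀ᵐ ω ∂P, ∀ t, X t ω = Y t ω := by
  obtain ⟨s, hsc, hsd⟩ := TopologicalSpace.exists_countable_dense ℝ≥0
  have hs : ∀ᵐ ω ∂P, ∀ t ∈ s, X t ω = Y t ω := (ae_ball_iff hsc).mpr fun t _ => h t
  filter_upwards [hX, hY, hs] with ω h1 h2 h3 t
  exact congrFun (Continuous.ext_on hsd h1 h2 h3) t

section Vasicek

variable {F : Filtration ℝ≥0 mΩ} {P : Measure Ω} {W r : ℝ≥0 → Ω → ℝ} {κ γ δ r₀ : ℝ}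

theorem IsVasicek.ae_forall_eqn (hr : IsVasicek F P W κ γ δ r₀ r) (hW : IsBrownianWrt F P W) :
    ∀ᵐ ω ∂P, ∀ t : ℝ≥0,
      r t ω = r₀ + (∫ s in (0 : ℝ)..t, κ * (γ - r s.toNNReal ω)) + δ * W t ω := by
  refine ae_forall_eq_of_continuous hr.cont ?_ hr.eqn
  filter_upwards [hr.cont, hW.brownian.cont] with ω h1 h2
  have h3 : Continuous fun t : ℝ≥0 => ∫ s in (0 : ℝ)..t, κ * (γ - r s.toNNReal ω) :=
    continuous_primitive_nnreal (b := fun s => κ * (γ - r s ω)) (by fun_prop) (fun t => rfl)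
  fun_prop

/-- The integrated short rate, written as an adapted process. -/
def integratedRate (W r : ℝ≥0 → Ω → ℝ) (κ γ δ r₀ : ℝ) (t : ℝ≥0) (ω : Ω) : ℝ :=
  (r₀ + κ * γ * t + δ * W t ω - r t ω) / κ

theorem IsVasicek.measurable_filtration (hr : IsVasicek F P W κ γ δ r₀ r) (t : ℝ≥0) :
    Measurable[F t] (r t) :=
  (hr.adapted t).measurable

theorem IsVasicek.measurable_integratedRate (hr : IsVasicek F P W κ γ δ r₀ r)
    (hW : IsBrownianWrt F P W) (t : ℝ≥0) : Measurable[F t] (integratedRate W r κ γ δ r₀ t) :=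
  ((((hW.measurable_filtration le_rfl).const_mul δ).const_add _).sub
    (hr.measurable_filtration t)).div_const κ

/-- The rate equation is solved for `∫ r`. This trades the path integral for values at time `t`,
which makes adaptedness evident and isolates the perturbation `-r_t / κ`. -/
theorem IsVasicek.integratedRate_eq (hr : IsVasicek F P W κ γ δ r₀ r)
    (hW : IsBrownianWrt F P W) (hκ : 0 < κ) : ∀ᵐ ω ∂P, ∀ t : ℝ≥0,
      integratedRate W r κ γ δ r₀ t ω = ∫ s in (0 : ℝ)..t, r s.toNNReal ω := by
  filter_upwards [hr.ae_forall_eqn hW, hr.cont] with ω h hc t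
  have hcR : Continuous fun s : ℝ => r s.toNNReal ω := hc.comp continuous_real_toNNReal
  have h1 := h t
  rw [intervalIntegral.integral_const_mul, intervalIntegral.integral_sub
    (by simp) (hcR.intervalIntegrable _ _), intervalIntegral.integral_const] at h1
  rw [integratedRate, div_eq_iff hκ.ne', h1]
  simp only [sub_zero, smul_eq_mul]
  ring

end Vasicek

/-- Variation of constants for `dr = κ (γ - r) dt + dg` on uniform grids. -/
theorem tendsto_exp_weighted_sum {κ γ r₀ : ℝ} (hκ : 0 < κ) {r g : ℝ≥0 → ℝ} (hr : Continuous r)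
    (heq : ∀ t : ℝ≥0, r t = r₀ + (∫ s in (0 : ℝ)..t, κ * (γ - r s.toNNReal)) + g t) (T : ℝ≥0) :
    Tendsto (fun n : ℕ => ∑ i ∈ Finset.range (n + 1),
      Real.exp (κ * ((i * (T / (n + 1 : ℕ)) : ℝ≥0) : ℝ))
        * (g ((i + 1 : ℕ) * (T / (n + 1 : ℕ))) - g (i * (T / (n + 1 : ℕ))))) atTop
      (𝓝 (Real.exp (κ * T) * (r T - γ) - (r 0 - γ))) := by
  have hrR : Continuous fun s : ℝ => r s.toNNReal := hr.comp continuous_real_toNNReal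
  obtain ⟨M, hM⟩ := Continuous.exists_abs_le (hr.sub (continuous_const (y := γ))) T
  have hM0 : 0 ≤ M := (abs_nonneg _).trans (hM 0 zero_le)
  set K : ℝ := T * (Real.exp (κ * T) * (κ ^ 2 * Real.exp κ * M + κ)) with hK
  have hK0 : 0 ≤ K := by positivity
  rw [Metric.tendsto_atTop']
  intro ε' hε'
  set ε : ℝ := min 1 (ε' / (2 * (K + 1))) with hεdef
  have hε : 0 < ε := lt_min one_pos (by positivity)
  have hεK : ε * K < ε' := by
    have h1 : ε * K ≤ ε' / (2 * (K + 1)) * (K + 1) := by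
      have : ε ≤ ε' / (2 * (K + 1)) := min_le_right _ _
      gcongr
      linarith
    have h2 : ε' / (2 * (K + 1)) * (K + 1) = ε' / 2 := by field_simp
    linarith
  obtain ⟨δ, hδ, hmod⟩ := Continuous.exists_modulus hr T hε
  have ev := ((tendsto_coe_div_succ T).eventually (gt_mem_nhds hδ)).and
    ((tendsto_coe_div_succ T).eventually (gt_mem_nhds hε))
  obtain ⟨n₀, hn₀⟩ := eventually_atTop.mp ev
  refine ⟨n₀, fun n hn => ?_⟩
  obtain ⟨hn1, hn2⟩ := hn₀ n hn.le
  set h : ℝ≥0 := T / (n + 1 : ℕ) with hh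
  have hNh : ((n + 1 : ℕ) : ℝ≥0) * h = T := by rw [hh]; field_simp
  have hh1 : (h : ℝ) ≤ 1 := hn2.le.trans (min_le_left _ _)
  have htel : Real.exp (κ * T) * (r T - γ) - (r 0 - γ) = ∑ i ∈ Finset.range (n + 1),
      (Real.exp (κ * (((i + 1 : ℕ) * h : ℝ≥0) : ℝ)) * (r ((i + 1 : ℕ) * h) - γ)
        - Real.exp (κ * ((i * h : ℝ≥0) : ℝ)) * (r (i * h) - γ)) := by
    rw [Finset.sum_range_sub
      (fun i : ℕ => Real.exp (κ * ((i * h : ℝ≥0) : ℝ)) * (r (i * h) - γ)) (n + 1), hNh]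
    simp
  rw [dist_comm, Real.dist_eq, htel, ← Finset.sum_sub_distrib]
  refine lt_of_le_of_lt (Finset.abs_sum_le_sum_abs _ _) ?_
  have hterm : ∀ i ∈ Finset.range (n + 1),
      |Real.exp (κ * (((i + 1 : ℕ) * h : ℝ≥0) : ℝ)) * (r ((i + 1 : ℕ) * h) - γ)
        - Real.exp (κ * ((i * h : ℝ≥0) : ℝ)) * (r (i * h) - γ)
        - Real.exp (κ * ((i * h : ℝ≥0) : ℝ)) * (g ((i + 1 : ℕ) * h) - g (i * h))|
      ≤ h * (Real.exp (κ * T) * (κ ^ 2 * Real.exp κ * M + κ)) * ε := by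
    intro i hi
    have hi' := Finset.mem_range.mp hi
    have hle1 : ((i + 1 : ℕ) : ℝ≥0) * h ≤ T := grid_le hi'
    have hle0 : (i : ℝ≥0) * h ≤ T := grid_le hi'.le
    have hgR : ((i * h : ℝ≥0) : ℝ) ≤ (((i + 1 : ℕ) * h : ℝ≥0) : ℝ) := by
      exact_mod_cast grid_le_succ h i
    have hsub := grid_sub h i
    have e1 : Real.exp (κ * (((i + 1 : ℕ) * h : ℝ≥0) : ℝ))
        = Real.exp (κ * ((i * h : ℝ≥0) : ℝ)) * Real.exp (κ * h) := by
      rw [← Real.exp_add]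
      congr 1
      linear_combination κ * hsub
    have hconst : Continuous fun s : ℝ => κ * (γ - r s.toNNReal) := by fun_prop
    have e2 : r ((i + 1 : ℕ) * h) - r (i * h)
        = (∫ s in ((i * h : ℝ≥0) : ℝ)..(((i + 1 : ℕ) * h : ℝ≥0) : ℝ), κ * (γ - r s.toNNReal))
          + (g ((i + 1 : ℕ) * h) - g (i * h)) := by
      have q1 := heq ((i + 1 : ℕ) * h)
      have q2 := heq (i * h)
      have q3 := intervalIntegral.integral_interval_sub_left
        (hconst.intervalIntegrable (μ := volume) 0 (((i + 1 : ℕ) * h : ℝ≥0) : ℝ))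
        (hconst.intervalIntegrable (μ := volume) 0 ((i * h : ℝ≥0) : ℝ))
      rw [← q3]
      linarith
    -- The drift is frozen at the right endpoint, because the telescoping term `exp (κ h) (r_(i+1) -
    -- γ)` carries the right value. The one-step error is then `(exp (κ h) - 1 - κ h) (r_(i+1) - γ)
    -- + J`, up to the exponential weight, with `J` small by uniform continuity.
    set J : ℝ := ∫ s in ((i * h : ℝ≥0) : ℝ)..(((i + 1 : ℕ) * h : ℝ≥0) : ℝ),
      κ * (r ((i + 1 : ℕ) * h) - r s.toNNReal) with hJ
    have e3 : (∫ s in ((i * h : ℝ≥0) : ℝ)..(((i + 1 : ℕ) * h : ℝ≥0) : ℝ), κ * (γ - r s.toNNReal))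
        = J - κ * h * (r ((i + 1 : ℕ) * h) - γ) := by
      have q1 : κ * h * (r ((i + 1 : ℕ) * h) - γ)
          = ∫ s in ((i * h : ℝ≥0) : ℝ)..(((i + 1 : ℕ) * h : ℝ≥0) : ℝ),
            κ * (r ((i + 1 : ℕ) * h) - γ) := by
        rw [intervalIntegral.integral_const, hsub, smul_eq_mul]
        ring
      rw [hJ, q1, ← intervalIntegral.integral_sub
        ((show Continuous fun s : ℝ => κ * (r ((i + 1 : ℕ) * h) - r s.toNNReal) by
          fun_prop).intervalIntegrable _ _) (by simp)]
      exact intervalIntegral.integral_congr fun s _ => by ring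
    have hJb : |J| ≤ κ * ε * h := by
      rw [hJ, ← Real.norm_eq_abs]
      have q := intervalIntegral.norm_integral_le_of_norm_le_const (C := κ * ε)
        (a := ((i * h : ℝ≥0) : ℝ)) (b := (((i + 1 : ℕ) * h : ℝ≥0) : ℝ))
        (f := fun s : ℝ => κ * (r ((i + 1 : ℕ) * h) - r s.toNNReal)) (fun s hs => ?_)
      · rw [hsub, abs_of_nonneg h.coe_nonneg] at q
        exact q
      · rw [uIoc_of_le hgR] at hs
        obtain ⟨hs1, hs2⟩ := hs
        have hs0 : 0 ≤ s := (NNReal.coe_nonneg _).trans hs1.le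
        rw [norm_mul, Real.norm_of_nonneg hκ.le]
        gcongr
        refine hmod _ hle1 _ ?_ ?_
        · rw [Real.toNNReal_le_iff_le_coe]
          exact hs2.trans (by exact_mod_cast hle1)
        · rw [NNReal.dist_eq, Real.coe_toNNReal s hs0, abs_of_nonneg (by linarith)]
          linarith
    have e4 : Real.exp (κ * (((i + 1 : ℕ) * h : ℝ≥0) : ℝ)) * (r ((i + 1 : ℕ) * h) - γ)
        - Real.exp (κ * ((i * h : ℝ≥0) : ℝ)) * (r (i * h) - γ)
        - Real.exp (κ * ((i * h : ℝ≥0) : ℝ)) * (g ((i + 1 : ℕ) * h) - g (i * h))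
        = Real.exp (κ * ((i * h : ℝ≥0) : ℝ))
          * ((Real.exp (κ * h) - (1 + κ * h)) * (r ((i + 1 : ℕ) * h) - γ) + J) := by
      rw [e3] at e2
      rw [e1]
      linear_combination Real.exp (κ * ((i * h : ℝ≥0) : ℝ)) * e2
    have hκh : 0 ≤ κ * (h : ℝ) := by positivity
    have e5 : |Real.exp (κ * h) - (1 + κ * h)| ≤ κ ^ 2 * Real.exp κ * (ε * h) := by
      refine (abs_exp_sub_linear_le _).trans ?_
      rw [abs_of_nonneg hκh]
      have q1 : Real.exp (κ * h) ≤ Real.exp κ := by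
        gcongr
        exact mul_le_of_le_one_right hκ.le hh1
      have q2 : (κ * (h : ℝ)) ^ 2 ≤ κ ^ 2 * (ε * h) := by
        rw [mul_pow, sq (h : ℝ)]
        gcongr
      calc _ ≤ κ ^ 2 * (ε * h) * Real.exp κ := by gcongr
        _ = _ := by ring
    have e6 : Real.exp (κ * ((i * h : ℝ≥0) : ℝ)) ≤ Real.exp (κ * T) := by
      gcongr
    rw [e4, abs_mul, abs_of_nonneg (Real.exp_pos _).le]
    calc _ ≤ Real.exp (κ * T) * (κ ^ 2 * Real.exp κ * (ε * h) * M + κ * ε * h) := by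
          gcongr
          refine (abs_add_le _ _).trans (add_le_add ?_ hJb)
          rw [abs_mul]
          gcongr
          exact hM _ hle1
      _ = _ := by ring
  refine (Finset.sum_le_sum hterm).trans_lt ?_
  rw [Finset.sum_const, Finset.card_range, nsmul_eq_mul]
  have hNhR : ((n + 1 : ℕ) : ℝ) * (h : ℝ) = T := by exact_mod_cast hNh
  calc _ = ε * (((n + 1 : ℕ) : ℝ) * h * (Real.exp (κ * T) * (κ ^ 2 * Real.exp κ * M + κ))) := by
        ring
    _ = ε * K := by rw [hNhR, hK]
    _ < ε' := hεK

/-- Exponential moments of deterministic linear combinations of Brownian increments. -/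
theorem IsBrownianWrt.integral_exp_sum {F : Filtration ℝ≥0 mΩ} {P : Measure Ω}
    [IsProbabilityMeasure P] {W : ℝ≥0 → Ω → ℝ} (hW : IsBrownianWrt F P W) (h : ℝ≥0) (c : ℕ → ℝ)
    (N : ℕ) :
    Measurable[F (N * h)] (fun ω => ∑ i ∈ Finset.range N,
      c i * (W ((i + 1 : ℕ) * h) ω - W (i * h) ω)) ∧
    Integrable (fun ω => Real.exp (∑ i ∈ Finset.range N,
      c i * (W ((i + 1 : ℕ) * h) ω - W (i * h) ω))) P ∧
    ∫ ω, Real.exp (∑ i ∈ Finset.range N, c i * (W ((i + 1 : ℕ) * h) ω - W (i * h) ω)) ∂P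
      = Real.exp (∑ i ∈ Finset.range N, c i ^ 2 * h / 2) := by
  induction N with
  | zero => simp
  | succ N ih =>
    obtain ⟨ih1, ih2, ih3⟩ := ih
    have hle := grid_le_succ h N
    have hind := (hW.indepFun_sub hle (Real.measurable_exp.comp ih1)).comp
      (φ := fun x => Real.exp (c N * x)) (ψ := id) (by fun_prop) measurable_id
    have hsplit : ∀ ω, Real.exp (∑ i ∈ Finset.range (N + 1),
        c i * (W ((i + 1 : ℕ) * h) ω - W (i * h) ω))
        = Real.exp (c N * (W ((N + 1 : ℕ) * h) ω - W (N * h) ω))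
          * Real.exp (∑ i ∈ Finset.range N, c i * (W ((i + 1 : ℕ) * h) ω - W (i * h) ω)) := by
      intro ω
      rw [Finset.sum_range_succ, add_comm, Real.exp_add]
    have hi := hW.integrable_exp_sub hle (c N)
    refine ⟨?_, ?_, ?_⟩
    · simp_rw [Finset.sum_range_succ]
      exact (ih1.mono (F.mono hle) le_rfl).add
        (((hW.measurable_filtration le_rfl).sub (hW.measurable_filtration hle)).const_mul _)
    · simp_rw [hsplit]
      exact hind.integrable_mul hi ih2
    · simp_rw [hsplit]
      have := hind.integral_fun_mul_eq_mul_integral hi.1 ih2.1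
      simp only [Function.comp_def, id] at this
      rw [this, ih3, hW.integral_exp_sub hle, grid_sub, Finset.sum_range_succ, add_comm (∑ i ∈ _, _),
        Real.exp_add]

/-- Fatou's lemma; only the upper bound survives in the limit, and nothing more is needed. -/
theorem integrable_exp_of_tendsto {P : Measure Ω} {X : ℕ → Ω → ℝ} {Y : Ω → ℝ} {C : ℝ}
    (hX : ∀ n, Measurable (X n)) (hY : Measurable Y)
    (hi : ∀ n, Integrable (fun ω => Real.exp (X n ω)) P)
    (hC : ∀ n, ∫ ω, Real.exp (X n ω) ∂P ≤ C)
    (hlim : ∀ᵐ ω ∂P, Tendsto (fun n => X n ω) atTop (𝓝 (Y ω))) :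
    Integrable (fun ω => Real.exp (Y ω)) P ∧ ∫ ω, Real.exp (Y ω) ∂P ≤ C := by
  have hC0 : 0 ≤ C := (integral_nonneg fun ω => (Real.exp_pos _).le).trans (hC 0)
  have hle : ∫⁻ ω, ENNReal.ofReal (Real.exp (Y ω)) ∂P ≤ ENNReal.ofReal C := by
    calc ∫⁻ ω, ENNReal.ofReal (Real.exp (Y ω)) ∂P
        = ∫⁻ ω, liminf (fun n => ENNReal.ofReal (Real.exp (X n ω))) atTop ∂P := by
          refine lintegral_congr_ae ?_
          filter_upwards [hlim] with ω hω
          refine (Tendsto.liminf_eq ?_).symm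
          exact ENNReal.tendsto_ofReal ((Real.continuous_exp.tendsto _).comp hω)
      _ ≤ liminf (fun n => ∫⁻ ω, ENNReal.ofReal (Real.exp (X n ω)) ∂P) atTop :=
          lintegral_liminf_le fun n => (Real.measurable_exp.comp (hX n)).ennreal_ofReal
      _ ≤ ENNReal.ofReal C := by
          refine liminf_le_of_frequently_le' (Frequently.of_forall fun n => ?_)
          rw [← ofReal_integral_eq_lintegral_ofReal (hi n)
            (ae_of_all _ fun ω => (Real.exp_pos _).le)]
          exact ENNReal.ofReal_le_ofReal (hC n)
  have hm : AEStronglyMeasurable (fun ω => Real.exp (Y ω)) P :=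
    (Real.measurable_exp.comp hY).aestronglyMeasurable
  have hint : Integrable (fun ω => Real.exp (Y ω)) P := by
    refine ⟨hm, ?_⟩
    rw [hasFiniteIntegral_iff_ofReal (ae_of_all _ fun ω => (Real.exp_pos _).le)]
    exact hle.trans_lt ENNReal.ofReal_lt_top
  refine ⟨hint, ?_⟩
  rw [← ofReal_integral_eq_lintegral_ofReal hint (ae_of_all _ fun ω => (Real.exp_pos _).le)] at hle
  exact (ENNReal.ofReal_le_ofReal_iff hC0).mp hle

/-- The exponential moments of the Vasicek rate are bounded uniformly in time. -/
theorem IsVasicek.exp_moment {F : Filtration ℝ≥0 mΩ} {P : Measure Ω} [IsProbabilityMeasure P]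
    {W r : ℝ≥0 → Ω → ℝ} {κ γ δ r₀ : ℝ} (hr : IsVasicek F P W κ γ δ r₀ r)
    (hW : IsBrownianWrt F P W) (hκ : 0 < κ) (c : ℝ) (T : ℝ≥0) :
    Integrable (fun ω => Real.exp (c * r T ω)) P ∧
    ∫ ω, Real.exp (c * r T ω) ∂P
      ≤ Real.exp (|c| * (|γ| + |r₀ - γ|) + c ^ 2 * δ ^ 2 / (4 * κ)) := by
  -- The deterministic part of `c r_T` in `r_T = γ + exp (-κ T) (r₀ - γ) + δ ∫ exp (-κ (T - s))
  -- dW_s`; the coefficients `d` below discretize the stochastic part.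
  set A : ℝ := c * γ + c * Real.exp (-(κ * T)) * (r₀ - γ) with hA
  have hAle : A ≤ |c| * (|γ| + |r₀ - γ|) := by
    rw [hA, mul_add]
    refine add_le_add ?_ ?_
    · rw [← abs_mul]; exact le_abs_self _
    · refine (le_abs_self _).trans ?_
      rw [abs_mul, abs_mul, abs_of_nonneg (Real.exp_pos _).le]
      have : Real.exp (-(κ * T)) ≤ 1 := by
        rw [Real.exp_le_one_iff]
        have : 0 ≤ κ * (T : ℝ) := by positivity
        linarith
      gcongr
      exact mul_le_of_le_one_right (abs_nonneg c) this
  set d : ℕ → ℕ → ℝ := fun n i =>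
    c * δ * Real.exp (-(κ * T)) * Real.exp (κ * ((i * (T / (n + 1 : ℕ)) : ℝ≥0) : ℝ)) with hd
  -- A left Riemann sum of the increasing function `exp (2 κ s)` lies below its integral; here this
  -- is `2 κ h ≤ exp (2 κ h) - 1` and telescoping. The factor `exp (-2 κ T)` makes the bound
  -- independent of `T`.
  have hvar : ∀ n : ℕ, ∑ i ∈ Finset.range (n + 1), d n i ^ 2 * ((T / (n + 1 : ℕ) : ℝ≥0) : ℝ) / 2
      ≤ c ^ 2 * δ ^ 2 / (4 * κ) := by
    intro n
    set h : ℝ≥0 := T / (n + 1 : ℕ) with hh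
    have hNh : ((n + 1 : ℕ) : ℝ≥0) * h = T := by rw [hh]; field_simp
    have hterm : ∀ i ∈ Finset.range (n + 1), d n i ^ 2 * (h : ℝ) / 2
        ≤ c ^ 2 * δ ^ 2 / (4 * κ) * Real.exp (-(2 * κ * T))
          * (Real.exp (2 * κ * (((i + 1 : ℕ) * h : ℝ≥0) : ℝ))
            - Real.exp (2 * κ * ((i * h : ℝ≥0) : ℝ))) := by
      intro i _
      have hsub := grid_sub h i
      have e1 : Real.exp (2 * κ * (((i + 1 : ℕ) * h : ℝ≥0) : ℝ))
          = Real.exp (2 * κ * ((i * h : ℝ≥0) : ℝ)) * Real.exp (2 * κ * h) := by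
        rw [← Real.exp_add]
        congr 1
        linear_combination 2 * κ * hsub
      have e2 : 2 * κ * h ≤ Real.exp (2 * κ * h) - 1 := by
        linarith [Real.add_one_le_exp (2 * κ * (h : ℝ))]
      have e3 : d n i ^ 2 = c ^ 2 * δ ^ 2 * Real.exp (-(2 * κ * T))
          * Real.exp (2 * κ * ((i * h : ℝ≥0) : ℝ)) := by
        simp only [hd]
        rw [mul_pow, mul_pow, mul_pow, ← Real.exp_nat_mul, ← Real.exp_nat_mul]
        congr 2
        · congr 1
          push_cast; ring
        · rw [← hh]; push_cast; ring
      rw [e3, e1]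
      calc _ = c ^ 2 * δ ^ 2 / (4 * κ) * Real.exp (-(2 * κ * T))
            * (Real.exp (2 * κ * ((i * h : ℝ≥0) : ℝ)) * (2 * κ * h)) := by field_simp; ring
        _ ≤ c ^ 2 * δ ^ 2 / (4 * κ) * Real.exp (-(2 * κ * T))
            * (Real.exp (2 * κ * ((i * h : ℝ≥0) : ℝ)) * (Real.exp (2 * κ * h) - 1)) := by gcongr
        _ = _ := by ring
    refine (Finset.sum_le_sum hterm).trans ?_
    rw [← Finset.mul_sum, Finset.sum_range_sub
      (fun i : ℕ => Real.exp (2 * κ * ((i * h : ℝ≥0) : ℝ))) (n + 1), hNh]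
    have e4 : Real.exp (-(2 * κ * T)) * (Real.exp (2 * κ * T)
        - Real.exp (2 * κ * (((0 : ℕ) * h : ℝ≥0) : ℝ))) ≤ 1 := by
      rw [mul_sub, ← Real.exp_add]
      simp only [neg_add_cancel, Real.exp_zero]
      have := Real.exp_pos (-(2 * κ * (T : ℝ)))
      simp
      positivity
    rw [mul_assoc]
    exact mul_le_of_le_one_right (by positivity) e4
  refine integrable_exp_of_tendsto (X := fun n ω => A + ∑ i ∈ Finset.range (n + 1),
    d n i * (W ((i + 1 : ℕ) * (T / (n + 1 : ℕ))) ω - W (i * (T / (n + 1 : ℕ))) ω))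
    (fun n => ?_) ?_ (fun n => ?_) (fun n => ?_) ?_
  · exact ((hW.integral_exp_sum (T / (n + 1 : ℕ)) (d n) (n + 1)).1.mono (F.le _) le_rfl).const_add A
  · exact ((hr.measurable_filtration T).mono (F.le T) le_rfl).const_mul c
  · simp_rw [Real.exp_add]
    exact (hW.integral_exp_sum (T / (n + 1 : ℕ)) (d n) (n + 1)).2.1.const_mul _
  · simp_rw [Real.exp_add A]
    rw [integral_const_mul, (hW.integral_exp_sum (T / (n + 1 : ℕ)) (d n) (n + 1)).2.2,
      ← Real.exp_add]
    exact Real.exp_le_exp.mpr (add_le_add hAle (hvar n))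
  · filter_upwards [hr.ae_forall_eqn hW, hr.cont, hW.ae_zero] with ω h1 h2 h3
    have hlim := tendsto_exp_weighted_sum hκ h2 (g := fun t => δ * W t ω) h1 T
    have hr0 : r 0 ω = r₀ := by simpa [h3] using h1 0
    rw [hr0] at hlim
    have hlim2 := (hlim.const_mul (c * Real.exp (-(κ * T)))).const_add A
    have eY : A + c * Real.exp (-(κ * T)) * (Real.exp (κ * T) * (r T ω - γ) - (r₀ - γ))
        = c * r T ω := by
      have : Real.exp (-(κ * T)) * Real.exp (κ * T) = 1 := by
        rw [← Real.exp_add]; simp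
      rw [hA]
      linear_combination (c * (r T ω - γ)) * this
    rw [eY] at hlim2
    refine hlim2.congr fun n => ?_
    rw [Finset.mul_sum]
    congr 1
    refine Finset.sum_congr rfl fun i _ => ?_
    simp only [hd]
    ring

/-! ### Exponential growth rates under bounded perturbations. -/

/-- Hölder's inequality in logarithmic form. -/
theorem log_integral_exp_add_le {P : Measure Ω} [IsProbabilityMeasure P] {f g : Ω → ℝ} {s : ℝ}
    (hs0 : 0 < s) (hs1 : s < 1) (hf : Integrable (fun ω => Real.exp (f ω / s)) P)
    (hg : Integrable (fun ω => Real.exp (g ω / (1 - s))) P)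
    (hfm : Measurable f) (hgm : Measurable g)
    (hfg : Integrable (fun ω => Real.exp (f ω + g ω)) P) :
    Real.log (∫ ω, Real.exp (f ω + g ω) ∂P)
      ≤ s * Real.log (∫ ω, Real.exp (f ω / s) ∂P)
        + (1 - s) * Real.log (∫ ω, Real.exp (g ω / (1 - s)) ∂P) := by
  have hs2 : 0 < 1 - s := by linarith
  have hpq : (1 / s).HolderConjugate (1 / (1 - s)) := by
    rw [Real.holderConjugate_iff]
    refine ⟨by rw [lt_div_iff₀ hs0]; linarith, ?_⟩
    simp
  have hmem : ∀ {h : Ω → ℝ} {u : ℝ}, 0 < u → Measurable h →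
      Integrable (fun ω => Real.exp (h ω / u)) P →
      MemLp (fun ω => Real.exp (h ω)) (ENNReal.ofReal (1 / u)) P := by
    intro h u hu hm hi
    have hm' : AEStronglyMeasurable (fun ω => Real.exp (h ω)) P :=
      (Real.measurable_exp.comp hm).aestronglyMeasurable
    rw [← integrable_norm_rpow_iff hm' (by simpa using hu) ENNReal.ofReal_ne_top]
    refine hi.congr (ae_of_all _ fun ω => ?_)
    simp only
    rw [ENNReal.toReal_ofReal (by positivity), Real.norm_of_nonneg (Real.exp_pos _).le,
      ← Real.exp_mul]
    congr 1
    ring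
  have hH := integral_mul_le_Lp_mul_Lq_of_nonneg hpq (μ := P) (f := fun ω => Real.exp (f ω))
    (g := fun ω => Real.exp (g ω)) (ae_of_all _ fun ω => (Real.exp_pos _).le)
    (ae_of_all _ fun ω => (Real.exp_pos _).le) (hmem hs0 hfm hf) (hmem hs2 hgm hg)
  have e1 : ∀ x u : ℝ, Real.exp x ^ (1 / u) = Real.exp (x / u) := fun x u => by
    rw [← Real.exp_mul]; congr 1; ring
  simp only [e1, ← Real.exp_add, one_div_one_div] at hH
  have p1 : 0 < ∫ ω, Real.exp (f ω / s) ∂P := integral_exp_pos hf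
  have p2 : 0 < ∫ ω, Real.exp (g ω / (1 - s)) ∂P := integral_exp_pos hg
  have p0 : 0 < ∫ ω, Real.exp (f ω + g ω) ∂P := integral_exp_pos hfg
  have h3 := Real.log_le_log p0 hH
  rwa [Real.log_mul (Real.rpow_pos_of_pos p1 _).ne' (Real.rpow_pos_of_pos p2 _).ne',
    Real.log_rpow p1, Real.log_rpow p2] at h3

/-- A perturbation with bounded exponential moments does not change the exponential growth rate
of a Gaussian-type family. -/
theorem tendsto_log_integral_exp_add {P : Measure Ω} [IsProbabilityMeasure P]
    {X Y : ℝ≥0 → Ω → ℝ} (hXm : ∀ t, Measurable (X t)) (hYm : ∀ t, Measurable (Y t)) {Q : ℝ}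
    {C : ℝ → ℝ} (hXi : ∀ c t, Integrable (fun ω => Real.exp (c * X t ω)) P)
    (hX : ∀ (c : ℝ) (t : ℝ≥0), ∫ ω, Real.exp (c * X t ω) ∂P = Real.exp (c ^ 2 * Q * t / 2))
    (hYi : ∀ c t, Integrable (fun ω => Real.exp (c * Y t ω)) P)
    (hY : ∀ (c : ℝ) (t : ℝ≥0), ∫ ω, Real.exp (c * Y t ω) ∂P ≤ Real.exp (C c)) :
    (∀ t, Integrable (fun ω => Real.exp (X t ω + Y t ω)) P) ∧
    Tendsto (fun t : ℝ≥0 => 1 / (t : ℝ) * Real.log (∫ ω, Real.exp (X t ω + Y t ω) ∂P)) atTop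
      (𝓝 (Q / 2)) := by
  have hi : ∀ (c d : ℝ) (t : ℝ≥0), Integrable (fun ω => Real.exp (c * X t ω + d * Y t ω)) P := by
    intro c d t
    refine (((hXi (2 * c) t).add (hYi (2 * d) t)).div_const 2).mono' ?_ (ae_of_all _ fun ω => ?_)
    · exact (Real.measurable_exp.comp (((hXm t).const_mul _).add
        ((hYm t).const_mul _))).aestronglyMeasurable
    · rw [Real.norm_of_nonneg (Real.exp_pos _).le]
      simp only [Pi.add_apply, mul_assoc]
      exact exp_add_le _ _
  have hi1 : ∀ t, Integrable (fun ω => Real.exp (X t ω + Y t ω)) P := fun t => by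
    simpa using hi 1 1 t
  refine ⟨hi1, ?_⟩
  have hYlog : ∀ c t, Real.log (∫ ω, Real.exp (c * Y t ω) ∂P) ≤ C c := fun c t => by
    have := Real.log_le_log (integral_exp_pos (hYi c t)) (hY c t)
    rwa [Real.log_exp] at this
  have hXlog : ∀ (c : ℝ) (t : ℝ≥0),
      Real.log (∫ ω, Real.exp (c * X t ω) ∂P) = c ^ 2 * Q * t / 2 := fun c t => by
    rw [hX, Real.log_exp]
  -- Hölder with exponents `1 / s` and `1 / (1 - s)`. The cost of `Y` depends on `s` but not on `t`,
  -- so it disappears after division by `t`; only afterwards `s` is moved to `1`.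
  have hup : ∀ s : ℝ, 0 < s → s < 1 → ∀ t : ℝ≥0,
      Real.log (∫ ω, Real.exp (X t ω + Y t ω) ∂P)
        ≤ Q / (2 * s) * t + (1 - s) * C (1 / (1 - s)) := by
    intro s hs0 hs1 t
    have hs2 : 0 < 1 - s := by linarith
    have e1 : ∀ ω, X t ω / s = 1 / s * X t ω := fun ω => by ring
    have e2 : ∀ ω, Y t ω / (1 - s) = 1 / (1 - s) * Y t ω := fun ω => by ring
    have h := log_integral_exp_add_le hs0 hs1 (f := X t) (g := Y t)
      (by simp_rw [e1]; exact hXi _ t) (by simp_rw [e2]; exact hYi _ t) (hXm t) (hYm t) (hi1 t)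
    simp_rw [e1, e2] at h
    rw [hXlog] at h
    have h2 := mul_le_mul_of_nonneg_left (hYlog (1 / (1 - s)) t) hs2.le
    have h3 : s * ((1 / s) ^ 2 * Q * t / 2) = Q / (2 * s) * t := by field_simp
    linarith
  -- The reverse estimate is Hölder applied to `s X = s (X + Y) + (-s Y)`.
  have hlow : ∀ s : ℝ, 0 < s → s < 1 → ∀ t : ℝ≥0,
      s * Q / 2 * t - (1 - s) * C (-s / (1 - s)) / s
        ≤ Real.log (∫ ω, Real.exp (X t ω + Y t ω) ∂P) := by
    intro s hs0 hs1 t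
    have hs2 : 0 < 1 - s := by linarith
    have e0 : ∀ ω, s * (X t ω + Y t ω) + -s * Y t ω = s * X t ω := fun ω => by ring
    have e1 : ∀ ω, s * (X t ω + Y t ω) / s = X t ω + Y t ω := fun ω => by field_simp
    have e2 : ∀ ω, -s * Y t ω / (1 - s) = -s / (1 - s) * Y t ω := fun ω => by ring
    have h := log_integral_exp_add_le hs0 hs1 (f := fun ω => s * (X t ω + Y t ω))
      (g := fun ω => -s * Y t ω) (by simp_rw [e1]; exact hi1 t)
      (by simp_rw [e2]; exact hYi _ t) (((hXm t).add (hYm t)).const_mul s)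
      ((hYm t).const_mul _) (by simp_rw [e0]; exact hXi _ t)
    simp_rw [e0, e1, e2] at h
    rw [hXlog] at h
    have h2 := mul_le_mul_of_nonneg_left (hYlog (-s / (1 - s)) t) hs2.le
    have h3 : s * (s * Q / 2 * t - (1 - s) * C (-s / (1 - s)) / s)
        = s ^ 2 * Q * t / 2 - (1 - s) * C (-s / (1 - s)) := by field_simp
    refine le_of_mul_le_mul_left ?_ hs0
    linarith
  have hdiv : ∀ K : ℝ, Tendsto (fun t : ℝ≥0 => K / (t : ℝ)) atTop (𝓝 0) := fun K =>
    tendsto_const_nhds.div_atTop (NNReal.tendsto_coe_atTop.mpr tendsto_id)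
  have hpos : ∀ᶠ t : ℝ≥0 in atTop, 0 < (t : ℝ) := by
    filter_upwards [eventually_gt_atTop 0] with t ht
    exact_mod_cast ht
  have hnear : ∀ {p : ℝ → Prop}, (∀ᶠ s in 𝓝 (1 : ℝ), p s) → ∃ s, 0 < s ∧ s < 1 ∧ p s := by
    intro p hp
    have h1 : ∀ᶠ s in 𝓝[<] (1 : ℝ), p s := hp.filter_mono nhdsWithin_le_nhds
    have h2 : ∀ᶠ s in 𝓝[<] (1 : ℝ), s ∈ Ioo (0 : ℝ) 1 := Ioo_mem_nhdsLT one_pos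
    obtain ⟨s, hs1, hs2⟩ := (h1.and h2).exists
    exact ⟨s, hs2.1, hs2.2, hs1⟩
  rw [tendsto_order]
  constructor
  · intro a ha
    have hc : Tendsto (fun s : ℝ => s * Q / 2) (𝓝 1) (𝓝 (Q / 2)) := by
      have : Continuous fun s : ℝ => s * Q / 2 := by fun_prop
      simpa using this.tendsto 1
    obtain ⟨s, hs0, hs1, hs⟩ := hnear (hc.eventually (lt_mem_nhds ha))
    have hlim := (hdiv ((1 - s) * C (-s / (1 - s)) / s)).const_sub (s * Q / 2)
    rw [sub_zero] at hlim
    filter_upwards [hlim.eventually (lt_mem_nhds hs), hpos] with t h1 ht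
    refine h1.trans_le ?_
    rw [one_div, ← div_eq_inv_mul, le_div_iff₀ ht, sub_mul, div_mul_cancel₀ _ ht.ne']
    exact hlow s hs0 hs1 t
  · intro a ha
    have hc : Tendsto (fun s : ℝ => Q / (2 * s)) (𝓝 1) (𝓝 (Q / 2)) := by
      have : ContinuousAt (fun s : ℝ => Q / (2 * s)) 1 := by
        refine ContinuousAt.div continuousAt_const (by fun_prop) (by norm_num)
      simpa [ContinuousAt] using this
    obtain ⟨s, hs0, hs1, hs⟩ := hnear (hc.eventually (gt_mem_nhds ha))
    have hlim := (hdiv ((1 - s) * C (1 / (1 - s)))).const_add (Q / (2 * s))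
    rw [add_zero] at hlim
    filter_upwards [hlim.eventually (gt_mem_nhds hs), hpos] with t h1 ht
    refine lt_of_le_of_lt ?_ h1
    rw [one_div, ← div_eq_inv_mul, div_le_iff₀ ht, add_mul, div_mul_cancel₀ _ ht.ne']
    exact hup s hs0 hs1 t

/-! ### Maximizing a parabola on the unit interval. -/

section Optimization

variable {c₀ c₁ c₂ : ℝ} {Λ : ℝ → ℝ}

/-- For `b` in `[0, 1]` and `c₂ ≥ 0`, `Λ b - Λ 0 = b (c₁ + c₂ b) ≤ b (c₁ + c₂)`: convexity reduces
everything to comparing the endpoints. -/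
theorem isOptimal_zero_of_convex (hΛ : ∀ x, Λ x = c₀ + c₁ * x + c₂ * x ^ 2) (h2 : 0 ≤ c₂)
    (h : c₁ + c₂ ≤ 0) : IsOptimal Λ 0 := by
  refine ⟨⟨le_rfl, zero_le_one⟩, fun b hb => ?_⟩
  rw [hΛ, hΛ]
  nlinarith [hb.1, hb.2, mul_nonneg hb.1 (sub_nonneg.mpr hb.2),
    mul_nonneg h2 (mul_nonneg hb.1 (sub_nonneg.mpr hb.2)), mul_nonneg hb.1 (neg_nonneg.mpr h)]

theorem isUniqueOptimal_zero_of_convex (hΛ : ∀ x, Λ x = c₀ + c₁ * x + c₂ * x ^ 2) (h2 : 0 ≤ c₂)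
    (h : c₁ + c₂ < 0) : IsUniqueOptimal Λ 0 := by
  refine ⟨isOptimal_zero_of_convex hΛ h2 h.le, fun b hb => ?_⟩
  obtain ⟨⟨hb0, hb1⟩, hmax⟩ := hb
  have h0 := hmax 0 ⟨le_rfl, zero_le_one⟩
  rw [hΛ, hΛ] at h0
  by_contra hne
  have hpos : 0 < b := lt_of_le_of_ne hb0 (Ne.symm hne)
  nlinarith [mul_nonneg h2 (mul_nonneg hb0 (sub_nonneg.mpr hb1)), mul_pos hpos (neg_pos.mpr h)]

theorem isUniqueOptimal_one_of_convex (hΛ : ∀ x, Λ x = c₀ + c₁ * x + c₂ * x ^ 2) (h2 : 0 ≤ c₂)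
    (h : 0 < c₁ + c₂) : IsUniqueOptimal Λ 1 := by
  refine ⟨⟨⟨zero_le_one, le_rfl⟩, fun b hb => ?_⟩, fun b hb => ?_⟩
  · rw [hΛ, hΛ]
    nlinarith [mul_nonneg h2 (mul_nonneg hb.1 (sub_nonneg.mpr hb.2)),
      mul_nonneg h.le (sub_nonneg.mpr hb.2)]
  · obtain ⟨⟨hb0, hb1⟩, hmax⟩ := hb
    have h0 := hmax 1 ⟨zero_le_one, le_rfl⟩
    rw [hΛ, hΛ] at h0
    by_contra hne
    have hpos : 0 < 1 - b := sub_pos.mpr (lt_of_le_of_ne hb1 hne)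
    nlinarith [mul_nonneg h2 (mul_nonneg hb0 (sub_nonneg.mpr hb1)), mul_pos h hpos]

/-- A point of `[0, 1]` closest to the vertex is the unique maximizer of a concave parabola. -/
theorem isUniqueOptimal_of_concave (hΛ : ∀ x, Λ x = c₀ + c₁ * x + c₂ * x ^ 2) (h2 : c₂ < 0)
    {p : ℝ} (hp : p ∈ Icc (0 : ℝ) 1)
    (hvar : ∀ b ∈ Icc (0 : ℝ) 1, (c₁ + 2 * c₂ * p) * (b - p) ≤ 0) : IsUniqueOptimal Λ p := by
  have hdiff : ∀ b, Λ b - Λ p = (c₁ + 2 * c₂ * p) * (b - p) + c₂ * (b - p) ^ 2 := by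
    intro b
    rw [hΛ, hΛ]
    ring
  refine ⟨⟨hp, fun b hb => ?_⟩, fun b hb => ?_⟩
  · have := hdiff b
    nlinarith [hvar b hb, sq_nonneg (b - p)]
  · have h1 := hb.2 p hp
    have h3 := hdiff b
    have h4 := hvar b hb.1
    by_contra hne
    have h5 : 0 < (b - p) ^ 2 := by
      have : b - p ≠ 0 := sub_ne_zero.mpr hne
      positivity
    nlinarith [mul_pos (neg_pos.mpr h2) h5]

end Optimization

/-! ### Closed form of the wealth and growth rate of its utility. -/

section Wealth

variable {F : Filtration ℝ≥0 mΩ} {P : Measure Ω} [IsProbabilityMeasure P]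
  {B W r V : ℝ≥0 → Ω → ℝ} {μ σ κ γ δ r₀ V₀ α : ℝ}

/-- The wealth process in closed form. -/
theorem IsWealth.ae_forall_eq (hV : IsWealth F P B r μ σ V₀ α V) (hB : IsBrownianWrt F P B)
    (hW : IsBrownianWrt F P W) (hr : IsVasicek F P W κ γ δ r₀ r) (hκ : 0 < κ) :
    ∀ᵐ ω ∂P, ∀ t : ℝ≥0, V t ω = V₀ * Real.exp (α * σ * B t ω - (α * σ) ^ 2 * t / 2
      + (α * μ * t + (1 - α) * integratedRate W r κ γ δ r₀ t ω)) := by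
  obtain ⟨I, hI, heq⟩ := hV.eqn
  have hAm : ∀ s : ℝ≥0, Measurable[F s]
      (fun ω => α * μ * s + (1 - α) * integratedRate W r κ γ δ r₀ s ω) := fun s =>
    ((hr.measurable_integratedRate hW s).const_mul _).const_add _
  have hbc : ∀ᵐ ω ∂P, Continuous fun t => α * μ + (1 - α) * r t ω := by
    filter_upwards [hr.cont] with ω h
    fun_prop
  have hAb : ∀ᵐ ω ∂P, ∀ t : ℝ≥0, α * μ * t + (1 - α) * integratedRate W r κ γ δ r₀ t ω
      = ∫ s in (0 : ℝ)..t, (α * μ + (1 - α) * r s.toNNReal ω) := by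
    filter_upwards [hr.integratedRate_eq hW hκ, hr.cont] with ω h hc t
    have hcR : Continuous fun s : ℝ => (1 - α) * r s.toNNReal ω :=
      (hc.comp continuous_real_toNNReal).const_mul _
    rw [h t, intervalIntegral.integral_add (by simp) (hcR.intervalIntegrable _ _),
      intervalIntegral.integral_const, intervalIntegral.integral_const_mul]
    simp only [sub_zero, smul_eq_mul]
    ring
  have heq' : ∀ t : ℝ≥0, ∀ᵐ ω ∂P, V t ω = V₀ + (∫ s in (0 : ℝ)..t,
      (α * μ + (1 - α) * r s.toNNReal ω) * V s.toNNReal ω) + I t ω := by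
    intro t
    filter_upwards [heq t] with ω h
    rw [h]
    congr 2
    exact intervalIntegral.integral_congr fun s _ => by ring
  refine ae_forall_eq_of_continuous hV.cont ?_ (linear_sde_unique hB
    (fun s => (hV.adapted s).measurable) hAm hV.cont hbc hAb hI heq')
  filter_upwards [hr.cont, hW.brownian.cont, hB.brownian.cont] with ω h1 h2 h3
  unfold integratedRate
  fun_prop

/-- The long-term growth rate of expected utility as a function of the stock fraction. -/
def growthRate (μ σ κ γ δ ρ θ α : ℝ) : ℝ :=
  κ * γ * (θ * (1 - α) / κ + θ * α * σ * ρ / δ)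
    + δ ^ 2 / 2 * (θ * (1 - α) / κ + θ * α * σ * ρ / δ) ^ 2
    - θ * α * σ * κ * γ * ρ / δ
    + 1 / 2 * θ ^ 2 * α ^ 2 * σ ^ 2 * (1 - ρ ^ 2)
    + θ * α * μ - 1 / 2 * θ * α ^ 2 * σ ^ 2

/-- The form for the optimization: the coefficient of `α²` is `θ` times the quantity whose sign
separates the two cases. -/
theorem growthRate_eq {ρ θ : ℝ} (hκ : 0 < κ) (hδ : 0 < δ) (α : ℝ) :
    growthRate μ σ κ γ δ ρ θ α = (γ * θ + δ ^ 2 * θ ^ 2 / (2 * κ ^ 2))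
      + (-γ * θ + θ * μ + δ * θ ^ 2 * σ * ρ / κ - δ ^ 2 * θ ^ 2 / κ ^ 2) * α
      + θ * (δ ^ 2 * θ / (2 * κ ^ 2) - δ * θ * σ * ρ / κ + σ ^ 2 * θ / 2 - σ ^ 2 / 2)
        * α ^ 2 := by
  unfold growthRate
  field_simp
  ring

/-- The form in which the rate arises: a drift plus half the variance per unit time of `l₁ B + l₂
W`. The divisions by `δ` cancel. -/
theorem growthRate_eq_drift_add {ρ θ : ℝ} (hκ : 0 < κ) (hδ : 0 < δ) (α : ℝ) :
    growthRate μ σ κ γ δ ρ θ α = θ * (α * μ - (α * σ) ^ 2 / 2 + (1 - α) * γ)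
      + ((θ * (α * σ)) ^ 2 + 2 * ρ * (θ * (α * σ)) * (θ * (1 - α) * δ / κ)
        + (θ * (1 - α) * δ / κ) ^ 2) / 2 := by
  unfold growthRate
  field_simp
  ring

/-- Positivity of the wealth, integrability of its utility and the growth rate. -/
theorem IsWealth.growth (hV : IsWealth F P B r μ σ V₀ α V) (hB : IsBrownianWrt F P B)
    (hW : IsBrownianWrt F P W) {ρ : ℝ} (hWB : HasCrossVariation F P W B ρ)
    (hr : IsVasicek F P W κ γ δ r₀ r) (hκ : 0 < κ) (hδ : 0 < δ) (hV₀ : 0 < V₀) {η : ℝ}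
    (hη : η < 1) :
    (∀ᵐ ω ∂P, ∀ t : ℝ≥0, 0 < V t ω) ∧
    (∀ t : ℝ≥0, Integrable (fun ω => haraUtility η (V t ω)) P) ∧
    Tendsto (fun t : ℝ≥0 => 1 / (t : ℝ) * Real.log (∫ ω, haraUtility η (V t ω) ∂P)) atTop
      (𝓝 (growthRate μ σ κ γ δ ρ (1 - η) α)) := by
  have hsol := hV.ae_forall_eq hB hW hr hκ
  set θ : ℝ := 1 - η with hθ
  have hθ0 : 0 < θ := by rw [hθ]; linarith
  set l₁ : ℝ := θ * (α * σ) with hl₁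
  set l₂ : ℝ := θ * (1 - α) * δ / κ with hl₂
  set Q : ℝ := l₁ ^ 2 + 2 * ρ * l₁ * l₂ + l₂ ^ 2 with hQ
  set β : ℝ := θ * (α * μ - (α * σ) ^ 2 / 2 + (1 - α) * γ) with hβ
  set K : ℝ := V₀ ^ θ / θ * Real.exp (θ * (1 - α) * r₀ / κ) with hK
  have hK0 : 0 < K := by
    have : 0 < V₀ ^ θ := Real.rpow_pos_of_pos hV₀ _
    positivity
  set X : ℝ≥0 → Ω → ℝ := fun t ω => l₁ * B t ω + l₂ * W t ω with hX
  set Y : ℝ≥0 → Ω → ℝ := fun t ω => -(θ * (1 - α) / κ) * r t ω with hY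
  have hXm : ∀ t, Measurable (X t) := fun t =>
    ((hB.measurable t).const_mul _).add ((hW.measurable t).const_mul _)
  have hYm : ∀ t, Measurable (Y t) := fun t =>
    ((hr.measurable_filtration t).mono (F.le t) le_rfl).const_mul _
  have eX : ∀ c t ω, c * X t ω = c * l₁ * B t ω + c * l₂ * W t ω := fun c t ω => by
    simp only [hX]; ring
  have eY : ∀ c t ω, c * Y t ω = c * -(θ * (1 - α) / κ) * r t ω := fun c t ω => by
    simp only [hY]; ring
  obtain ⟨hint, hlim⟩ := tendsto_log_integral_exp_add (P := P) hXm hYm (Q := Q)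
    (C := fun c => |c * -(θ * (1 - α) / κ)| * (|γ| + |r₀ - γ|)
      + (c * -(θ * (1 - α) / κ)) ^ 2 * δ ^ 2 / (4 * κ))
    (fun c t => by simp_rw [eX]; exact integrable_exp_pair hB hW _ _ t)
    (fun c t => by
      simp_rw [eX]
      rw [integral_exp_pair hB hW hWB]
      congr 1
      rw [hQ]
      ring)
    (fun c t => by simp_rw [eY]; exact (hr.exp_moment hW hκ _ t).1)
    (fun c t => by simp_rw [eY]; exact (hr.exp_moment hW hκ _ t).2)
  -- Substituting `integratedRate` in the exponent sorts it into the constant `r₀` term (kept in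
  -- `K`), the drift `β t`, the Brownian part `X` and the stationary-type part `Y`.
  have hut : ∀ t : ℝ≥0, (fun ω => haraUtility η (V t ω))
      =ᵐ[P] fun ω => K * Real.exp (β * t) * Real.exp (X t ω + Y t ω) := by
    intro t
    filter_upwards [hsol] with ω hω
    rw [haraUtility, ← hθ, hω t, Real.mul_rpow hV₀.le (Real.exp_pos _).le, ← Real.exp_mul, hK]
    have e1 : (α * σ * B t ω - (α * σ) ^ 2 * t / 2
        + (α * μ * t + (1 - α) * integratedRate W r κ γ δ r₀ t ω)) * θ
        = θ * (1 - α) * r₀ / κ + β * t + (X t ω + Y t ω) := by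
      simp only [integratedRate, hβ, hX, hY, hl₁, hl₂]
      field_simp
      ring
    rw [e1, Real.exp_add, Real.exp_add]
    ring
  refine ⟨?_, fun t => ?_, ?_⟩
  · filter_upwards [hsol] with ω hω t
    rw [hω t]
    positivity
  · exact ((hint t).const_mul _).congr (hut t).symm
  · have hval : ∀ᶠ t : ℝ≥0 in atTop, Real.log K / (t : ℝ) + β
        + 1 / (t : ℝ) * Real.log (∫ ω, Real.exp (X t ω + Y t ω) ∂P)
        = 1 / (t : ℝ) * Real.log (∫ ω, haraUtility η (V t ω) ∂P) := by
      filter_upwards [eventually_gt_atTop 0] with t ht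
      have ht' : (t : ℝ) ≠ 0 := by exact_mod_cast ht.ne'
      rw [integral_congr_ae (hut t), integral_const_mul,
        Real.log_mul (by positivity) (integral_exp_pos (hint t)).ne',
        Real.log_mul hK0.ne' (Real.exp_pos _).ne', Real.log_exp]
      field_simp
    have hz : Tendsto (fun t : ℝ≥0 => Real.log K / (t : ℝ)) atTop (𝓝 0) :=
      tendsto_const_nhds.div_atTop (NNReal.tendsto_coe_atTop.mpr tendsto_id)
    have hres := ((hz.add_const β).add hlim).congr' hval
    rw [growthRate_eq_drift_add hκ hδ]
    rw [zero_add] at hres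
    exact hres

end Wealth

end LongTermGrowth

end

/-! ### The growth rate and its maximizers. -/

theorem mainTheorem3 {Ω : Type*} {mΩ : MeasurableSpace Ω} (P : Measure Ω) [IsProbabilityMeasure P]
    (F : Filtration ℝ≥0 mΩ) (B W r : ℝ≥0 → Ω → ℝ) (V : ℝ → ℝ≥0 → Ω → ℝ)
    (μ σ κ γ δ ρ r₀ V₀ η θ : ℝ)
    (hσ : 0 < σ) (hκ : 0 < κ) (hδ : 0 < δ) (hρ : ρ ∈ Icc (-1 : ℝ) 1) (hV₀ : 0 < V₀)
    (hη : η ∈ Ioo (0 : ℝ) 1) (hθ : θ = 1 - η)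
    (hB : LongTermGrowth.IsBrownianWrt F P B) (hW : LongTermGrowth.IsBrownianWrt F P W)
    (hWB : LongTermGrowth.HasCrossVariation F P W B ρ)
    (hr : LongTermGrowth.IsVasicek F P W κ γ δ r₀ r)
    (hV : ∀ α ∈ Icc (0 : ℝ) 1, LongTermGrowth.IsWealth F P B r μ σ V₀ α (V α)) :
    ∃ Λ : ℝ → ℝ,
      (∀ α ∈ Icc (0 : ℝ) 1,
        (∀ᵐ ω ∂P, ∀ t : ℝ≥0, 0 < V α t ω) ∧
        (∀ t : ℝ≥0, Integrable (fun ω => LongTermGrowth.haraUtility η (V α t ω)) P) ∧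
        Tendsto
          (fun t : ℝ≥0 =>
            1 / (t : ℝ) * Real.log (∫ ω, LongTermGrowth.haraUtility η (V α t ω) ∂P))
          atTop (𝓝 (Λ α)) ∧
        Λ α = κ * γ * (θ * (1 - α) / κ + θ * α * σ * ρ / δ)
          + δ ^ 2 / 2 * (θ * (1 - α) / κ + θ * α * σ * ρ / δ) ^ 2
          - θ * α * σ * κ * γ * ρ / δ
          + 1 / 2 * θ ^ 2 * α ^ 2 * σ ^ 2 * (1 - ρ ^ 2)
          + θ * α * μ - 1 / 2 * θ * α ^ 2 * σ ^ 2) ∧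
      (0 ≤ δ ^ 2 * θ / (2 * κ ^ 2) - δ * θ * σ * ρ / κ + σ ^ 2 * θ / 2 - σ ^ 2 / 2 →
        (1 / 2 * (θ - 1) * σ ^ 2 + μ ≤ γ + δ ^ 2 * θ / (2 * κ ^ 2) →
          LongTermGrowth.IsOptimal Λ 0) ∧
        (1 / 2 * (θ - 1) * σ ^ 2 + μ < γ + δ ^ 2 * θ / (2 * κ ^ 2) →
          LongTermGrowth.IsUniqueOptimal Λ 0) ∧
        (γ + δ ^ 2 * θ / (2 * κ ^ 2) < 1 / 2 * (θ - 1) * σ ^ 2 + μ →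
          LongTermGrowth.IsUniqueOptimal Λ 1)) ∧
      (δ ^ 2 * θ / (2 * κ ^ 2) - δ * θ * σ * ρ / κ + σ ^ 2 * θ / 2 - σ ^ 2 / 2 < 0 →
        ∀ αd : ℝ,
          αd = (-γ * θ + θ * μ + δ * θ ^ 2 * σ * ρ / κ - δ ^ 2 * θ ^ 2 / κ ^ 2) /
            (2 * θ * (-(δ ^ 2 * θ / (2 * κ ^ 2)) + δ * θ * σ * ρ / κ
              - σ ^ 2 * θ / 2 + σ ^ 2 / 2)) →
          (1 ≤ αd → LongTermGrowth.IsUniqueOptimal Λ 1) ∧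
          (αd ∈ Ioo (0 : ℝ) 1 → LongTermGrowth.IsUniqueOptimal Λ αd) ∧
          (αd ≤ 0 → LongTermGrowth.IsUniqueOptimal Λ 0)) := by
  have hθ0 : 0 < θ := by rw [hθ]; linarith [hη.2]
  set Λ : ℝ → ℝ := LongTermGrowth.growthRate μ σ κ γ δ ρ θ with hΛ
  set c₁ : ℝ := -γ * θ + θ * μ + δ * θ ^ 2 * σ * ρ / κ - δ ^ 2 * θ ^ 2 / κ ^ 2 with hc₁
  set D : ℝ := δ ^ 2 * θ / (2 * κ ^ 2) - δ * θ * σ * ρ / κ + σ ^ 2 * θ / 2 - σ ^ 2 / 2 with hD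
  have hquad : ∀ x, Λ x = (γ * θ + δ ^ 2 * θ ^ 2 / (2 * κ ^ 2)) + c₁ * x + (θ * D) * x ^ 2 :=
    fun x => LongTermGrowth.growthRate_eq hκ hδ x
  -- The left side is `Λ 1 - Λ 0`, so the criterion in the convex case compares the two pure
  -- strategies.
  have hsum : c₁ + θ * D
      = θ * ((1 / 2 * (θ - 1) * σ ^ 2 + μ) - (γ + δ ^ 2 * θ / (2 * κ ^ 2))) := by
    rw [hc₁, hD]
    field_simp
    ring
  refine ⟨Λ, fun α hα => ?_, fun hD0 => ⟨fun h => ?_, fun h => ?_, fun h => ?_⟩,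
    fun hD0 αd hαd => ?_⟩
  · obtain ⟨h1, h2, h3⟩ := (hV α hα).growth hB hW hWB hr hκ hδ hV₀ hη.2
    rw [← hθ] at h3
    exact ⟨h1, h2, h3, rfl⟩
  · refine LongTermGrowth.isOptimal_zero_of_convex hquad (by positivity) ?_
    rw [hsum]
    exact mul_nonpos_of_nonneg_of_nonpos hθ0.le (by linarith)
  · refine LongTermGrowth.isUniqueOptimal_zero_of_convex hquad (by positivity) ?_
    rw [hsum]
    exact mul_neg_of_pos_of_neg hθ0 (by linarith)
  · refine LongTermGrowth.isUniqueOptimal_one_of_convex hquad (by positivity) ?_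
    rw [hsum]
    exact mul_pos hθ0 (by linarith)
  · have hneg : θ * D < 0 := mul_neg_of_pos_of_neg hθ0 hD0
    -- `αd` is the vertex of the concave parabola. The slope at `p` is therefore the positive number
    -- `-2 θ D` times `αd - p`, which decides each of the three positions of the vertex.
    have hvertex : c₁ = -(2 * (θ * D)) * αd := by
      have hden : 2 * θ * (-(δ ^ 2 * θ / (2 * κ ^ 2)) + δ * θ * σ * ρ / κ
          - σ ^ 2 * θ / 2 + σ ^ 2 / 2) = -(2 * (θ * D)) := by
        rw [hD]
        ring
      rw [hden] at hαd
      have hne : -(2 * (θ * D)) ≠ 0 := neg_ne_zero.mpr (mul_ne_zero two_ne_zero hneg.ne)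
      rw [hαd, mul_div_assoc', mul_div_cancel_left₀ _ hne]
    refine ⟨fun h => ?_, fun h => ?_, fun h => ?_⟩
    · refine LongTermGrowth.isUniqueOptimal_of_concave hquad hneg ⟨zero_le_one, le_rfl⟩
        fun b hb => ?_
      have e : (c₁ + 2 * (θ * D) * 1) * (b - 1) = (-(2 * (θ * D)) * (αd - 1)) * (b - 1) := by
        rw [hvertex]; ring
      rw [e]
      refine mul_nonpos_of_nonneg_of_nonpos (mul_nonneg ?_ ?_) ?_
      · linarith
      · linarith
      · linarith [hb.2]
    · refine LongTermGrowth.isUniqueOptimal_of_concave hquad hneg ⟨h.1.le, h.2.le⟩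
        fun b _ => ?_
      have e : (c₁ + 2 * (θ * D) * αd) * (b - αd) = 0 := by rw [hvertex]; ring
      exact e.le
    · refine LongTermGrowth.isUniqueOptimal_of_concave hquad hneg ⟨le_rfl, zero_le_one⟩
        fun b hb => ?_
      have e : (c₁ + 2 * (θ * D) * 0) * (b - 0) = (-(2 * (θ * D)) * b) * αd := by
        rw [hvertex]; ring
      rw [e]
      refine mul_nonpos_of_nonneg_of_nonpos (mul_nonneg ?_ hb.1) h
      linarith
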